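/- **Setting.** Let $\epsilon,\delta>0$, let $m\ge 1$ be an integer, let $J\subseteq\mathbb R$ be an open set of times, let $I_z\subseteq\mathbb R$ be open and let $\pi:I_z\to(0,\infty)$ be a (measurable) probability density. Put $M(v)=\frac1{\sqrt{2\pi}}e^{-v^2/2}$ and $\mathcal L h=\frac1{\sqrt M}\,\partial_v\!\big(M\,\partial_v(h/\sqrt M)\big)$. Consider $h=h(t,x,v,z)$ and $\phi=\phi(t,x,z)$ with $t\in J$, $x,v\in\mathbb R$, $z\in I_z$, and set $$\sigma=\int_{\mathbb R}h\sqrt M\,dv,\qquad u=\int_{\mathbb R}h\,v\sqrt M\,dv,\qquad (1-\Pi)h=h-\sigma\sqrt M-u\,v\sqrt M .$$ The rescaled microscopic Vlasov–Poisson–Fokker–Planck system is $$\epsilon\delta\,\partial_t h+\epsilon v\,\partial_x h-\delta\,\partial_x\phi\,\partial_v h+\delta\tfrac v2\,\partial_x\phi\,h+\delta v\sqrt M\,\partial_x\phi=\mathcal L h,\qquad \partial_x^2\phi=-\sigma .\tag{S}$$ Norms: $\langle\cdot,\cdot\rangle$ and $\|\cdot\|$ are the inner product and norm of $L^2$ for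 $d\mu=\pi(z)\,dx\,dv\,dz$ (functions of $x,v,z$) or $d\mu=\pi(z)\,dx\,dz$ (functions of $x,z$); $\|F\|_\nu^2=\int\big((1+v^2)F^2+(\partial_vF)^2\big)d\mu(x,v,z)$; and $\|F\|^2_{H^m_z(H^1_x)}=\sum_{i\le1}\sum_{l\le m}\|\partial_z^l\partial_x^iF\|^2$. Energies and dissipations (at time $t$): $$E_h^m=\|h\|^2_{H^m_z(H^1_x)},\qquad E_\phi^m=D_\phi^m=\|\partial_x\phi\|^2_{H^m_z(H^1_x)},$$ $$D_u^m=\|u\|^2_{H^m_z(H^1_x)},\qquad D_\sigma^m=\|\sigma\|^2_{H^m_z(H^1_x)},\qquad D_h^m=\sum_{i\le1}\sum_{l\le m}\|\partial_z^l\partial_x^i(1-\Pi)h\|_\nu^2 .$$ Constants: $\lambda_0=\frac17$ and $A=A(m)=2\sqrt{m+1}\binom{m}{\lceil m/2\rceil}+\sqrt{m+1}$. $C_1\ge1$ is a constant of the one-dimensional Sobolev embedding in $z$, i.e. $\sup_{I_z}|f|\le C_1\big(\int_{I_z}(f^2+f'^2)\,\pi\,dz\big)^{1/2}$ for all $f\in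 C^1(I_z)$ for which the right-hand side is finite. Solutions: $(h,\phi)$ solves (S) pointwise for $t\in J$ and satisfies the following. * All mixed partial derivatives of $h$ and $\phi$ of order at most $m$ in $z$ and of total order at most $3$ in the other variables exist, do not depend on the order of differentiation, are continuous, and grow at most polynomially in $v$, locally uniformly in $(t,x,z)$. * For all $t\in J$, $l\le m$, $i\le 1$: $\partial_z^l\partial_x^ih$, $v\,\partial_z^l\partial_x^ih$, $\partial_v\partial_z^l\partial_x^ih$ and $\partial_z^l\partial_x^i\partial_x\phi$ are in $L^2(d\mu)$. * For all $l\le m$, $i\le 1$, the maps $t\mapsto\partial_z^l\partial_x^ih(t)$ and $t\mapsto\partial_z^l\partial_x^i\partial_x\phi(t)$ are differentiable from $J$ into $L^2(d\mu)$, with derivative the pointwise time derivative. **Lemma.** For every $m\ge1$ and every such solution, the quantities in square brackets below are differentiable in $t$ on $J$, and for all $t\in J$ and every $a>0$ $$\begin{aligned} &\tfrac12\partial_t\Big[E_h^m+\tfrac\delta\epsilon E_\phi^m\Big]+\frac{\lambda_0}{\delta\epsilon}D_h^m+\frac1{\delta\epsilon}D_u^m\\ &\quad\le\frac{AC_1^2}{a\epsilon}\sqrt{E_h^m}\,\big(3D_u^m+2D_h^m\big)+\frac{2AC_1^2}{\epsilon}\sqrt{E_\phi^m}\,\Big(\big(4+\tfrac1a\big)D_u^m+4D_h^m\Big)\\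 &\qquad+\frac{aAC_1^2}{\epsilon}\sqrt{E_h^m}\,D_\phi^m+\frac{aAC_1^2}{\epsilon}\sqrt{E_\phi^m}\,D_\sigma^m , \end{aligned}$$ and $$\begin{aligned} &\partial_t\Big[\sum_{l=0}^{m}\langle\partial_z^lu,\partial_z^l\partial_x\phi\rangle+\sum_{l=0}^m\langle\partial_z^l\partial_xu,\partial_z^l\partial_x^2\phi\rangle+\frac1{2\epsilon}E_\phi^m\Big]+\frac1{2\delta}D_\sigma^m+\frac1\epsilon D_\phi^m\\ &\quad\le\frac1\delta D_u^m+\frac1{2\delta}D_h^m+\frac{AC_1^2}{\epsilon}\sqrt{E_\phi^m}\,\big(3D_\sigma^m+2D_\phi^m\big). \end{aligned}$$ -/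

import Mathlib

open MeasureTheory Filter Topology Set

noncomputable section

namespace VPFP

/-! Functions of the kinetic variables are written `F t x v z`; macroscopic functions `G t x z`. -/

/-- The global Maxwellian `M(v) = (2π)^{-1/2} exp(-v²/2)`. -/
def maxwellian (v : ℝ) : ℝ := 1 / Real.sqrt (2 * Real.pi) * Real.exp (-(v ^ 2) / 2)

/-- `√M`. -/
def sqrtM (v : ℝ) : ℝ := Real.sqrt (maxwellian v)

/-- The linearized Fokker-Planck operator `𝓛 g = M^{-1/2} ∂_v (M ∂_v (g / M^{1/2}))`. -/
def linFP (g : ℝ → ℝ) (v : ℝ) : ℝ :=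
  1 / sqrtM v * deriv (fun v' => maxwellian v' * deriv (fun w => g w / sqrtM w) v') v

/-- The law `π(z) dz` of the random variable on `I_z`. -/
def zMeasure (Iz : Set ℝ) (dens : ℝ → ℝ) : Measure ℝ :=
  (volume.restrict Iz).withDensity (fun z => ENNReal.ofReal (dens z))

/-- `dμ(x,z) = π(z) dx dz`. -/
def xzMeasure (Iz : Set ℝ) (dens : ℝ → ℝ) : Measure (ℝ × ℝ) :=
  (volume : Measure ℝ).prod (zMeasure Iz dens)

/-- `dμ(x,v,z) = π(z) dx dv dz`. -/
def xvzMeasure (Iz : Set ℝ) (dens : ℝ → ℝ) : Measure (ℝ × ℝ × ℝ) :=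
  (volume : Measure ℝ).prod ((volume : Measure ℝ).prod (zMeasure Iz dens))

/-- `π` is a positive probability density on the open set `I_z`. -/
structure IsDensity (Iz : Set ℝ) (dens : ℝ → ℝ) : Prop where
  isOpen : IsOpen Iz
  measurable : Measurable dens
  pos : ∀ z ∈ Iz, 0 < dens z
  prob : IsProbabilityMeasure (zMeasure Iz dens)

/-- `C₁ ≥ 1` is a constant of the Sobolev embedding `H¹_z ⊂ C⁰_z` for the measure `π(z) dz`:
`sup |f| ≤ C₁ ‖f‖_{H¹_z}`. The inequality is only required for continuously differentiable `f`
of finite `H¹_z` norm. -/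
def IsSobolevConst (Iz : Set ℝ) (dens : ℝ → ℝ) (C₁ : ℝ) : Prop :=
  1 ≤ C₁ ∧ ∀ f f' : ℝ → ℝ, (∀ z ∈ Iz, HasDerivAt f (f' z) z) → ContinuousOn f' Iz →
    MemLp f 2 (zMeasure Iz dens) → MemLp f' 2 (zMeasure Iz dens) →
    ∀ z ∈ Iz, |f z| ≤ C₁ * Real.sqrt (∫ y, (f y ^ 2 + f' y ^ 2) ∂(zMeasure Iz dens))

/-- The density fluctuation `σ = ∫ h √M dv`. -/
def sigma (h : ℝ → ℝ → ℝ → ℝ → ℝ) (t x z : ℝ) : ℝ := ∫ v, h t x v z * sqrtM v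

/-- The velocity fluctuation `u = ∫ h v √M dv`. -/
def vel (h : ℝ → ℝ → ℝ → ℝ → ℝ) (t x z : ℝ) : ℝ := ∫ v, h t x v z * (v * sqrtM v)

/-- `(1 - Π) h = h - σ √M - u v √M`. -/
def micro (h : ℝ → ℝ → ℝ → ℝ → ℝ) (t x v z : ℝ) : ℝ :=
  h t x v z - sigma h t x z * sqrtM v - vel h t x z * (v * sqrtM v)

/-- `∂_z^l ∂_x^i F` for `F(t,x,v,z)`. -/
def dzx (l i : ℕ) (F : ℝ → ℝ → ℝ → ℝ → ℝ) (t x v z : ℝ) : ℝ :=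
  iteratedDeriv l (fun z' => iteratedDeriv i (fun x' => F t x' v z') x) z

/-- `∂_z^l ∂_x^i G` for `G(t,x,z)`. -/
def dzxMac (l i : ℕ) (G : ℝ → ℝ → ℝ → ℝ) (t x z : ℝ) : ℝ :=
  iteratedDeriv l (fun z' => iteratedDeriv i (fun x' => G t x' z') x) z

/-- `∂_x φ`. -/
def gradPhi (φ : ℝ → ℝ → ℝ → ℝ) (t x z : ℝ) : ℝ := deriv (fun x' => φ t x' z) x

/-- `‖F‖²` in `L²(dμ(x,v,z))`. -/
def normSq (Iz : Set ℝ) (dens : ℝ → ℝ) (F : ℝ → ℝ → ℝ → ℝ) : ℝ :=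
  ∫ p, F p.1 p.2.1 p.2.2 ^ 2 ∂(xvzMeasure Iz dens)

/-- `‖F‖²_ν = ∫ ((1 + v²) F² + (∂_v F)²) dμ(x,v,z)`. -/
def nuNormSq (Iz : Set ℝ) (dens : ℝ → ℝ) (F : ℝ → ℝ → ℝ → ℝ) : ℝ :=
  ∫ p, ((1 + p.2.1 ^ 2) * F p.1 p.2.1 p.2.2 ^ 2
    + deriv (fun v => F p.1 v p.2.2) p.2.1 ^ 2) ∂(xvzMeasure Iz dens)

/-- `⟨G, K⟩` in `L²(dμ(x,z))`. -/
def innerMac (Iz : Set ℝ) (dens : ℝ → ℝ) (G K : ℝ → ℝ → ℝ) : ℝ :=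
  ∫ p, G p.1 p.2 * K p.1 p.2 ∂(xzMeasure Iz dens)

/-- `‖G‖²` in `L²(dμ(x,z))`. -/
def normSqMac (Iz : Set ℝ) (dens : ℝ → ℝ) (G : ℝ → ℝ → ℝ) : ℝ :=
  innerMac Iz dens G G

/-- `‖G(t)‖²_{H^m_z(H¹_x)}` for macroscopic `G`. -/
def sobSqMac (Iz : Set ℝ) (dens : ℝ → ℝ) (m : ℕ) (G : ℝ → ℝ → ℝ → ℝ) (t : ℝ) : ℝ :=
  ∑ i ∈ Finset.range 2, ∑ l ∈ Finset.range (m + 1), normSqMac Iz dens (dzxMac l i G t)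

/-- `E_h^m = ‖h‖²_{H^m_z(H¹_x)}`. -/
def Eh (Iz : Set ℝ) (dens : ℝ → ℝ) (m : ℕ) (h : ℝ → ℝ → ℝ → ℝ → ℝ) (t : ℝ) : ℝ :=
  ∑ i ∈ Finset.range 2, ∑ l ∈ Finset.range (m + 1), normSq Iz dens (dzx l i h t)

/-- `E_φ^m = ‖∂_x φ‖²_{H^m_z(H¹_x)}`. -/
def Ephi (Iz : Set ℝ) (dens : ℝ → ℝ) (m : ℕ) (φ : ℝ → ℝ → ℝ → ℝ) (t : ℝ) : ℝ :=
  sobSqMac Iz dens m (gradPhi φ) t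

/-- `D_h^m = ∑_{i ≤ 1} ∑_{l ≤ m} ‖∂_z^l ∂_x^i (1 - Π) h‖²_ν`. -/
def Dh (Iz : Set ℝ) (dens : ℝ → ℝ) (m : ℕ) (h : ℝ → ℝ → ℝ → ℝ → ℝ) (t : ℝ) : ℝ :=
  ∑ i ∈ Finset.range 2, ∑ l ∈ Finset.range (m + 1), nuNormSq Iz dens (dzx l i (micro h) t)

/-- `D_φ^m = ‖∂_x φ‖²_{H^m_z(H¹_x)}`. -/
def Dphi (Iz : Set ℝ) (dens : ℝ → ℝ) (m : ℕ) (φ : ℝ → ℝ → ℝ → ℝ) (t : ℝ) : ℝ :=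
  sobSqMac Iz dens m (gradPhi φ) t

/-- `D_u^m = ‖u‖²_{H^m_z(H¹_x)}`. -/
def Du (Iz : Set ℝ) (dens : ℝ → ℝ) (m : ℕ) (h : ℝ → ℝ → ℝ → ℝ → ℝ) (t : ℝ) : ℝ :=
  sobSqMac Iz dens m (vel h) t

/-- `D_σ^m = ‖σ‖²_{H^m_z(H¹_x)}`. -/
def Dsigma (Iz : Set ℝ) (dens : ℝ → ℝ) (m : ℕ) (h : ℝ → ℝ → ℝ → ℝ → ℝ) (t : ℝ) : ℝ :=
  sobSqMac Iz dens m (sigma h) t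

/-- The functional under the time derivative in the macroscopic inequality:
`∑_{l ≤ m} ⟨∂_z^l u, ∂_z^l ∂_x φ⟩ + ∑_{l ≤ m} ⟨∂_z^l ∂_x u, ∂_z^l ∂_x² φ⟩ + E_φ^m / (2ε)`. -/
def Gmac (Iz : Set ℝ) (dens : ℝ → ℝ) (m : ℕ) (ε : ℝ) (h : ℝ → ℝ → ℝ → ℝ → ℝ)
    (φ : ℝ → ℝ → ℝ → ℝ) (t : ℝ) : ℝ :=
  ∑ l ∈ Finset.range (m + 1),
      innerMac Iz dens (dzxMac l 0 (vel h) t) (dzxMac l 0 (gradPhi φ) t)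
    + ∑ l ∈ Finset.range (m + 1),
      innerMac Iz dens (dzxMac l 1 (vel h) t) (dzxMac l 1 (gradPhi φ) t)
    + 1 / (2 * ε) * Ephi Iz dens m φ t

/-- `A(m) = 2 √(m+1) * binom(m, ⌈m/2⌉) + √(m+1)`; here `⌈m/2⌉` is the natural number
`(m + 1) / 2`. -/
def constA (m : ℕ) : ℝ :=
  2 * Real.sqrt (m + 1) * (m.choose ((m + 1) / 2) : ℝ) + Real.sqrt (m + 1)

/-- The hypocoercivity constant in one dimension. -/
def lambda0 : ℝ := 1 / 7

/-- `F` is regular of order `m` in `z` on `J × ℝ × ℝ × I_z`: all mixed partial derivatives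
`∂_z^l ∂_t^k ∂_x^i ∂_v^j F` with `l ≤ m` and `k + i + j ≤ 3` exist (independently of the order of
differentiation), are continuous, and grow at most polynomially in `v`, locally uniformly in
`(t,x,z)`. The function `D k i j l` is that partial derivative. -/
def MixedRegular (J Iz : Set ℝ) (m : ℕ) (F : ℝ → ℝ → ℝ → ℝ → ℝ) : Prop :=
  ∃ D : ℕ → ℕ → ℕ → ℕ → ℝ → ℝ → ℝ → ℝ → ℝ,
    D 0 0 0 0 = F ∧
    (∀ k i j l, k + i + j ≤ 3 → l ≤ m →
      ContinuousOn (fun p : ℝ × ℝ × ℝ × ℝ => D k i j l p.1 p.2.1 p.2.2.1 p.2.2.2)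
        (J ×ˢ (univ ×ˢ (univ ×ˢ Iz)))) ∧
    (∀ k i j l, k + i + j ≤ 3 → l ≤ m →
      ∀ K : Set (ℝ × ℝ × ℝ), IsCompact K → K ⊆ J ×ˢ (univ ×ˢ Iz) →
        ∃ (C : ℝ) (N : ℕ), ∀ p ∈ K, ∀ v : ℝ,
          |D k i j l p.1 p.2.1 v p.2.2| ≤ C * (1 + |v|) ^ N) ∧
    (∀ k i j l, k + i + j < 3 → l ≤ m → ∀ t ∈ J, ∀ x v : ℝ, ∀ z ∈ Iz,
      HasDerivAt (fun s => D k i j l s x v z) (D (k + 1) i j l t x v z) t ∧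
      HasDerivAt (fun y => D k i j l t y v z) (D k (i + 1) j l t x v z) x ∧
      HasDerivAt (fun w => D k i j l t x w z) (D k i (j + 1) l t x v z) v) ∧
    (∀ k i j l, k + i + j ≤ 3 → l < m → ∀ t ∈ J, ∀ x v : ℝ, ∀ z ∈ Iz,
      HasDerivAt (fun y => D k i j l t x v y) (D k i j (l + 1) t x v z) z)

/-- `(h, φ)` is a classical solution, of finite energy and dissipation of order `m`, of the
microscopic system
`εδ ∂_t h + ε v ∂_x h - δ ∂_xφ ∂_v h + δ (v/2) ∂_xφ h + δ v √M ∂_xφ = 𝓛 h`, `∂_x² φ = -σ`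
for times `t ∈ J`; as curves in `H^m_z(H¹_x)`, both `h` and `∂_x φ` are differentiable in time. -/
structure IsSolution (m : ℕ) (ε δ : ℝ) (J Iz : Set ℝ) (dens : ℝ → ℝ)
    (h : ℝ → ℝ → ℝ → ℝ → ℝ) (φ : ℝ → ℝ → ℝ → ℝ) : Prop where
  regular_h : MixedRegular J Iz m h
  regular_phi : MixedRegular J Iz m (fun t x _ z => φ t x z)
  kinetic : ∀ t ∈ J, ∀ x v : ℝ, ∀ z ∈ Iz,
    ε * δ * deriv (fun s => h s x v z) t + ε * (v * deriv (fun y => h t y v z) x)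
      - δ * (gradPhi φ t x z * deriv (fun w => h t x w z) v)
      + δ * (v / 2 * gradPhi φ t x z * h t x v z)
      + δ * (v * sqrtM v * gradPhi φ t x z)
      = linFP (fun w => h t x w z) v
  poisson : ∀ t ∈ J, ∀ x : ℝ, ∀ z ∈ Iz,
    iteratedDeriv 2 (fun y => φ t y z) x = - sigma h t x z
  /-- finite energy of `h` -/
  energy_h : ∀ t ∈ J, ∀ i ≤ 1, ∀ l ≤ m,
    MemLp (fun p : ℝ × ℝ × ℝ => dzx l i h t p.1 p.2.1 p.2.2) 2 (xvzMeasure Iz dens)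
  /-- finite `ν`-norms, velocity weight -/
  weight_h : ∀ t ∈ J, ∀ i ≤ 1, ∀ l ≤ m,
    MemLp (fun p : ℝ × ℝ × ℝ => p.2.1 * dzx l i h t p.1 p.2.1 p.2.2) 2 (xvzMeasure Iz dens)
  /-- finite `ν`-norms, velocity derivative -/
  dv_h : ∀ t ∈ J, ∀ i ≤ 1, ∀ l ≤ m,
    MemLp (fun p : ℝ × ℝ × ℝ => deriv (fun v => dzx l i h t p.1 v p.2.2) p.2.1) 2
      (xvzMeasure Iz dens)
  /-- finite energy of `∂_x φ` -/
  energy_phi : ∀ t ∈ J, ∀ i ≤ 1, ∀ l ≤ m,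
    MemLp (fun p : ℝ × ℝ => dzxMac l i (gradPhi φ) t p.1 p.2) 2 (xzMeasure Iz dens)
  /-- time differentiability of `h` in `H^m_z(H¹_x)` -/
  dt_h : ∀ t ∈ J, ∀ i ≤ 1, ∀ l ≤ m,
    MemLp (fun p : ℝ × ℝ × ℝ => deriv (fun s => dzx l i h s p.1 p.2.1 p.2.2) t) 2
      (xvzMeasure Iz dens) ∧
    Tendsto (fun s => eLpNorm (fun p : ℝ × ℝ × ℝ =>
        (dzx l i h s p.1 p.2.1 p.2.2 - dzx l i h t p.1 p.2.1 p.2.2) / (s - t)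
          - deriv (fun r => dzx l i h r p.1 p.2.1 p.2.2) t) 2 (xvzMeasure Iz dens))
      (𝓝[≠] t) (𝓝 0)
  /-- time differentiability of `∂_x φ` in `H^m_z(H¹_x)` -/
  dt_phi : ∀ t ∈ J, ∀ i ≤ 1, ∀ l ≤ m,
    MemLp (fun p : ℝ × ℝ => deriv (fun s => dzxMac l i (gradPhi φ) s p.1 p.2) t) 2
      (xzMeasure Iz dens) ∧
    Tendsto (fun s => eLpNorm (fun p : ℝ × ℝ =>
        (dzxMac l i (gradPhi φ) s p.1 p.2 - dzxMac l i (gradPhi φ) t p.1 p.2) / (s - t)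
          - deriv (fun r => dzxMac l i (gradPhi φ) r p.1 p.2) t) 2 (xzMeasure Iz dens))
      (𝓝[≠] t) (𝓝 0)

end VPFP

end

open scoped ENNReal

noncomputable section

namespace VPFP
/-! ### The Maxwellian -/

/-! The argument is a weighted energy method. Write `a = ∂_v + v/2`, so that `𝓛 = -a*a`, `a √M = 0`
and `a (v√M) = √M`, and let `F = ∂_x φ`. Every estimate is made for `∂_x^i ∂_z^l` of the equations
with `i ≤ 1`, `l ≤ m`, and then summed.

Microscopic inequality. Testing the differentiated kinetic equation with `∂h` gives `-‖a ∂h‖²` from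
collisions. Since `a h = a(1-Π)h + u√M` and these two pieces are orthogonal, `‖a h‖² = ‖a(1-Π)h‖² +
‖u‖²`. The Gaussian Poincaré inequality (`integral_sq_le_integral_creation_sq`) bounds the first
piece below by `λ₀ ‖(1-Π)h‖_ν²` (`lambda0_mul_integral_le`). The linear field term produces `⟨u,
F⟩`. Mass conservation and the Poisson equation make `δ ∂_t F - u` constant in `x`; being square
integrable on the line for almost every `z`, it vanishes. This Ampère law (`EnergyData.ampere`)
turns `⟨u, F⟩` into the time derivative of the field energy.

After integration by parts in `v`, the quadratic force term is `⟨F h, a h⟩` (with Leibniz sums).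
Splitting `h = σ√M + (h - σ√M)` and `a h = u√M + a(1-Π)h`, the mixed pairings vanish because `h -
σ√M` and `a(1-Π)h` are orthogonal to `√M`. What remains is `F σ u` and `F (h - σ√M) a(1-Π)h`; `h -
σ√M` is controlled by `u` and `(1-Π)h`, so every remaining product contains two dissipated factors
and one factor `F`. The terms with `√E_h` in the claimed bound are therefore slack.

Macroscopic inequality. The velocity moment of the equation against `v√M` is a momentum balance.
Tested with `F`, its pressure term becomes `⟨P, σ⟩` because `∂_x F = -σ`, and `P = σ +` a moment of
`(1-Π)h`; this yields the dissipation of `σ`. The term `δF` yields that of `F`. By Ampère's law the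
friction term `⟨u, F⟩` is the time derivative that accounts for `E_φ/(2ε)`, and `⟨u, ∂_t F⟩ =
‖u‖²/δ`.

Both quadratic errors are covered by one trilinear estimate (`abs_trilinear_le`). In each Leibniz
product the factor with fewer `z`-derivatives pays for the Sobolev embedding in `z`, at the cost of
one extra `z`-derivative; in `x` the embedding on the line is used with constant `1/√2`. The sum
over `l` is then a truncated discrete convolution, bounded by Young's inequality `ℓ¹ * ℓ² ⊂ ℓ²` and
by the central binomial coefficient, which gives `2A C₁²`.

Two analytic points need care. Second derivatives in `x` and `v` are not known to be square
integrable, so each integration by parts uses a divergence theorem in which only the flux and the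
full divergence are integrable; the latter is supplied by the equation. Time derivatives of the
functionals come from differentiability in the Hilbert space `L²`. -/

theorem maxwellian_pos (v : ℝ) : 0 < maxwellian v := by
  unfold maxwellian; positivity

theorem sqrtM_pos (v : ℝ) : 0 < sqrtM v := Real.sqrt_pos.2 (maxwellian_pos v)

theorem sqrtM_mul_self (v : ℝ) : sqrtM v * sqrtM v = maxwellian v :=
  Real.mul_self_sqrt (maxwellian_pos v).le

theorem hasDerivAt_maxwellian (v : ℝ) : HasDerivAt maxwellian (-v * maxwellian v) v := by
  have h1 : HasDerivAt (fun v : ℝ => -(v ^ 2) / 2) (-v) v := by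
    have := ((hasDerivAt_pow 2 v).neg.div_const 2)
    exact this.congr_deriv (by push_cast; ring)
  have h2 := h1.exp.const_mul (1 / Real.sqrt (2 * Real.pi))
  exact h2.congr_deriv (by unfold maxwellian; ring)

theorem hasDerivAt_sqrtM (v : ℝ) : HasDerivAt sqrtM (-(v / 2) * sqrtM v) v := by
  have h := (hasDerivAt_maxwellian v).sqrt (maxwellian_pos v).ne'
  have hs := (sqrtM_pos v).ne'
  unfold sqrtM
  convert h using 1
  have h2 : Real.sqrt (maxwellian v) = sqrtM v := rfl
  rw [h2, ← sqrtM_mul_self]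
  field_simp

theorem continuous_sqrtM : Continuous sqrtM :=
  continuous_iff_continuousAt.2 fun v => (hasDerivAt_sqrtM v).continuousAt

theorem continuous_maxwellian : Continuous maxwellian :=
  continuous_iff_continuousAt.2 fun v => (hasDerivAt_maxwellian v).continuousAt

/-- A continuous weight that decays faster than any polynomial. -/
structure Rapid (ψ : ℝ → ℝ) : Prop where
  cont : Continuous ψ
  integrable : ∀ N : ℕ, Integrable fun v => (1 + |v|) ^ N * |ψ v|

theorem Rapid.mul_id {ψ : ℝ → ℝ} (h : Rapid ψ) : Rapid fun v => v * ψ v := by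
  refine ⟨continuous_id.mul h.cont, fun N => ?_⟩
  refine (h.integrable (N + 1)).mono' ?_ (Eventually.of_forall fun v => ?_)
  · have := h.cont
    exact Continuous.aestronglyMeasurable (by fun_prop)
  · rw [abs_mul, Real.norm_eq_abs, abs_of_nonneg (by positivity), pow_succ, mul_assoc]
    gcongr
    linarith [abs_nonneg v]

theorem Rapid.const_mul {ψ : ℝ → ℝ} (h : Rapid ψ) (c : ℝ) : Rapid fun v => c * ψ v := by
  refine ⟨continuous_const.mul h.cont, fun N => ?_⟩
  refine ((h.integrable N).const_mul |c|).congr (Eventually.of_forall fun v => ?_)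
  simp only [abs_mul]; ring

theorem Rapid.add {ψ χ : ℝ → ℝ} (h : Rapid ψ) (h' : Rapid χ) : Rapid fun v => ψ v + χ v := by
  refine ⟨h.cont.add h'.cont, fun N => ?_⟩
  refine ((h.integrable N).add (h'.integrable N)).mono' ?_ (Eventually.of_forall fun v => ?_)
  · have := h.cont
    have := h'.cont
    exact Continuous.aestronglyMeasurable (by fun_prop)
  · rw [Real.norm_eq_abs, abs_of_nonneg (by positivity), Pi.add_apply, ← mul_add]
    gcongr
    exact abs_add_le _ _

/-- Continuity and polynomial growth in the velocity variable. -/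
structure PolyGrowth (f : ℝ → ℝ) : Prop where
  cont : Continuous f
  bound : ∃ (C : ℝ) (N : ℕ), ∀ v, |f v| ≤ C * (1 + |v|) ^ N

theorem Rapid.integrable_mul {ψ f : ℝ → ℝ} (h : Rapid ψ) (hf : PolyGrowth f) :
    Integrable fun v => f v * ψ v := by
  obtain ⟨C, N, hC⟩ := hf.bound
  refine ((h.integrable N).const_mul C).mono' (hf.cont.mul h.cont).aestronglyMeasurable
    (Eventually.of_forall fun v => ?_)
  rw [Real.norm_eq_abs, abs_mul, ← mul_assoc]
  gcongr
  exact hC v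

theorem integrable_one_add_abs_pow_mul_exp (N : ℕ) {b : ℝ} (hb : 0 < b) :
    Integrable fun v : ℝ => (1 + |v|) ^ N * Real.exp (-b * v ^ 2) := by
  have h0 := integrable_exp_neg_mul_sq hb
  have h1 := integrable_rpow_mul_exp_neg_mul_sq hb
    (s := (N : ℝ)) (by have : (0 : ℝ) ≤ N := Nat.cast_nonneg N; linarith)
  refine ((h0.add h1.norm).const_mul (2 ^ N)).mono' ?_ (Eventually.of_forall fun v => ?_)
  · exact Continuous.aestronglyMeasurable (by fun_prop)
  · simp only [Pi.add_apply, Real.rpow_natCast, norm_mul, Real.norm_eq_abs, abs_pow, Real.abs_exp]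
    rw [abs_of_nonneg (by positivity : 0 ≤ 1 + |v|)]
    -- The larger of `1` and `|v|` dominates half of `1 + |v|`, which separates the power into two
    -- Gaussian moments.
    have h2 : (1 + |v|) ^ N ≤ 2 ^ N * (1 + |v| ^ N) := by
      rcases le_total |v| 1 with hv | hv
      · calc (1 + |v|) ^ N ≤ 2 ^ N := by gcongr; linarith
          _ ≤ 2 ^ N * (1 + |v| ^ N) := by
            have : (0 : ℝ) ≤ 2 ^ N * |v| ^ N := by positivity
            linarith
      · calc (1 + |v|) ^ N ≤ (2 * |v|) ^ N := by gcongr; linarith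
          _ ≤ 2 ^ N * (1 + |v| ^ N) := by
            rw [mul_pow]; gcongr; linarith
    calc (1 + |v|) ^ N * Real.exp (-b * v ^ 2)
        ≤ (2 ^ N * (1 + |v| ^ N)) * Real.exp (-b * v ^ 2) := by gcongr
      _ = _ := by ring

theorem sqrtM_eq (v : ℝ) :
    sqrtM v = Real.sqrt (1 / Real.sqrt (2 * Real.pi)) * Real.exp (-(1 / 4) * v ^ 2) := by
  unfold sqrtM maxwellian
  rw [Real.sqrt_mul (by positivity)]
  congr 1
  rw [Real.sqrt_eq_iff_mul_self_eq (Real.exp_nonneg _) (Real.exp_nonneg _), ← Real.exp_add]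
  congr 1; ring

theorem rapid_sqrtM : Rapid sqrtM := by
  refine ⟨continuous_sqrtM, fun N => ?_⟩
  refine ((integrable_one_add_abs_pow_mul_exp N (b := 1 / 4) (by norm_num)).const_mul
    (Real.sqrt (1 / Real.sqrt (2 * Real.pi)))).congr (Eventually.of_forall fun v => ?_)
  simp only [abs_of_pos (sqrtM_pos v)]
  rw [sqrtM_eq]; ring

theorem rapid_maxwellian : Rapid maxwellian := by
  refine ⟨continuous_maxwellian, fun N => ?_⟩
  refine ((integrable_one_add_abs_pow_mul_exp N (b := 1 / 2) (by norm_num)).const_mul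
    (1 / Real.sqrt (2 * Real.pi))).congr (Eventually.of_forall fun v => ?_)
  simp only [abs_of_pos (maxwellian_pos v)]
  rw [maxwellian, show -(v ^ 2) / 2 = -(1 / 2) * v ^ 2 by ring]; ring

theorem Rapid.integrable' {ψ : ℝ → ℝ} (h : Rapid ψ) : Integrable ψ := by
  have := h.integrable 0
  simp only [pow_zero, one_mul] at this
  exact (integrable_norm_iff h.cont.aestronglyMeasurable).1 this

theorem integral_maxwellian : ∫ v, maxwellian v = 1 := by
  unfold maxwellian
  rw [integral_const_mul]
  have : ∀ v : ℝ, Real.exp (-(v ^ 2) / 2) = Real.exp (-(1 / 2) * v ^ 2) := fun v => by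
    congr 1; ring
  simp_rw [this]
  rw [integral_gaussian, show Real.pi / (1 / 2) = 2 * Real.pi by ring]
  have : Real.sqrt (2 * Real.pi) ≠ 0 := (Real.sqrt_pos.2 (by positivity)).ne'
  field_simp

theorem integral_id_mul_maxwellian : ∫ v, v * maxwellian v = 0 := by
  have h := integral_eq_zero_of_hasDerivAt_of_integrable hasDerivAt_maxwellian
    ((rapid_maxwellian.mul_id.const_mul (-1)).integrable'.congr
      (Eventually.of_forall fun v => by ring)) rapid_maxwellian.integrable'
  have h2 : ∫ v, -v * maxwellian v = -∫ v, v * maxwellian v := by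
    rw [← integral_neg]; congr 1; ext v; ring
  linarith

theorem integral_sq_mul_maxwellian : ∫ v, v * (v * maxwellian v) = 1 := by
  have h := integral_eq_zero_of_hasDerivAt_of_integrable
    (f := fun v => v * maxwellian v) (f' := fun v => maxwellian v + -1 * (v * (v * maxwellian v)))
    (fun v => ((hasDerivAt_id' v).mul (hasDerivAt_maxwellian v)).congr_deriv (by ring))
    ((rapid_maxwellian.add (rapid_maxwellian.mul_id.mul_id.const_mul (-1))).integrable')
    rapid_maxwellian.mul_id.integrable'
  rw [integral_add rapid_maxwellian.integrable'
    (rapid_maxwellian.mul_id.mul_id.const_mul (-1)).integrable', integral_const_mul,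
    integral_maxwellian] at h
  linarith

theorem integral_cube_mul_maxwellian : ∫ v, v * (v * (v * maxwellian v)) = 0 := by
  have r3 := rapid_maxwellian.mul_id.mul_id.mul_id
  have h := integral_eq_zero_of_hasDerivAt_of_integrable
    (f := fun v => v * (v * maxwellian v))
    (f' := fun v => 2 * (v * maxwellian v) + -1 * (v * (v * (v * maxwellian v))))
    (fun v => ((hasDerivAt_id' v).fun_mul ((hasDerivAt_id' v).fun_mul
      (hasDerivAt_maxwellian v))).congr_deriv (by ring))
    (((rapid_maxwellian.mul_id.const_mul 2).add (r3.const_mul (-1))).integrable')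
    rapid_maxwellian.mul_id.mul_id.integrable'
  rw [integral_add (rapid_maxwellian.mul_id.const_mul 2).integrable'
    (r3.const_mul (-1)).integrable', integral_const_mul, integral_const_mul,
    integral_id_mul_maxwellian] at h
  linarith

/-- Expanded form of the Fokker-Planck operator. -/
theorem linFP_eq {g g' g'' : ℝ → ℝ} (h1 : ∀ v, HasDerivAt g (g' v) v)
    (h2 : ∀ v, HasDerivAt g' (g'' v) v) (v : ℝ) :
    linFP g v = g'' v + (1 / 2 - v ^ 2 / 4) * g v := by
  have hd : ∀ v, HasDerivAt (fun w => g w / sqrtM w) ((g' v + v / 2 * g v) / sqrtM v) v := by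
    intro v
    have hs := (sqrtM_pos v).ne'
    refine ((h1 v).div (hasDerivAt_sqrtM v) hs).congr_deriv ?_
    field_simp
    ring
  have he : (fun v' => maxwellian v' * deriv (fun w => g w / sqrtM w) v')
      = fun v => sqrtM v * (g' v + v / 2 * g v) := by
    ext v
    have hs := (sqrtM_pos v).ne'
    rw [(hd v).deriv, ← sqrtM_mul_self]
    field_simp
  have hs := (sqrtM_pos v).ne'
  have h3 : HasDerivAt (fun v => sqrtM v * (g' v + v / 2 * g v))
      (sqrtM v * (g'' v + (1 / 2 - v ^ 2 / 4) * g v)) v := by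
    refine ((hasDerivAt_sqrtM v).mul ((h2 v).add
      (((hasDerivAt_id' v).div_const 2).mul (h1 v)))).congr_deriv ?_
    simp only [Pi.add_apply, Pi.mul_apply]
    ring
  unfold linFP
  rw [he, h3.deriv]
  field_simp

/-! ### Cauchy-Schwarz -/

section CauchySchwarz

variable {α : Type*} [MeasurableSpace α] {μ : Measure α}

theorem integrable_mul_of_memLp {f g : α → ℝ} (hf : MemLp f 2 μ) (hg : MemLp g 2 μ) :
    Integrable (fun x => f x * g x) μ := hf.integrable_mul hg

theorem integrable_sq_of_memLp {f : α → ℝ} (hf : MemLp f 2 μ) :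
    Integrable (fun x => f x ^ 2) μ := hf.integrable_sq

/-- The quadratic polynomial `s ↦ ∫ (s f + g)²` is nonnegative, so its discriminant is at most zero.
-/
theorem sq_integral_mul_le {f g : α → ℝ} (hf : MemLp f 2 μ) (hg : MemLp g 2 μ) :
    (∫ x, f x * g x ∂μ) ^ 2 ≤ (∫ x, f x ^ 2 ∂μ) * ∫ x, g x ^ 2 ∂μ := by
  have h : ∀ s : ℝ, 0 ≤ (∫ x, f x ^ 2 ∂μ) * (s * s) + (2 * ∫ x, f x * g x ∂μ) * s
      + ∫ x, g x ^ 2 ∂μ := by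
    intro s
    have h1 : ∫ x, (s * f x + g x) ^ 2 ∂μ = (∫ x, f x ^ 2 ∂μ) * (s * s)
        + (2 * ∫ x, f x * g x ∂μ) * s + ∫ x, g x ^ 2 ∂μ := by
      have i1 := (integrable_sq_of_memLp hf).const_mul (s * s)
      have i2 := (integrable_mul_of_memLp hf hg).const_mul (2 * s)
      have i3 := integrable_sq_of_memLp hg
      have h2 : ∀ x, (s * f x + g x) ^ 2
          = (s * s * f x ^ 2 + 2 * s * (f x * g x)) + g x ^ 2 := fun x => by ring
      simp_rw [h2]
      rw [integral_add (i1.fun_add i2) i3, integral_add i1 i2, integral_const_mul, integral_const_mul]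
      ring
    rw [← h1]
    exact integral_nonneg fun x => sq_nonneg _
  have := discrim_le_zero h
  unfold discrim at this
  nlinarith

theorem abs_integral_mul_le {f g : α → ℝ} (hf : MemLp f 2 μ) (hg : MemLp g 2 μ) :
    |∫ x, f x * g x ∂μ| ≤ Real.sqrt (∫ x, f x ^ 2 ∂μ) * Real.sqrt (∫ x, g x ^ 2 ∂μ) := by
  rw [← Real.sqrt_mul (integral_nonneg fun x => sq_nonneg _)]
  exact Real.abs_le_sqrt (sq_integral_mul_le hf hg)

end CauchySchwarz

/-! ### The Gaussian Poincaré inequality on the line -/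

theorem memLp_sqrtM : MemLp sqrtM 2 volume :=
  (memLp_two_iff_integrable_sq continuous_sqrtM.aestronglyMeasurable).2
    (rapid_maxwellian.integrable'.congr (Eventually.of_forall fun v => by
      simp only [sq, sqrtM_mul_self]))

theorem memLp_id_mul_sqrtM : MemLp (fun v => v * sqrtM v) 2 volume :=
  (memLp_two_iff_integrable_sq (continuous_id'.mul continuous_sqrtM).aestronglyMeasurable).2
    (rapid_maxwellian.mul_id.mul_id.integrable'.congr (Eventually.of_forall fun v => by
      simp only [← sqrtM_mul_self, Pi.mul_apply]; ring))

/-- The Mills bound for the Gaussian tail: on the tail `R ≤ v`, and `v M = -M'` integrates exactly.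
-/
theorem mul_integral_Ioi_maxwellian_le {R : ℝ} :
    R * ∫ v in Ioi R, maxwellian v ≤ maxwellian R := by
  have hi := rapid_maxwellian.mul_id.integrable'
  have ht : Tendsto (fun v => - maxwellian v) atTop (𝓝 0) := by
    have := (tendsto_zero_of_hasDerivAt_of_integrableOn_Ioi (a := R)
      (fun v _ => hasDerivAt_maxwellian v)
      (((rapid_maxwellian.mul_id.const_mul (-1)).integrable'.congr
      (Eventually.of_forall fun v => by ring)).integrableOn)
      rapid_maxwellian.integrable'.integrableOn).neg
    simpa using this
  have h := integral_Ioi_of_hasDerivAt_of_tendsto' (a := R)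
    (fun v _ => (hasDerivAt_maxwellian v).neg.congr_deriv (by ring : _ = v * maxwellian v))
    hi.integrableOn ht
  rw [← integral_const_mul]
  calc ∫ v in Ioi R, R * maxwellian v ≤ ∫ v in Ioi R, v * maxwellian v := by
        refine setIntegral_mono_on (rapid_maxwellian.integrable'.integrableOn.const_mul R)
          hi.integrableOn measurableSet_Ioi fun v hv => ?_
        exact mul_le_mul_of_nonneg_right (le_of_lt hv) (maxwellian_pos v).le
    _ = maxwellian R := by rw [h]; simp

/-- Cauchy–Schwarz on the tail combined with the Mills bound. It controls the boundary terms at `±R`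
in the Poincaré inequality. -/
theorem mul_sq_integral_Ioi_le {g : ℝ → ℝ} (hg : MemLp g 2 volume) {R : ℝ} (hR : 0 < R) :
    R * (∫ v in Ioi R, g v * sqrtM v) ^ 2 ≤ maxwellian R * ∫ v in Ioi R, g v ^ 2 := by
  have h1 := sq_integral_mul_le (hg.restrict (Ioi R)) (memLp_sqrtM.restrict (Ioi R))
  have h2 : ∫ v in Ioi R, sqrtM v ^ 2 = ∫ v in Ioi R, maxwellian v := by
    simp only [sq, sqrtM_mul_self]
  rw [h2] at h1
  have h3 : 0 ≤ ∫ v in Ioi R, g v ^ 2 := integral_nonneg fun _ => sq_nonneg _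
  calc R * (∫ v in Ioi R, g v * sqrtM v) ^ 2
      ≤ R * ((∫ v in Ioi R, g v ^ 2) * ∫ v in Ioi R, maxwellian v) := by gcongr
    _ = (R * ∫ v in Ioi R, maxwellian v) * ∫ v in Ioi R, g v ^ 2 := by ring
    _ ≤ _ := by gcongr; exact mul_integral_Ioi_maxwellian_le

theorem maxwellian_neg (v : ℝ) : maxwellian (-v) = maxwellian v := by simp [maxwellian]

theorem sqrtM_neg (v : ℝ) : sqrtM (-v) = sqrtM v := by simp [sqrtM, maxwellian_neg]

/-- Gaussian Poincaré inequality, written for `g = f √M`. -/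
theorem integral_sq_le_integral_creation_sq {g g' : ℝ → ℝ} (hd : ∀ v, HasDerivAt g (g' v) v)
    (hc : Continuous g') (hg : MemLp g 2 volume) (hvg : MemLp (fun v => v * g v) 2 volume)
    (hg' : MemLp g' 2 volume) (h0 : ∫ v, g v * sqrtM v = 0) :
    ∫ v, g v ^ 2 ≤ ∫ v, (g' v + v / 2 * g v) ^ 2 := by
  have hgc : Continuous g := continuous_iff_continuousAt.2 fun v => (hd v).continuousAt
  have hgi : Integrable (fun v => g v * sqrtM v) := integrable_mul_of_memLp hg memLp_sqrtM
  set F : ℝ → ℝ := fun v => (∫ w in Iic 0, g w * sqrtM w) + ∫ w in (0 : ℝ)..v, g w * sqrtM w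
    with hF
  have hFd : ∀ v, HasDerivAt F (g v * sqrtM v) v := fun v =>
    ((hgc.mul continuous_sqrtM).integral_hasStrictDerivAt 0 v).hasDerivAt.const_add _
  have hFI : ∀ v, F v = ∫ w in Iic v, g w * sqrtM w := fun v => by
    rw [hF]
    simp only
    rw [← intervalIntegral.integral_Iic_sub_Iic hgi.integrableOn hgi.integrableOn]
    ring
  -- The zero-mean hypothesis makes the antiderivative vanish at `+∞` as well as at `-∞`, so either
  -- tail can be used to estimate it.
  have hFI' : ∀ v, F v = -∫ w in Ioi v, g w * sqrtM w := fun v => by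
    rw [hFI]
    have := intervalIntegral.integral_Iic_add_Ioi (b := v) hgi.integrableOn hgi.integrableOn
    linarith
  -- `ψ` solves `(-∂_v + v/2) ψ = g`. Pairing `g` with this representation moves the operator onto
  -- `g` as `∂_v + v/2`.
  set ψ : ℝ → ℝ := fun v => -(F v / sqrtM v) with hψ
  have hψd : ∀ v, HasDerivAt ψ (v / 2 * ψ v - g v) v := by
    intro v
    have hs := (sqrtM_pos v).ne'
    refine ((hFd v).div (hasDerivAt_sqrtM v) hs).neg.congr_deriv ?_
    simp only [hψ]
    field_simp
    ring
  have hψc : Continuous ψ := continuous_iff_continuousAt.2 fun v => (hψd v).continuousAt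
  -- With `a = g' + (v/2) g`, the difference `a² - g²` is an exact derivative plus two squares. The
  -- inequality therefore holds up to boundary terms.
  have hΦd : ∀ v, HasDerivAt (fun v => 2 * (g v * ψ v) - v * (ψ v * ψ v))
      ((g' v + v / 2 * g v) ^ 2 - g v ^ 2 - (g' v + v / 2 * g v - ψ v) ^ 2
        - (v * ψ v - g v) ^ 2) v := by
    intro v
    refine ((((hd v).fun_mul (hψd v)).const_mul 2).sub ((hasDerivAt_id' v).fun_mul
      ((hψd v).fun_mul (hψd v)))).congr_deriv ?_
    ring
  have hg2 := integrable_sq_of_memLp hg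
  have hB : MemLp (fun v => g' v + v / 2 * g v) 2 volume := by
    refine (hg'.add (hvg.const_mul (1 / 2))).ae_eq (Eventually.of_forall fun v => ?_)
    simp only [Pi.add_apply]; ring
  have hB2 := integrable_sq_of_memLp hB
  set T : ℝ → ℝ := fun R => (∫ v, g v ^ 2) - ∫ v in (-R)..R, g v ^ 2 with hT
  have hsplit : ∀ R : ℝ, T R = (∫ v in Iic (-R), g v ^ 2) + ∫ v in Ioi R, g v ^ 2 := by
    intro R
    have h1 := intervalIntegral.integral_Iic_add_Ioi (b := R) hg2.integrableOn hg2.integrableOn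
    have h2 := intervalIntegral.integral_Iic_sub_Iic (a := -R) (b := R) hg2.integrableOn
      hg2.integrableOn
    simp only [hT]
    linarith
  have hpos : ∀ R > 0, R * ψ R ^ 2 ≤ T R := by
    intro R hR
    have h1 := mul_sq_integral_Ioi_le hg hR
    have h2 : 0 ≤ ∫ v in Iic (-R), g v ^ 2 := integral_nonneg fun _ => sq_nonneg _
    have hs := sqrtM_pos R
    have h3 : R * ψ R ^ 2 * maxwellian R = R * (∫ v in Ioi R, g v * sqrtM v) ^ 2 := by
      simp only [hψ, hFI', ← sqrtM_mul_self]
      field_simp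
    rw [← h3, mul_comm] at h1
    have := le_of_mul_le_mul_left h1 (maxwellian_pos R)
    rw [hsplit]; linarith
  have hneg : ∀ R > 0, R * ψ (-R) ^ 2 ≤ T R := by
    intro R hR
    have hgn : MemLp (fun v => g (-v)) 2 volume :=
      hg.comp_measurePreserving (Measure.measurePreserving_neg volume)
    have h1 := mul_sq_integral_Ioi_le hgn hR
    have h2 : 0 ≤ ∫ v in Ioi R, g v ^ 2 := integral_nonneg fun _ => sq_nonneg _
    have h4 : ∫ v in Ioi R, g (-v) * sqrtM v = ∫ v in Iic (-R), g v * sqrtM v := by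
      rw [← integral_comp_neg_Ioi]
      simp only [sqrtM_neg]
    have h5 : ∫ v in Ioi R, g (-v) ^ 2 = ∫ v in Iic (-R), g v ^ 2 := by
      rw [← integral_comp_neg_Ioi]
    rw [h4, h5] at h1
    have hs := sqrtM_pos R
    have h3 : R * ψ (-R) ^ 2 * maxwellian R = R * (∫ v in Iic (-R), g v * sqrtM v) ^ 2 := by
      simp only [hψ, hFI, ← sqrtM_mul_self, sqrtM_neg]
      field_simp
    rw [← h3, mul_comm] at h1
    have := le_of_mul_le_mul_left h1 (maxwellian_pos R)
    rw [hsplit]; linarith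
  -- For `R ≥ 1` both `ψ(±R)²` and `R ψ(±R)²` are at most `T R`. The cross terms `±2gψ` cost `g² +
  -- ψ²`, so four copies of `T R` appear in all.
  have hbd : ∀ R ≥ (1 : ℝ), -(g R ^ 2 + g (-R) ^ 2) - 4 * T R
      ≤ ∫ v in (-R)..R, ((g' v + v / 2 * g v) ^ 2 - g v ^ 2) := by
    intro R hR
    have hR0 : 0 < R := by linarith
    have e1 := intervalIntegral.integral_eq_sub_of_hasDerivAt (a := -R) (b := R)
      (fun v _ => hΦd v) (Continuous.intervalIntegrable (by fun_prop) _ _)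
    have e2 : ∫ v in (-R)..R, ((g' v + v / 2 * g v) ^ 2 - g v ^ 2
        - (g' v + v / 2 * g v - ψ v) ^ 2 - (v * ψ v - g v) ^ 2)
        ≤ ∫ v in (-R)..R, ((g' v + v / 2 * g v) ^ 2 - g v ^ 2) := by
      refine intervalIntegral.integral_mono_on (by linarith)
        (Continuous.intervalIntegrable (by fun_prop) _ _)
        (Continuous.intervalIntegrable (by fun_prop) _ _) fun v _ => ?_
      nlinarith [sq_nonneg (g' v + v / 2 * g v - ψ v), sq_nonneg (v * ψ v - g v)]
    rw [e1] at e2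
    have p1 := hpos R hR0
    have p2 := hneg R hR0
    have q1 : ψ R ^ 2 ≤ R * ψ R ^ 2 := le_mul_of_one_le_left (sq_nonneg _) hR
    have q2 : ψ (-R) ^ 2 ≤ R * ψ (-R) ^ 2 := le_mul_of_one_le_left (sq_nonneg _) hR
    nlinarith [sq_nonneg (g R + ψ R), sq_nonneg (g (-R) - ψ (-R))]
  have hd2 : ∀ v, HasDerivAt (fun v => g v * g v) (2 * (g v * g' v)) v := fun v =>
    ((hd v).fun_mul (hd v)).congr_deriv (by ring)
  have hi2 := (integrable_mul_of_memLp hg hg').const_mul 2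
  have hi3 := integrable_mul_of_memLp hg hg
  have t1 : Tendsto (fun v => g v * g v) atTop (𝓝 0) :=
    tendsto_zero_of_hasDerivAt_of_integrableOn_Ioi (a := 0) (fun v _ => hd2 v)
      hi2.integrableOn hi3.integrableOn
  have t2 : Tendsto (fun v => g v * g v) atBot (𝓝 0) :=
    tendsto_zero_of_hasDerivAt_of_integrableOn_Iic (a := 0) (fun v _ => hd2 v)
      hi2.integrableOn hi3.integrableOn
  have t3 : Tendsto T atTop (𝓝 0) := by
    have := (intervalIntegral_tendsto_integral hg2 tendsto_neg_atTop_atBot tendsto_id).const_sub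
      (∫ v, g v ^ 2)
    simpa [hT] using this
  have t4 : Tendsto (fun R => -(g R ^ 2 + g (-R) ^ 2) - 4 * T R) atTop (𝓝 0) := by
    have := ((t1.add (t2.comp tendsto_neg_atTop_atBot)).neg).sub (t3.const_mul 4)
    simp only [Function.comp_def, ← sq] at this
    simpa using this
  have t5 := intervalIntegral_tendsto_integral (hB2.sub hg2) tendsto_neg_atTop_atBot tendsto_id
  have := le_of_tendsto_of_tendsto t4 t5 (by
    filter_upwards [eventually_ge_atTop (1 : ℝ)] with R hR using hbd R hR)
  simp only [Pi.sub_apply] at this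
  rw [integral_sub hB2 hg2] at this
  linarith

/-- Microscopic coercivity of the Fokker-Planck operator with constant `1/7`. -/
theorem lambda0_mul_integral_le {g g' : ℝ → ℝ} (hd : ∀ v, HasDerivAt g (g' v) v)
    (hc : Continuous g') (hg : MemLp g 2 volume) (hvg : MemLp (fun v => v * g v) 2 volume)
    (hg' : MemLp g' 2 volume) (h0 : ∫ v, g v * sqrtM v = 0) :
    lambda0 * ∫ v, ((1 + v ^ 2) * g v ^ 2 + g' v ^ 2) ≤ ∫ v, (g' v + v / 2 * g v) ^ 2 := by
  have hp := integral_sq_le_integral_creation_sq hd hc hg hvg hg' h0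
  have i1 := integrable_sq_of_memLp hg
  have i2 := integrable_sq_of_memLp hvg
  have i3 := integrable_sq_of_memLp hg'
  have i4 := integrable_mul_of_memLp hvg hg'
  have i5 : Integrable fun v => v * (g v * g v) :=
    (integrable_mul_of_memLp hvg hg).congr (Eventually.of_forall fun v => by ring)
  have hz := integral_eq_zero_of_hasDerivAt_of_integrable (f := fun v => v * (g v * g v))
    (f' := fun v => g v ^ 2 + 2 * (v * g v * g' v))
    (fun v => ((hasDerivAt_id' v).fun_mul ((hd v).fun_mul (hd v))).congr_deriv (by ring))
    (i1.add (i4.const_mul 2)) i5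
  rw [integral_add i1 (i4.const_mul 2), integral_const_mul] at hz
  have e1 : ∫ v, (g' v + v / 2 * g v) ^ 2
      = (∫ v, g' v ^ 2) + (∫ v, v * g v * g' v) + 1 / 4 * ∫ v, (v * g v) ^ 2 := by
    rw [← integral_add i3 i4, ← integral_const_mul, ← integral_add (i3.fun_add i4) (i2.const_mul _)]
    congr 1; ext v; ring
  have e2 : ∫ v, ((1 + v ^ 2) * g v ^ 2 + g' v ^ 2)
      = (∫ v, g v ^ 2) + (∫ v, (v * g v) ^ 2) + ∫ v, g' v ^ 2 := by
    rw [← integral_add i1 i2, ← integral_add (i1.fun_add i2) i3]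
    congr 1; ext v; ring
  have n1 : 0 ≤ ∫ v, g' v ^ 2 := integral_nonneg fun _ => sq_nonneg _
  rw [e2, lambda0]
  -- Write `N`, `V`, `G` for the squared norms of `g`, `vg`, `g'` and `B` for the right side.
  -- Integration by parts gives `B = G - N/2 + V/4`, hence `V + G ≤ V + 4G = 4B + 2N`. With `N ≤ B`
  -- this yields `N + V + G ≤ 4B + 3N ≤ 7B`, which is the source of `1/7`.
  nlinarith

/-! ### Divergence theorems for integrable fluxes -/

theorem exists_cutoff : ∃ χ χ' : ℝ → ℝ, ∃ C : ℝ, (∀ x, HasDerivAt χ (χ' x) x) ∧ Continuous χ' ∧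
    HasCompactSupport χ ∧ HasCompactSupport χ' ∧ (∀ x, |χ x| ≤ 1) ∧ (∀ x, |χ' x| ≤ C) ∧
    χ 0 = 1 := by
  let b : ContDiffBump (0 : ℝ) := ⟨1, 2, by norm_num, by norm_num⟩
  have hb : ContDiff ℝ 1 b := b.contDiff
  have hcd : Continuous (deriv b) := hb.continuous_deriv le_rfl
  obtain ⟨C, hC⟩ := hcd.bounded_above_of_compact_support b.hasCompactSupport.deriv
  refine ⟨b, deriv b, C, fun x => (hb.differentiable one_ne_zero x).hasDerivAt, hcd,
    b.hasCompactSupport, b.hasCompactSupport.deriv, fun x => ?_, fun x => hC x, ?_⟩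
  · rw [abs_of_nonneg b.nonneg]; exact b.le_one
  · exact b.one_of_mem_closedBall (by simp [b.rIn_pos.le])

theorem integral_prod_deriv_fst_eq_zero {Φ Φ' : ℝ × ℝ → ℝ}
    (hd : ∀ x v, HasDerivAt (fun y => Φ (y, v)) (Φ' (x, v)) x) (hc : Continuous Φ)
    (hc' : Continuous Φ') (hs : HasCompactSupport Φ) (hs' : HasCompactSupport Φ') :
    ∫ p, Φ' p = 0 := by
  rw [Measure.volume_eq_prod, integral_prod_symm Φ' (hc'.integrable_of_hasCompactSupport hs')]
  have : ∀ v : ℝ, ∫ x, Φ' (x, v) = 0 := fun v => by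
    have he : IsClosedEmbedding (fun x : ℝ => (x, v)) := (Topology.IsClosedEmbedding.of_continuous_injective_isClosedMap (by fun_prop)
      (fun a b h => (Prod.ext_iff.1 h).1) (isClosedMap_prodMk_right v))
    exact integral_eq_zero_of_hasDerivAt_of_integrable (fun x => hd x v)
      ((hc'.comp he.continuous).integrable_of_hasCompactSupport (hs'.comp_isClosedEmbedding he))
      ((hc.comp he.continuous).integrable_of_hasCompactSupport (hs.comp_isClosedEmbedding he))
  simp [this]

theorem integral_prod_deriv_snd_eq_zero {Φ Φ' : ℝ × ℝ → ℝ}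
    (hd : ∀ x v, HasDerivAt (fun w => Φ (x, w)) (Φ' (x, v)) v) (hc : Continuous Φ)
    (hc' : Continuous Φ') (hs : HasCompactSupport Φ) (hs' : HasCompactSupport Φ') :
    ∫ p, Φ' p = 0 := by
  have hsw : IsClosedEmbedding (Prod.swap : ℝ × ℝ → ℝ × ℝ) :=
    (Homeomorph.prodComm ℝ ℝ).isClosedEmbedding
  have := integral_prod_deriv_fst_eq_zero (Φ := Φ ∘ Prod.swap) (Φ' := Φ' ∘ Prod.swap)
    (fun x v => hd v x) (hc.comp continuous_swap) (hc'.comp continuous_swap)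
    (hs.comp_isClosedEmbedding hsw) (hs'.comp_isClosedEmbedding hsw)
  rw [Measure.volume_eq_prod] at this ⊢
  rw [← integral_prod_swap Φ']
  exact this

/-- Only the sum of the two partial derivatives is assumed integrable, not each one. Multiplication
by a product cutoff at scale `1 / r n` makes each flux compactly supported; the derivatives falling
on the cutoff carry a factor `r n` times an integrable flux and disappear in the limit. -/
theorem integral_divergence_eq_zero {F₁ F₂ F₁' F₂' : ℝ × ℝ → ℝ}
    (hd₁ : ∀ x v, HasDerivAt (fun y => F₁ (y, v)) (F₁' (x, v)) x)
    (hd₂ : ∀ x v, HasDerivAt (fun w => F₂ (x, w)) (F₂' (x, v)) v)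
    (hc₁ : Continuous F₁) (hc₂ : Continuous F₂) (hc₁' : Continuous F₁') (hc₂' : Continuous F₂')
    (hi₁ : Integrable F₁) (hi₂ : Integrable F₂) (hi : Integrable fun p => F₁' p + F₂' p) :
    ∫ p, (F₁' p + F₂' p) = 0 := by
  obtain ⟨χ, χ', C, hχ, hχc', hχs, hχs', hχ1, hχ'C, hχ0⟩ := exists_cutoff
  have hχc : Continuous χ := continuous_iff_continuousAt.2 fun v => (hχ v).continuousAt
  have hC0 : 0 ≤ C := (abs_nonneg _).trans (hχ'C 0)
  set r : ℕ → ℝ := fun n => 1 / ((n : ℝ) + 1) with hr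
  have hrpos : ∀ n, 0 < r n := fun n => by simp only [hr]; positivity
  have hr1 : ∀ n, r n ≤ 1 := fun n => by
    simp only [hr]
    rw [div_le_one (by positivity)]
    linarith [Nat.cast_nonneg (α := ℝ) n]
  have hr0 : Tendsto r atTop (𝓝 0) := tendsto_one_div_add_atTop_nhds_zero_nat
  have hχd : ∀ n x, HasDerivAt (fun y => χ (r n * y)) (r n * χ' (r n * x)) x := fun n x => by
    have := (hχ (r n * x)).comp x ((hasDerivAt_id' x).const_mul (r n))
    exact this.congr_deriv (by ring)
  have hcs : ∀ n (f : ℝ → ℝ) (g : ℝ → ℝ), HasCompactSupport f → HasCompactSupport g →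
      HasCompactSupport fun p : ℝ × ℝ => f (r n * p.1) * g (r n * p.2) := by
    intro n f g hf hg
    have hsc : IsClosedEmbedding fun x : ℝ => r n * x :=
      (Homeomorph.mulLeft₀ (r n) (hrpos n).ne').isClosedEmbedding
    have h1 := hf.comp_isClosedEmbedding hsc
    have h2 := hg.comp_isClosedEmbedding hsc
    refine HasCompactSupport.intro (h1.isCompact.prod h2.isCompact) fun p hp => ?_
    rw [Set.mem_prod, not_and_or] at hp
    rcases hp with hp | hp
    · have h0 : (f ∘ fun x => r n * x) p.1 = 0 := image_eq_zero_of_notMem_tsupport hp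
      rw [show f (r n * p.1) = 0 from h0, zero_mul]
    · have h0 : (g ∘ fun x => r n * x) p.2 = 0 := image_eq_zero_of_notMem_tsupport hp
      rw [show g (r n * p.2) = 0 from h0, mul_zero]
  -- The divergence of the flux multiplied by the cutoff, with the terms regrouped so that dominated
  -- convergence needs only the integrable full divergence.
  let Ψ : ℕ → ℝ × ℝ → ℝ := fun n p =>
    (χ (r n * p.1) * χ (r n * p.2)) * (F₁' p + F₂' p)
      + r n * (χ' (r n * p.1) * χ (r n * p.2) * F₁ p)
      + r n * (χ (r n * p.1) * χ' (r n * p.2) * F₂ p)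
  have hzero : ∀ n, ∫ p, Ψ n p = 0 := by
    intro n
    have cs1 := hcs n χ χ hχs hχs
    have cs2 := hcs n χ' χ hχs' hχs
    have cs3 := hcs n χ χ' hχs hχs'
    have k1 : HasCompactSupport fun p : ℝ × ℝ => r n * (χ' (r n * p.1) * χ (r n * p.2) * F₁ p)
        + (χ (r n * p.1) * χ (r n * p.2)) * F₁' p := (cs2.mul_right.mul_left).add cs1.mul_right
    have k2 : HasCompactSupport fun p : ℝ × ℝ => r n * (χ (r n * p.1) * χ' (r n * p.2) * F₂ p)
        + (χ (r n * p.1) * χ (r n * p.2)) * F₂' p := (cs3.mul_right.mul_left).add cs1.mul_right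
    have e1 := integral_prod_deriv_fst_eq_zero
      (Φ := fun p => (χ (r n * p.1) * χ (r n * p.2)) * F₁ p)
      (Φ' := fun p => r n * (χ' (r n * p.1) * χ (r n * p.2) * F₁ p)
        + (χ (r n * p.1) * χ (r n * p.2)) * F₁' p)
      (fun x v => (((hχd n x).mul_const (χ (r n * v))).fun_mul (hd₁ x v)).congr_deriv (by ring))
      (by fun_prop) (by fun_prop) cs1.mul_right k1
    have e2 := integral_prod_deriv_snd_eq_zero
      (Φ := fun p => (χ (r n * p.1) * χ (r n * p.2)) * F₂ p)
      (Φ' := fun p => r n * (χ (r n * p.1) * χ' (r n * p.2) * F₂ p)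
        + (χ (r n * p.1) * χ (r n * p.2)) * F₂' p)
      (fun x v => (((hχd n v).const_mul (χ (r n * x))).fun_mul (hd₂ x v)).congr_deriv (by ring))
      (by fun_prop) (by fun_prop) cs1.mul_right k2
    have i1 := Continuous.integrable_of_hasCompactSupport (μ := volume) (by fun_prop) k1
    have i2 := Continuous.integrable_of_hasCompactSupport (μ := volume) (by fun_prop) k2
    have := integral_add i1 i2
    rw [e1, e2, add_zero] at this
    rw [← this]
    congr 1; ext p; simp only [Ψ]; ring
  have hlim : Tendsto (fun n => ∫ p, Ψ n p) atTop (𝓝 (∫ p, (F₁' p + F₂' p))) := by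
    refine tendsto_integral_of_dominated_convergence
      (fun p => |F₁' p + F₂' p| + C * |F₁ p| + C * |F₂ p|) (fun n => ?_) ?_ (fun n => ?_) ?_
    · exact Continuous.aestronglyMeasurable (by simp only [Ψ]; fun_prop)
    · exact (hi.abs.add (hi₁.abs.const_mul C)).add (hi₂.abs.const_mul C)
    · refine Eventually.of_forall fun p => ?_
      have a1 := hχ1 (r n * p.1)
      have a2 := hχ1 (r n * p.2)
      have a3 := hχ'C (r n * p.1)
      have a4 := hχ'C (r n * p.2)
      have b1 : |(χ (r n * p.1) * χ (r n * p.2)) * (F₁' p + F₂' p)| ≤ |F₁' p + F₂' p| := by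
        rw [abs_mul, abs_mul]
        exact mul_le_of_le_one_left (abs_nonneg _) (mul_le_one₀ a1 (abs_nonneg _) a2)
      have b2 : |r n * (χ' (r n * p.1) * χ (r n * p.2) * F₁ p)| ≤ C * |F₁ p| := by
        rw [abs_mul, abs_mul, abs_mul, abs_of_pos (hrpos n)]
        calc _ ≤ 1 * (C * 1 * |F₁ p|) := by gcongr; exact hr1 n
          _ = _ := by ring
      have b3 : |r n * (χ (r n * p.1) * χ' (r n * p.2) * F₂ p)| ≤ C * |F₂ p| := by
        rw [abs_mul, abs_mul, abs_mul, abs_of_pos (hrpos n)]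
        calc _ ≤ 1 * (1 * C * |F₂ p|) := by gcongr; exact hr1 n
          _ = _ := by ring
      exact (abs_add_three _ _ _).trans (add_le_add (add_le_add b1 b2) b3)
    · refine Eventually.of_forall fun p => ?_
      have c1 : ∀ y : ℝ, Tendsto (fun n => χ (r n * y)) atTop (𝓝 1) := fun y => by
        have := (hχc.tendsto 0).comp (f := fun n => r n * y) (by simpa using hr0.mul_const y)
        rwa [hχ0] at this
      have c2 : ∀ y : ℝ, Tendsto (fun n => χ' (r n * y)) atTop (𝓝 (χ' 0)) := fun y =>
        (hχc'.tendsto 0).comp (f := fun n => r n * y) (by simpa using hr0.mul_const y)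
      have := ((((c1 p.1).mul (c1 p.2)).mul_const (F₁' p + F₂' p)).add
        (hr0.mul (((c2 p.1).mul (c1 p.2)).mul_const (F₁ p)))).add
        (hr0.mul (((c1 p.1).mul (c2 p.2)).mul_const (F₂ p)))
      simpa [Ψ] using this
  simp only [hzero] at hlim
  exact tendsto_nhds_unique hlim tendsto_const_nhds

/-- Fubini in the parameter `z` reduces this to the planar divergence theorem on almost every slice;
the integrability hypotheses pass to almost every slice. -/
theorem integral_xvz_divergence_eq_zero {ν : Measure ℝ} [SFinite ν] {Iz : Set ℝ}
    (hν : ∀ᵐ z ∂ν, z ∈ Iz) {F₁ F₂ F₁' F₂' : ℝ → ℝ → ℝ → ℝ}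
    (hd₁ : ∀ x v, ∀ z ∈ Iz, HasDerivAt (fun y => F₁ y v z) (F₁' x v z) x)
    (hd₂ : ∀ x v, ∀ z ∈ Iz, HasDerivAt (fun w => F₂ x w z) (F₂' x v z) v)
    (hc₁ : ∀ z ∈ Iz, Continuous fun p : ℝ × ℝ => F₁ p.1 p.2 z)
    (hc₂ : ∀ z ∈ Iz, Continuous fun p : ℝ × ℝ => F₂ p.1 p.2 z)
    (hc₁' : ∀ z ∈ Iz, Continuous fun p : ℝ × ℝ => F₁' p.1 p.2 z)
    (hc₂' : ∀ z ∈ Iz, Continuous fun p : ℝ × ℝ => F₂' p.1 p.2 z)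
    (hi₁ : Integrable (fun p : ℝ × ℝ × ℝ => F₁ p.1 p.2.1 p.2.2)
      ((volume : Measure ℝ).prod ((volume : Measure ℝ).prod ν)))
    (hi₂ : Integrable (fun p : ℝ × ℝ × ℝ => F₂ p.1 p.2.1 p.2.2)
      ((volume : Measure ℝ).prod ((volume : Measure ℝ).prod ν)))
    (hi : Integrable (fun p : ℝ × ℝ × ℝ => F₁' p.1 p.2.1 p.2.2 + F₂' p.1 p.2.1 p.2.2)
      ((volume : Measure ℝ).prod ((volume : Measure ℝ).prod ν))) :
    ∫ p : ℝ × ℝ × ℝ, (F₁' p.1 p.2.1 p.2.2 + F₂' p.1 p.2.1 p.2.2)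
      ∂((volume : Measure ℝ).prod ((volume : Measure ℝ).prod ν)) = 0 := by
  have hm := measurePreserving_prodAssoc (volume : Measure ℝ) (volume : Measure ℝ) ν
  have j₁ := hm.integrable_comp_of_integrable hi₁
  have j₂ := hm.integrable_comp_of_integrable hi₂
  have j := hm.integrable_comp_of_integrable hi
  rw [← hm.integral_comp' (f := MeasurableEquiv.prodAssoc)]
  refine (integral_prod_symm _ j).trans ?_
  refine integral_eq_zero_of_ae ?_
  filter_upwards [hν, j₁.prod_left_ae, j₂.prod_left_ae, j.prod_left_ae] with z hz k₁ k₂ k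
  exact integral_divergence_eq_zero (F₁ := fun p => F₁ p.1 p.2 z) (F₂ := fun p => F₂ p.1 p.2 z)
    (F₁' := fun p => F₁' p.1 p.2 z) (F₂' := fun p => F₂' p.1 p.2 z)
    (fun x v => hd₁ x v z hz) (fun x v => hd₂ x v z hz) (hc₁ z hz) (hc₂ z hz) (hc₁' z hz)
    (hc₂' z hz) k₁ k₂ k

theorem integral_xz_deriv_eq_zero {ν : Measure ℝ} [SFinite ν] {Iz : Set ℝ}
    (hν : ∀ᵐ z ∂ν, z ∈ Iz) {F F' : ℝ → ℝ → ℝ}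
    (hd : ∀ x, ∀ z ∈ Iz, HasDerivAt (fun y => F y z) (F' x z) x)
    (hi : Integrable (fun p : ℝ × ℝ => F p.1 p.2) ((volume : Measure ℝ).prod ν))
    (hi' : Integrable (fun p : ℝ × ℝ => F' p.1 p.2) ((volume : Measure ℝ).prod ν)) :
    ∫ p : ℝ × ℝ, F' p.1 p.2 ∂((volume : Measure ℝ).prod ν) = 0 := by
  rw [integral_prod_symm _ hi']
  refine integral_eq_zero_of_ae ?_
  filter_upwards [hν, hi.prod_left_ae, hi'.prod_left_ae] with z hz k k'
  exact integral_eq_zero_of_hasDerivAt_of_integrable (fun x => hd x z hz) k' k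

/-! ### `L²` norms as lower integrals -/

section LTwo

variable {α : Type*} [MeasurableSpace α] {μ : Measure α}

theorem memLp_two_of_lintegral_lt_top {f : α → ℝ} (hf : AEStronglyMeasurable f μ)
    (h : ∫⁻ x, ‖f x‖ₑ ^ 2 ∂μ < ∞) : MemLp f 2 μ := by
  refine (memLp_two_iff_integrable_sq hf).2 ⟨hf.pow 2, ?_⟩
  simpa [hasFiniteIntegral_iff_enorm, enorm_pow] using h

theorem ofReal_integral_sq {f : α → ℝ} (hf : MemLp f 2 μ) :
    ENNReal.ofReal (∫ x, f x ^ 2 ∂μ) = ∫⁻ x, ‖f x‖ₑ ^ 2 ∂μ := by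
  rw [ofReal_integral_eq_lintegral_ofReal hf.integrable_sq
    (Eventually.of_forall fun x => sq_nonneg _)]
  refine lintegral_congr fun x => ?_
  rw [← enorm_pow, Real.enorm_of_nonneg (sq_nonneg _)]

theorem lintegral_enorm_sq_lt_top {f : α → ℝ} (hf : MemLp f 2 μ) :
    ∫⁻ x, ‖f x‖ₑ ^ 2 ∂μ < ∞ := by
  rw [← ofReal_integral_sq hf]; exact ENNReal.ofReal_lt_top

theorem eLpNorm_two_sq (f : α → ℝ) : eLpNorm f 2 μ ^ 2 = ∫⁻ x, ‖f x‖ₑ ^ 2 ∂μ := by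
  rw [eLpNorm_eq_lintegral_rpow_enorm_toReal (by norm_num) (by norm_num)]
  simp only [ENNReal.toReal_ofNat, ENNReal.rpow_ofNat]
  rw [← ENNReal.rpow_natCast, ← ENNReal.rpow_mul]
  norm_num

end LTwo

/-! ### One-dimensional Sobolev embeddings -/

/-- Both `f(x)² = ∫_{-∞}^x 2 f f'` and `f(x)² = -∫_x^∞ 2 f f'` hold. Adding them and using `±2 f f'
≤ f² + f'²` on each half-line gives the factor `2`. With lower integrals no finiteness hypothesis is
needed, since an infinite right side is trivial. -/
theorem two_mul_enorm_sq_le_lintegral {f f' : ℝ → ℝ} (hd : ∀ x, HasDerivAt f (f' x) x)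
    (hc : Continuous f') (x : ℝ) :
    2 * ‖f x‖ₑ ^ 2 ≤ ∫⁻ y, (‖f y‖ₑ ^ 2 + ‖f' y‖ₑ ^ 2) := by
  have hfc : Continuous f := continuous_iff_continuousAt.2 fun v => (hd v).continuousAt
  by_cases htop : ∫⁻ y, (‖f y‖ₑ ^ 2 + ‖f' y‖ₑ ^ 2) = ∞
  · rw [htop]; exact le_top
  have hlt := lt_top_iff_ne_top.2 htop
  have hf : MemLp f 2 volume := memLp_two_of_lintegral_lt_top hfc.aestronglyMeasurable
    ((lintegral_mono fun y => le_self_add).trans_lt hlt)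
  have hf' : MemLp f' 2 volume := memLp_two_of_lintegral_lt_top hc.aestronglyMeasurable
    ((lintegral_mono fun y => le_add_self).trans_lt hlt)
  rw [lintegral_add_left (by fun_prop), ← ofReal_integral_sq hf, ← ofReal_integral_sq hf',
    ← ENNReal.ofReal_add (integral_nonneg fun _ => sq_nonneg _)
      (integral_nonneg fun _ => sq_nonneg _), ← enorm_pow, Real.enorm_of_nonneg (sq_nonneg _),
    show (2 : ℝ≥0∞) = ENNReal.ofReal 2 by simp, ← ENNReal.ofReal_mul (by norm_num)]
  refine ENNReal.ofReal_le_ofReal ?_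
  have hd2 : ∀ v, HasDerivAt (fun v => f v * f v) (2 * (f v * f' v)) v := fun v =>
    ((hd v).fun_mul (hd v)).congr_deriv (by ring)
  have hi2 := (integrable_mul_of_memLp hf hf').const_mul 2
  have hi3 := integrable_mul_of_memLp hf hf
  have t1 : Tendsto (fun v => f v * f v) atTop (𝓝 0) :=
    tendsto_zero_of_hasDerivAt_of_integrableOn_Ioi (a := 0) (fun v _ => hd2 v)
      hi2.integrableOn hi3.integrableOn
  have t2 : Tendsto (fun v => f v * f v) atBot (𝓝 0) :=
    tendsto_zero_of_hasDerivAt_of_integrableOn_Iic (a := 0) (fun v _ => hd2 v)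
      hi2.integrableOn hi3.integrableOn
  have e1 := integral_Ioi_of_hasDerivAt_of_tendsto' (a := x) (fun v _ => hd2 v)
    hi2.integrableOn t1
  have e2 := integral_Iic_of_hasDerivAt_of_tendsto' (a := x) (fun v _ => hd2 v)
    hi2.integrableOn t2
  have i4 := (integrable_sq_of_memLp hf).add (integrable_sq_of_memLp hf')
  have l1 : ∫ y in Iic x, 2 * (f y * f' y) ≤ ∫ y in Iic x, (f y ^ 2 + f' y ^ 2) :=
    setIntegral_mono hi2.integrableOn i4.integrableOn fun y => by
      nlinarith [sq_nonneg (f y - f' y)]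
  have l2 : ∫ y in Ioi x, -(2 * (f y * f' y)) ≤ ∫ y in Ioi x, (f y ^ 2 + f' y ^ 2) :=
    setIntegral_mono hi2.integrableOn.neg i4.integrableOn fun y => by
      beta_reduce
      nlinarith [sq_nonneg (f y + f' y)]
  rw [integral_neg] at l2
  have e3 := intervalIntegral.integral_Iic_add_Ioi (b := x) i4.integrableOn i4.integrableOn
  simp only [Pi.add_apply] at e3
  rw [integral_add (integrable_sq_of_memLp hf) (integrable_sq_of_memLp hf')] at e3
  nlinarith

/-- The embedding in squared, extended-valued form: the finite-norm hypothesis disappears, so that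
it can be applied at every `x` before integrating by Tonelli. -/
theorem IsSobolevConst.enorm_sq_le {Iz : Set ℝ} {dens : ℝ → ℝ} {C₁ : ℝ}
    (hC : IsSobolevConst Iz dens C₁) (hIz : MeasurableSet Iz)
    (hν : (zMeasure Iz dens).restrict Iz = zMeasure Iz dens) {f f' : ℝ → ℝ}
    (hd : ∀ z ∈ Iz, HasDerivAt f (f' z) z) (hc : ContinuousOn f' Iz) {z : ℝ} (hz : z ∈ Iz) :
    ‖f z‖ₑ ^ 2 ≤ ENNReal.ofReal (C₁ ^ 2) *
      ∫⁻ y, (‖f y‖ₑ ^ 2 + ‖f' y‖ₑ ^ 2) ∂(zMeasure Iz dens) := by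
  have hfc : ContinuousOn f Iz := fun v hv => (hd v hv).continuousAt.continuousWithinAt
  have h1 : 0 < C₁ := by linarith [hC.1]
  have hm : AEStronglyMeasurable f (zMeasure Iz dens) := by
    rw [← hν]; exact hfc.aestronglyMeasurable hIz
  have hm' : AEStronglyMeasurable f' (zMeasure Iz dens) := by
    rw [← hν]; exact hc.aestronglyMeasurable hIz
  by_cases htop : ∫⁻ y, (‖f y‖ₑ ^ 2 + ‖f' y‖ₑ ^ 2) ∂(zMeasure Iz dens) = ∞
  -- The constant is positive, so the product with an infinite integral is infinite rather than `0 *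
  -- ∞ = 0`.
  · rw [htop, ENNReal.mul_top (by simpa using h1.ne')]; exact le_top
  have hlt := lt_top_iff_ne_top.2 htop
  have hf : MemLp f 2 (zMeasure Iz dens) := memLp_two_of_lintegral_lt_top hm
    ((lintegral_mono fun y => le_self_add).trans_lt hlt)
  have hf' : MemLp f' 2 (zMeasure Iz dens) := memLp_two_of_lintegral_lt_top hm'
    ((lintegral_mono fun y => le_add_self).trans_lt hlt)
  rw [lintegral_add_left' (hm.enorm.pow_const 2), ← ofReal_integral_sq hf,
    ← ofReal_integral_sq hf', ← ENNReal.ofReal_add (integral_nonneg fun _ => sq_nonneg _)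
      (integral_nonneg fun _ => sq_nonneg _), ← enorm_pow, Real.enorm_of_nonneg (sq_nonneg _),
    ← ENNReal.ofReal_mul (sq_nonneg _)]
  refine ENNReal.ofReal_le_ofReal ?_
  have := hC.2 f f' hd hc hf hf' z hz
  rw [integral_add hf.integrable_sq hf'.integrable_sq] at this
  have h2 := pow_le_pow_left₀ (abs_nonneg _) this 2
  rw [mul_pow, Real.sq_sqrt (add_nonneg (integral_nonneg fun _ => sq_nonneg _)
    (integral_nonneg fun _ => sq_nonneg _)), sq_abs] at h2
  exact h2

/-! ### Supports of the measures -/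

theorem IsDensity.restrict_zMeasure {Iz : Set ℝ} {dens : ℝ → ℝ} (h : IsDensity Iz dens) :
    (zMeasure Iz dens).restrict Iz = zMeasure Iz dens := by
  unfold zMeasure
  rw [restrict_withDensity h.isOpen.measurableSet, Measure.restrict_restrict
    h.isOpen.measurableSet, inter_self]

theorem IsDensity.ae_mem {Iz : Set ℝ} {dens : ℝ → ℝ} (h : IsDensity Iz dens) :
    ∀ᵐ z ∂(zMeasure Iz dens), z ∈ Iz := by
  rw [← h.restrict_zMeasure]; exact ae_restrict_mem h.isOpen.measurableSet

theorem IsDensity.xz_ae_mem {Iz : Set ℝ} {dens : ℝ → ℝ} (h : IsDensity Iz dens) :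
    ∀ᵐ p ∂(xzMeasure Iz dens), p.2 ∈ Iz := by
  have := h.prob
  exact Measure.quasiMeasurePreserving_snd.ae h.ae_mem

theorem IsDensity.xz_aestronglyMeasurable {Iz : Set ℝ} {dens : ℝ → ℝ} (h : IsDensity Iz dens)
    {f : ℝ → ℝ → ℝ} (hf : ContinuousOn (fun p : ℝ × ℝ => f p.1 p.2) (univ ×ˢ Iz)) :
    AEStronglyMeasurable (fun p : ℝ × ℝ => f p.1 p.2) (xzMeasure Iz dens) := by
  have := h.prob
  have : (xzMeasure Iz dens).restrict (univ ×ˢ Iz) = xzMeasure Iz dens := by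
    unfold xzMeasure
    rw [← Measure.prod_restrict, h.restrict_zMeasure, Measure.restrict_univ]
  rw [← this]
  exact hf.aestronglyMeasurable (MeasurableSet.univ.prod h.isOpen.measurableSet)

/-! ### Products of two functions of `(x, z)` -/

/-- `∂_x^j ∂_z^k` derivatives, `j ≤ 1`, `k ≤ m`, of a function of `(x, z)`, all continuous. -/
structure Chain (Iz : Set ℝ) (m : ℕ) (F : ℕ → ℕ → ℝ → ℝ → ℝ) : Prop where
  cont : ∀ j ≤ 1, ∀ k ≤ m, ContinuousOn (fun p : ℝ × ℝ => F j k p.1 p.2) (univ ×ˢ Iz)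
  dx : ∀ k ≤ m, ∀ x, ∀ z ∈ Iz, HasDerivAt (fun y => F 0 k y z) (F 1 k x z) x
  dz : ∀ j ≤ 1, ∀ k < m, ∀ x, ∀ z ∈ Iz, HasDerivAt (fun y => F j k x y) (F j (k + 1) x z) z

/-- `‖∂_z^k F‖²_{H¹_x}` as a lower integral. -/
def sobLIntegral (Iz : Set ℝ) (dens : ℝ → ℝ) (F : ℕ → ℕ → ℝ → ℝ → ℝ) (k : ℕ) : ℝ≥0∞ :=
  ∫⁻ p, (‖F 0 k p.1 p.2‖ₑ ^ 2 + ‖F 1 k p.1 p.2‖ₑ ^ 2) ∂(xzMeasure Iz dens)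

theorem ContinuousOn.slice_left {Iz : Set ℝ} {f : ℝ → ℝ → ℝ}
    (hf : ContinuousOn (fun p : ℝ × ℝ => f p.1 p.2) (univ ×ˢ Iz)) {z : ℝ} (hz : z ∈ Iz) :
    Continuous fun x => f x z := by
  rw [← continuousOn_univ]
  exact hf.comp (f := fun x : ℝ => (x, z)) (by fun_prop) fun x _ => ⟨mem_univ _, hz⟩

theorem ContinuousOn.slice_right {Iz : Set ℝ} {f : ℝ → ℝ → ℝ}
    (hf : ContinuousOn (fun p : ℝ × ℝ => f p.1 p.2) (univ ×ˢ Iz)) (x : ℝ) :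
    ContinuousOn (fun z => f x z) Iz :=
  hf.comp (f := fun z : ℝ => (x, z)) (by fun_prop) fun z hz => ⟨mem_univ _, hz⟩

section Product

variable {Iz : Set ℝ} {dens : ℝ → ℝ} {C₁ : ℝ} {m : ℕ} {X Y : ℕ → ℕ → ℝ → ℝ → ℝ}

theorem Chain.two_mul_enorm_sq_le (hX : Chain Iz m X) {k : ℕ} (hk : k ≤ m) (x : ℝ) {z : ℝ}
    (hz : z ∈ Iz) :
    2 * ‖X 0 k x z‖ₑ ^ 2 ≤ ∫⁻ y, (‖X 0 k y z‖ₑ ^ 2 + ‖X 1 k y z‖ₑ ^ 2) :=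
  two_mul_enorm_sq_le_lintegral (fun y => hX.dx k hk y z hz)
    (ContinuousOn.slice_left (hX.cont 1 le_rfl k hk) hz) x

theorem Chain.enorm_sq_le (hX : Chain Iz m X) (hπ : IsDensity Iz dens)
    (hC : IsSobolevConst Iz dens C₁) {j k : ℕ} (hj : j ≤ 1) (hk : k < m) (x : ℝ) {z : ℝ}
    (hz : z ∈ Iz) :
    ‖X j k x z‖ₑ ^ 2 ≤ ENNReal.ofReal (C₁ ^ 2) *
      ∫⁻ y, (‖X j k x y‖ₑ ^ 2 + ‖X j (k + 1) x y‖ₑ ^ 2) ∂(zMeasure Iz dens) :=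
  hC.enorm_sq_le hπ.isOpen.measurableSet hπ.restrict_zMeasure
    (fun y hy => hX.dz j hj k hk x y hy)
    (ContinuousOn.slice_right (hX.cont j hj (k + 1) hk) x) hz

theorem Chain.aemeasurable (hX : Chain Iz m X) (hπ : IsDensity Iz dens) {j k : ℕ} (hj : j ≤ 1)
    (hk : k ≤ m) :
    AEMeasurable (fun p : ℝ × ℝ => ‖X j k p.1 p.2‖ₑ ^ 2) (xzMeasure Iz dens) :=
  (hπ.xz_aestronglyMeasurable (hX.cont j hj k hk)).enorm.pow_const 2

/-- Pointwise bound by the `H¹_z(H¹_x)` norm. -/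
theorem Chain.two_mul_enorm_sq_le_sob (hX : Chain Iz m X) (hπ : IsDensity Iz dens)
    (hC : IsSobolevConst Iz dens C₁) {k : ℕ} (hk : k < m) (x : ℝ) {z : ℝ} (hz : z ∈ Iz) :
    2 * ‖X 0 k x z‖ₑ ^ 2 ≤ ENNReal.ofReal (C₁ ^ 2) *
      (sobLIntegral Iz dens X k + sobLIntegral Iz dens X (k + 1)) := by
  have := hπ.prob
  refine (hX.two_mul_enorm_sq_le hk.le x hz).trans ?_
  have hm : ∀ j ≤ 1, AEMeasurable (fun p : ℝ × ℝ => ‖X j k p.1 p.2‖ₑ ^ 2 + ‖X j (k + 1) p.1 p.2‖ₑ ^ 2)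
      (xzMeasure Iz dens) := fun j hj =>
    (hX.aemeasurable hπ hj hk.le).add (hX.aemeasurable hπ hj hk)
  have hm' : ∀ k ≤ m, AEMeasurable (fun p : ℝ × ℝ => ‖X 0 k p.1 p.2‖ₑ ^ 2 + ‖X 1 k p.1 p.2‖ₑ ^ 2)
      (xzMeasure Iz dens) := fun k hk =>
    (hX.aemeasurable hπ zero_le_one hk).add (hX.aemeasurable hπ le_rfl hk)
  calc ∫⁻ y, (‖X 0 k y z‖ₑ ^ 2 + ‖X 1 k y z‖ₑ ^ 2)
      ≤ ∫⁻ y, (ENNReal.ofReal (C₁ ^ 2) * ((∫⁻ w, (‖X 0 k y w‖ₑ ^ 2 + ‖X 0 (k + 1) y w‖ₑ ^ 2)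
          ∂(zMeasure Iz dens)) + ∫⁻ w, (‖X 1 k y w‖ₑ ^ 2 + ‖X 1 (k + 1) y w‖ₑ ^ 2)
          ∂(zMeasure Iz dens))) := by
        refine lintegral_mono fun y => ?_
        rw [mul_add]
        exact add_le_add (hX.enorm_sq_le hπ hC zero_le_one hk y hz)
          (hX.enorm_sq_le hπ hC le_rfl hk y hz)
    _ = ENNReal.ofReal (C₁ ^ 2) * (∫⁻ p, (‖X 0 k p.1 p.2‖ₑ ^ 2 + ‖X 0 (k + 1) p.1 p.2‖ₑ ^ 2)
          ∂(xzMeasure Iz dens) + ∫⁻ p, (‖X 1 k p.1 p.2‖ₑ ^ 2 + ‖X 1 (k + 1) p.1 p.2‖ₑ ^ 2)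
          ∂(xzMeasure Iz dens)) := by
        rw [lintegral_const_mul' _ _ ENNReal.ofReal_ne_top]
        congr 1
        unfold xzMeasure
        rw [lintegral_prod _ (hm 0 zero_le_one), lintegral_prod _ (hm 1 le_rfl),
          lintegral_add_left' (hm 0 zero_le_one).lintegral_prod_right']
    _ = _ := by
        unfold sobLIntegral
        congr 1
        rw [← lintegral_add_left' (hm 0 zero_le_one), ← lintegral_add_left' (hm' k hk.le)]
        refine lintegral_congr fun p => ?_
        ring

/-- The factor `X` pays for the supremum in `z`, and at most one of the factors carries an
`x`-derivative. If `X` carries none, it is bounded pointwise in `(x, z)` by its `H¹_z(H¹_x)` norm.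
If `X` carries one, then `X` is placed in `L²_x L^∞_z` and `Y` in `L^∞_x L²_z`, and the double
integral factorizes. In both cases the embedding in `x` is used exactly once, so one factor `2`
survives. -/
theorem Chain.two_mul_lintegral_mul_le (hX : Chain Iz m X) (hY : Chain Iz m Y)
    (hπ : IsDensity Iz dens) (hC : IsSobolevConst Iz dens C₁) {j j' k k' : ℕ} (hj : j + j' ≤ 1)
    (hk : k < m) (hk' : k' ≤ m) :
    2 * ∫⁻ p, ‖X j k p.1 p.2‖ₑ ^ 2 * ‖Y j' k' p.1 p.2‖ₑ ^ 2 ∂(xzMeasure Iz dens)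
      ≤ ENNReal.ofReal (C₁ ^ 2) * (sobLIntegral Iz dens X k + sobLIntegral Iz dens X (k + 1))
        * sobLIntegral Iz dens Y k' := by
  have := hπ.prob
  rw [← lintegral_const_mul' _ _ (by norm_num)]
  have hj' : j' ≤ 1 := by omega
  rcases Nat.eq_zero_or_pos j with rfl | hj0
  · calc ∫⁻ p, 2 * (‖X 0 k p.1 p.2‖ₑ ^ 2 * ‖Y j' k' p.1 p.2‖ₑ ^ 2) ∂(xzMeasure Iz dens)
        ≤ ∫⁻ p, (ENNReal.ofReal (C₁ ^ 2) * (sobLIntegral Iz dens X k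
            + sobLIntegral Iz dens X (k + 1))) * ‖Y j' k' p.1 p.2‖ₑ ^ 2 ∂(xzMeasure Iz dens) := by
          refine lintegral_mono_ae ?_
          filter_upwards [hπ.xz_ae_mem] with p hp
          rw [← mul_assoc]
          exact mul_le_mul' (hX.two_mul_enorm_sq_le_sob hπ hC hk p.1 hp) le_rfl
      _ = (ENNReal.ofReal (C₁ ^ 2) * (sobLIntegral Iz dens X k
            + sobLIntegral Iz dens X (k + 1))) * ∫⁻ p, ‖Y j' k' p.1 p.2‖ₑ ^ 2 ∂(xzMeasure Iz dens) :=
          lintegral_const_mul'' _ (hY.aemeasurable hπ hj' hk')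
      _ ≤ _ := by
          gcongr
          unfold sobLIntegral
          refine lintegral_mono fun p => ?_
          interval_cases j'
          · exact le_self_add
          · exact le_add_self
  · obtain rfl : j = 1 := by omega
    obtain rfl : j' = 0 := by omega
    have hmX : AEMeasurable (fun p : ℝ × ℝ => ‖X 1 k p.1 p.2‖ₑ ^ 2 + ‖X 1 (k + 1) p.1 p.2‖ₑ ^ 2)
        (xzMeasure Iz dens) := (hX.aemeasurable hπ le_rfl hk.le).add (hX.aemeasurable hπ le_rfl hk)
    have hmY : AEMeasurable (fun p : ℝ × ℝ => ‖Y 0 k' p.1 p.2‖ₑ ^ 2 + ‖Y 1 k' p.1 p.2‖ₑ ^ 2)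
        (xzMeasure Iz dens) := (hY.aemeasurable hπ zero_le_one hk').add (hY.aemeasurable hπ le_rfl hk')
    unfold xzMeasure at hmX hmY
    calc ∫⁻ p, 2 * (‖X 1 k p.1 p.2‖ₑ ^ 2 * ‖Y 0 k' p.1 p.2‖ₑ ^ 2) ∂(xzMeasure Iz dens)
        ≤ ∫⁻ p, (ENNReal.ofReal (C₁ ^ 2) * ∫⁻ w, (‖X 1 k p.1 w‖ₑ ^ 2 + ‖X 1 (k + 1) p.1 w‖ₑ ^ 2)
            ∂(zMeasure Iz dens)) * (∫⁻ y, (‖Y 0 k' y p.2‖ₑ ^ 2 + ‖Y 1 k' y p.2‖ₑ ^ 2))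
            ∂(xzMeasure Iz dens) := by
          refine lintegral_mono_ae ?_
          filter_upwards [hπ.xz_ae_mem] with p hp
          rw [mul_left_comm]
          exact mul_le_mul' (hX.enorm_sq_le hπ hC le_rfl hk p.1 hp)
            (hY.two_mul_enorm_sq_le hk' p.1 hp)
      _ = ENNReal.ofReal (C₁ ^ 2) * (∫⁻ p, (‖X 1 k p.1 p.2‖ₑ ^ 2 + ‖X 1 (k + 1) p.1 p.2‖ₑ ^ 2)
            ∂(xzMeasure Iz dens)) * sobLIntegral Iz dens Y k' := by
          unfold sobLIntegral xzMeasure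
          rw [lintegral_prod_mul (hmX.lintegral_prod_right'.const_mul _) hmY.lintegral_prod_left',
            lintegral_const_mul' _ _ ENNReal.ofReal_ne_top, ← lintegral_prod _ hmX,
            ← lintegral_prod_symm _ hmY]
      _ ≤ _ := by
          gcongr
          rw [lintegral_add_left' (hX.aemeasurable hπ le_rfl hk.le)]
          exact add_le_add (lintegral_mono fun p => le_add_self) (lintegral_mono fun p => le_add_self)

end Product

/-! ### Trilinear estimate -/

/-- `dμ(x,v,z)` with the variables in the order `((x, z), v)`. -/
def xzvMeasure (Iz : Set ℝ) (dens : ℝ → ℝ) : Measure ((ℝ × ℝ) × ℝ) :=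
  (xzMeasure Iz dens).prod volume

instance xzvMeasure.instSFinite {Iz : Set ℝ} {dens : ℝ → ℝ} [SFinite (zMeasure Iz dens)] :
    SFinite (xzMeasure Iz dens) := by unfold xzMeasure; infer_instance

section Trilinear

variable {Iz : Set ℝ} {dens : ℝ → ℝ} {C₁ : ℝ} {m : ℕ} {E : ℕ → ℕ → ℝ → ℝ → ℝ}
  {G : ℕ → ℕ → ℝ → ℝ → ℝ → ℝ}

theorem sobLIntegral_eq (hπ : IsDensity Iz dens) (hE : Chain Iz m E)
    (hE2 : ∀ j ≤ 1, ∀ k ≤ m, MemLp (fun p : ℝ × ℝ => E j k p.1 p.2) 2 (xzMeasure Iz dens))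
    {k : ℕ} (hk : k ≤ m) :
    sobLIntegral Iz dens E k = ENNReal.ofReal ((∫ p, E 0 k p.1 p.2 ^ 2 ∂(xzMeasure Iz dens))
      + ∫ p, E 1 k p.1 p.2 ^ 2 ∂(xzMeasure Iz dens)) := by
  unfold sobLIntegral
  rw [lintegral_add_left' (hE.aemeasurable hπ zero_le_one hk),
    ENNReal.ofReal_add (integral_nonneg fun _ => sq_nonneg _) (integral_nonneg fun _ => sq_nonneg _),
    ofReal_integral_sq (hE2 0 zero_le_one k hk), ofReal_integral_sq (hE2 1 le_rfl k hk)]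

theorem lintegral_sobLIntegral_eq (hπ : IsDensity Iz dens)
    (hG2 : ∀ j ≤ 1, ∀ k ≤ m,
      MemLp (fun q : (ℝ × ℝ) × ℝ => G j k q.1.1 q.2 q.1.2) 2 (xzvMeasure Iz dens))
    {k : ℕ} (hk : k ≤ m) :
    ∫⁻ v, sobLIntegral Iz dens (fun j k x z => G j k x v z) k
      = ENNReal.ofReal ((∫ q, G 0 k q.1.1 q.2 q.1.2 ^ 2 ∂(xzvMeasure Iz dens))
      + ∫ q, G 1 k q.1.1 q.2 q.1.2 ^ 2 ∂(xzvMeasure Iz dens)) := by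
  have := hπ.prob
  have h0 := (hG2 0 zero_le_one k hk).aestronglyMeasurable.enorm.pow_const 2
  have h1 := (hG2 1 le_rfl k hk).aestronglyMeasurable.enorm.pow_const 2
  rw [ENNReal.ofReal_add (integral_nonneg fun _ => sq_nonneg _)
    (integral_nonneg fun _ => sq_nonneg _),
    ofReal_integral_sq (hG2 0 zero_le_one k hk), ofReal_integral_sq (hG2 1 le_rfl k hk),
    ← lintegral_add_left' h0]
  unfold xzvMeasure at h0 h1 ⊢
  exact (lintegral_prod_symm _ (h0.add h1)).symm

theorem aemeasurable_sobLIntegral (hπ : IsDensity Iz dens)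
    (hG2 : ∀ j ≤ 1, ∀ k ≤ m,
      MemLp (fun q : (ℝ × ℝ) × ℝ => G j k q.1.1 q.2 q.1.2) 2 (xzvMeasure Iz dens))
    {k : ℕ} (hk : k ≤ m) :
    AEMeasurable (fun v => sobLIntegral Iz dens (fun j k x z => G j k x v z) k) := by
  have := hπ.prob
  have h0 := (hG2 0 zero_le_one k hk).aestronglyMeasurable.enorm.pow_const 2
  have h1 := (hG2 1 le_rfl k hk).aestronglyMeasurable.enorm.pow_const 2
  unfold xzvMeasure at h0 h1
  exact (h0.add h1).lintegral_prod_left'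

theorem aestronglyMeasurable_fst (hπ : IsDensity Iz dens) (hE : Chain Iz m E) {j k : ℕ}
    (hj : j ≤ 1) (hk : k ≤ m) : AEStronglyMeasurable
      (fun q : (ℝ × ℝ) × ℝ => E j k q.1.1 q.1.2) (xzvMeasure Iz dens) := by
  have := hπ.prob
  exact (hπ.xz_aestronglyMeasurable (hE.cont j hj k hk)).comp_fst

variable (hπ : IsDensity Iz dens) (hC : IsSobolevConst Iz dens C₁) (hE : Chain Iz m E)
  (hE2 : ∀ j ≤ 1, ∀ k ≤ m, MemLp (fun p : ℝ × ℝ => E j k p.1 p.2) 2 (xzMeasure Iz dens))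
  (hG : ∀ v, Chain Iz m fun j k x z => G j k x v z)
  (hG2 : ∀ j ≤ 1, ∀ k ≤ m,
      MemLp (fun q : (ℝ × ℝ) × ℝ => G j k q.1.1 q.2 q.1.2) 2 (xzvMeasure Iz dens))

include hπ hE hG2 in
theorem lintegral_mul_eq {j j' k k' : ℕ} (hj : j + j' ≤ 1) (hk : k ≤ m) (hk' : k' ≤ m) :
    ∫⁻ q, ‖E j k q.1.1 q.1.2 * G j' k' q.1.1 q.2 q.1.2‖ₑ ^ 2 ∂(xzvMeasure Iz dens)
      = ∫⁻ v, ∫⁻ p, ‖E j k p.1 p.2‖ₑ ^ 2 * ‖G j' k' p.1 v p.2‖ₑ ^ 2 ∂(xzMeasure Iz dens) := by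
  have := hπ.prob
  have hm := ((aestronglyMeasurable_fst hπ hE (by omega : j ≤ 1) hk).enorm.pow_const 2).mul
    ((hG2 j' (by omega) k' hk').aestronglyMeasurable.enorm.pow_const 2)
  unfold xzvMeasure at hm ⊢
  simp only [enorm_mul, mul_pow]
  exact lintegral_prod_symm _ hm

/-- Finiteness of the lower integral supplies square integrability, after which the bound can be
read among real numbers. -/
theorem two_mul_integral_sq_le_of_lintegral {α : Type*} [MeasurableSpace α] {μ : Measure α}
    {f : α → ℝ} (hf : AEStronglyMeasurable f μ) {c a b : ℝ} (hc : 0 ≤ c) (ha : 0 ≤ a)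
    (hb : 0 ≤ b)
    (h : 2 * ∫⁻ x, ‖f x‖ₑ ^ 2 ∂μ ≤ ENNReal.ofReal c * ENNReal.ofReal a * ENNReal.ofReal b) :
    MemLp f 2 μ ∧ 2 * ∫ x, f x ^ 2 ∂μ ≤ c * a * b := by
  rw [← ENNReal.ofReal_mul hc, ← ENNReal.ofReal_mul (by positivity)] at h
  have hfm : MemLp f 2 μ := by
    refine memLp_two_of_lintegral_lt_top hf ?_
    refine lt_of_le_of_lt ?_ (h.trans_lt ENNReal.ofReal_lt_top)
    exact le_mul_of_one_le_left zero_le (by norm_num)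
  refine ⟨hfm, ?_⟩
  rw [← ofReal_integral_sq hfm, show (2 : ℝ≥0∞) = ENNReal.ofReal 2 by simp,
    ← ENNReal.ofReal_mul (by norm_num)] at h
  exact (ENNReal.ofReal_le_ofReal_iff (by positivity)).1 h

include hπ hC hE hE2 hG hG2 in
/-- Product estimate with few `z`-derivatives on the macroscopic factor. -/
theorem product_low {j j' k k' : ℕ} (hj : j + j' ≤ 1) (hk : k < m) (hk' : k' ≤ m) :
    MemLp (fun q : (ℝ × ℝ) × ℝ => E j k q.1.1 q.1.2 * G j' k' q.1.1 q.2 q.1.2) 2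
      (xzvMeasure Iz dens) ∧
    2 * ∫ q, (E j k q.1.1 q.1.2 * G j' k' q.1.1 q.2 q.1.2) ^ 2 ∂(xzvMeasure Iz dens)
      ≤ C₁ ^ 2 * (((∫ p, E 0 k p.1 p.2 ^ 2 ∂(xzMeasure Iz dens))
        + ∫ p, E 1 k p.1 p.2 ^ 2 ∂(xzMeasure Iz dens))
        + ((∫ p, E 0 (k + 1) p.1 p.2 ^ 2 ∂(xzMeasure Iz dens))
        + ∫ p, E 1 (k + 1) p.1 p.2 ^ 2 ∂(xzMeasure Iz dens)))
        * ((∫ q, G 0 k' q.1.1 q.2 q.1.2 ^ 2 ∂(xzvMeasure Iz dens))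
        + ∫ q, G 1 k' q.1.1 q.2 q.1.2 ^ 2 ∂(xzvMeasure Iz dens)) := by
  have := hπ.prob
  have n1 : ∀ j k, 0 ≤ ∫ p, E j k p.1 p.2 ^ 2 ∂(xzMeasure Iz dens) := fun j k =>
    integral_nonneg fun _ => sq_nonneg _
  have n2 : ∀ j k, 0 ≤ ∫ q, G j k q.1.1 q.2 q.1.2 ^ 2 ∂(xzvMeasure Iz dens) := fun j k =>
    integral_nonneg fun _ => sq_nonneg _
  refine two_mul_integral_sq_le_of_lintegral
    (f := fun q : (ℝ × ℝ) × ℝ => E j k q.1.1 q.1.2 * G j' k' q.1.1 q.2 q.1.2) ((aestronglyMeasurable_fst hπ hE (by omega) hk.le).mul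
      (hG2 j' (by omega) k' hk').aestronglyMeasurable) (sq_nonneg _)
    (add_nonneg (add_nonneg (n1 _ _) (n1 _ _)) (add_nonneg (n1 _ _) (n1 _ _)))
    (add_nonneg (n2 _ _) (n2 _ _)) ?_
  rw [lintegral_mul_eq hπ hE hG2 hj hk.le hk', ← lintegral_const_mul' _ _ (by norm_num),
    ENNReal.ofReal_add (add_nonneg (n1 _ _) (n1 _ _)) (add_nonneg (n1 _ _) (n1 _ _)),
    ← sobLIntegral_eq hπ hE hE2 hk.le, ← sobLIntegral_eq hπ hE hE2 hk,
    ← lintegral_sobLIntegral_eq hπ hG2 hk', ← lintegral_const_mul'' _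
      (aemeasurable_sobLIntegral hπ hG2 hk')]
  exact lintegral_mono fun v => hE.two_mul_lintegral_mul_le (hG v) hπ hC hj hk hk'

include hπ hC hE hE2 hG hG2 in
/-- Product estimate with few `z`-derivatives on the kinetic factor. -/
theorem product_high {j j' k k' : ℕ} (hj : j + j' ≤ 1) (hk : k ≤ m) (hk' : k' < m) :
    MemLp (fun q : (ℝ × ℝ) × ℝ => E j k q.1.1 q.1.2 * G j' k' q.1.1 q.2 q.1.2) 2
      (xzvMeasure Iz dens) ∧
    2 * ∫ q, (E j k q.1.1 q.1.2 * G j' k' q.1.1 q.2 q.1.2) ^ 2 ∂(xzvMeasure Iz dens)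
      ≤ C₁ ^ 2 * (((∫ q, G 0 k' q.1.1 q.2 q.1.2 ^ 2 ∂(xzvMeasure Iz dens))
        + ∫ q, G 1 k' q.1.1 q.2 q.1.2 ^ 2 ∂(xzvMeasure Iz dens))
        + ((∫ q, G 0 (k' + 1) q.1.1 q.2 q.1.2 ^ 2 ∂(xzvMeasure Iz dens))
        + ∫ q, G 1 (k' + 1) q.1.1 q.2 q.1.2 ^ 2 ∂(xzvMeasure Iz dens)))
        * ((∫ p, E 0 k p.1 p.2 ^ 2 ∂(xzMeasure Iz dens))
        + ∫ p, E 1 k p.1 p.2 ^ 2 ∂(xzMeasure Iz dens)) := by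
  have := hπ.prob
  have n1 : ∀ j k, 0 ≤ ∫ p, E j k p.1 p.2 ^ 2 ∂(xzMeasure Iz dens) := fun j k =>
    integral_nonneg fun _ => sq_nonneg _
  have n2 : ∀ j k, 0 ≤ ∫ q, G j k q.1.1 q.2 q.1.2 ^ 2 ∂(xzvMeasure Iz dens) := fun j k =>
    integral_nonneg fun _ => sq_nonneg _
  refine two_mul_integral_sq_le_of_lintegral
    (f := fun q : (ℝ × ℝ) × ℝ => E j k q.1.1 q.1.2 * G j' k' q.1.1 q.2 q.1.2) ((aestronglyMeasurable_fst hπ hE (by omega) hk).mul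
      (hG2 j' (by omega) k' hk'.le).aestronglyMeasurable) (sq_nonneg _)
    (add_nonneg (add_nonneg (n2 _ _) (n2 _ _)) (add_nonneg (n2 _ _) (n2 _ _)))
    (add_nonneg (n1 _ _) (n1 _ _)) ?_
  rw [lintegral_mul_eq hπ hE hG2 hj hk hk'.le, ← lintegral_const_mul' _ _ (by norm_num),
    ENNReal.ofReal_add (add_nonneg (n2 _ _) (n2 _ _)) (add_nonneg (n2 _ _) (n2 _ _)),
    ← sobLIntegral_eq hπ hE hE2 hk, ← lintegral_sobLIntegral_eq hπ hG2 hk'.le,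
    ← lintegral_sobLIntegral_eq hπ hG2 hk', ← lintegral_add_left'
      (aemeasurable_sobLIntegral hπ hG2 hk'.le), ← lintegral_const_mul' _ _ ENNReal.ofReal_ne_top,
    ← lintegral_mul_const' _ _ (by rw [sobLIntegral_eq hπ hE hE2 hk]; exact ENNReal.ofReal_ne_top)]
  refine lintegral_mono fun v => ?_
  -- The slice estimate with the roles exchanged: the kinetic factor, at fixed `v`, takes the
  -- supremum in `z`.
  have := (hG v).two_mul_lintegral_mul_le hE hπ hC (j := j') (j' := j) (by omega) hk' hk
  simp only [mul_comm (‖E j k _ _‖ₑ ^ 2)]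
  exact this

end Trilinear

/-! ### Discrete convolution -/

/-- Young's inequality `ℓ¹ * ℓ² ⊂ ℓ²` paired with `w`: for each fixed `k` the shifted sequence `l ↦
g (l - k)` has `ℓ²` norm at most that of `g`, and Cauchy–Schwarz in `l` applies. -/
theorem sum_sum_range_le {n m : ℕ} {c g w : ℕ → ℝ} (hc : ∀ k, 0 ≤ c k) :
    ∑ l ∈ Finset.range (m + 1), ∑ p ∈ Finset.HasAntidiagonal.antidiagonal l,
      (if p.1 < n then c p.1 * g p.2 * w l else 0)
    ≤ (∑ k ∈ Finset.range n, c k) * (Real.sqrt (∑ k ∈ Finset.range (m + 1), g k ^ 2)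
      * Real.sqrt (∑ l ∈ Finset.range (m + 1), w l ^ 2)) := by
  have h1 : ∀ l ∈ Finset.range (m + 1), ∑ p ∈ Finset.HasAntidiagonal.antidiagonal l,
      (if p.1 < n then c p.1 * g p.2 * w l else 0)
      = ∑ k ∈ Finset.range n, c k * ((if k ≤ l then g (l - k) else 0) * w l) := by
    intro l _
    rw [Finset.Nat.sum_antidiagonal_eq_sum_range_succ_mk]
    have e1 : ∑ k ∈ Finset.range n, c k * ((if k ≤ l then g (l - k) else 0) * w l)
        = ∑ k ∈ (Finset.range n).filter (· ≤ l), c k * g (l - k) * w l := by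
      rw [Finset.sum_filter]
      refine Finset.sum_congr rfl fun k _ => ?_
      split_ifs <;> ring
    rw [e1, ← Finset.sum_filter]
    refine Finset.sum_congr ?_ fun k _ => rfl
    ext k
    simp only [Finset.mem_filter, Finset.mem_range]
    omega
  rw [Finset.sum_congr rfl h1, Finset.sum_comm, Finset.sum_mul]
  refine Finset.sum_le_sum fun k _ => ?_
  rw [← Finset.mul_sum]
  refine mul_le_mul_of_nonneg_left ?_ (hc k)
  refine (Real.sum_mul_le_sqrt_mul_sqrt _ _ _).trans ?_
  refine mul_le_mul_of_nonneg_right (Real.sqrt_le_sqrt ?_) (Real.sqrt_nonneg _)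
  calc ∑ l ∈ Finset.range (m + 1), (if k ≤ l then g (l - k) else 0) ^ 2
      = ∑ l ∈ (Finset.range (m + 1)).filter (k ≤ ·), g (l - k) ^ 2 := by
        rw [Finset.sum_filter]
        refine Finset.sum_congr rfl fun l _ => ?_
        split_ifs <;> simp
    _ = ∑ j ∈ ((Finset.range (m + 1)).filter (k ≤ ·)).image (· - k), g j ^ 2 := by
        rw [Finset.sum_image]
        intro a ha b hb hab
        simp only [Finset.coe_filter, Finset.mem_range, Set.mem_ofPred_eq] at ha hb
        simp only at hab
        omega
    _ ≤ ∑ j ∈ Finset.range (m + 1), g j ^ 2 := by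
        refine Finset.sum_le_sum_of_subset_of_nonneg ?_ fun _ _ _ => sq_nonneg _
        intro j hj
        simp only [Finset.mem_image, Finset.mem_filter, Finset.mem_range] at hj ⊢
        omega

/-- Cauchy–Schwarz over `n` terms gives `√n`. Each `e k ^ 2` occurs at most twice among the pairs of
neighbours, which gives the `2`. -/
theorem sum_range_sqrt_le {n m : ℕ} (hn : n ≤ m) (e : ℕ → ℝ) :
    ∑ k ∈ Finset.range n, Real.sqrt (e k ^ 2 + e (k + 1) ^ 2)
      ≤ Real.sqrt (2 * n) * Real.sqrt (∑ k ∈ Finset.range (m + 1), e k ^ 2) := by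
  have h1 := Real.sum_mul_le_sqrt_mul_sqrt (Finset.range n) (fun _ => (1 : ℝ))
    fun k => Real.sqrt (e k ^ 2 + e (k + 1) ^ 2)
  simp only [one_mul, one_pow, Finset.sum_const, Finset.card_range, nsmul_eq_mul, mul_one] at h1
  refine h1.trans ?_
  rw [← Real.sqrt_mul (by positivity), ← Real.sqrt_mul (by positivity)]
  refine Real.sqrt_le_sqrt ?_
  have h2 : ∑ k ∈ Finset.range n, Real.sqrt (e k ^ 2 + e (k + 1) ^ 2) ^ 2
      = ∑ k ∈ Finset.range n, e k ^ 2 + ∑ k ∈ Finset.range n, e (k + 1) ^ 2 := by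
    rw [← Finset.sum_add_distrib]
    exact Finset.sum_congr rfl fun k _ => Real.sq_sqrt (by positivity)
  have h3 : ∑ k ∈ Finset.range n, e k ^ 2 ≤ ∑ k ∈ Finset.range (m + 1), e k ^ 2 :=
    Finset.sum_le_sum_of_subset_of_nonneg (Finset.range_mono (by omega)) fun _ _ _ => sq_nonneg _
  have h4 : ∑ k ∈ Finset.range n, e (k + 1) ^ 2 ≤ ∑ k ∈ Finset.range (m + 1), e k ^ 2 := by
    rw [Finset.sum_range_succ' _ m]
    have := Finset.sum_le_sum_of_subset_of_nonneg (f := fun k => e (k + 1) ^ 2)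
      (Finset.range_mono hn) fun _ _ _ => sq_nonneg _
    have h0 := sq_nonneg (e 0)
    linarith
  rw [h2]
  nlinarith [Nat.cast_nonneg (α := ℝ) n]

theorem choose_le_middle' {l m k : ℕ} (hl : l ≤ m) : l.choose k ≤ m.choose ((m + 1) / 2) := by
  refine (Nat.choose_le_choose k hl).trans ((Nat.choose_le_middle k m).trans ?_)
  rw [← Nat.choose_symm (show (m + 1) / 2 ≤ m ∨ m = 0 by omega |>.elim id (by omega))]
  rw [show m - (m + 1) / 2 = m / 2 by omega]

theorem sum_range_two_comm (m : ℕ) (f : ℕ → ℕ → ℝ) :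
    ∑ i ∈ Finset.range 2, ∑ l ∈ Finset.range (m + 1), f i l
      = ∑ l ∈ Finset.range (m + 1), (f 0 l + f 1 l) := by
  rw [Finset.sum_comm]
  exact Finset.sum_congr rfl fun l _ => by rw [Finset.sum_range_succ, Finset.sum_range_one]

/-- The combinatorial core of the trilinear estimate. -/
theorem sum_trilinear_le {m : ℕ} (hm : 1 ≤ m) {C₁ : ℝ} (hC : 1 ≤ C₁) {T : ℕ → ℕ × ℕ → ℝ}
    {e g w : ℕ → ℝ} (he : ∀ k, 0 ≤ e k) (hg : ∀ k, 0 ≤ g k) (hw : ∀ k, 0 ≤ w k)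
    (hlow : ∀ k k', k + k' ≤ m → k ≤ k' →
      T (k + k') (k, k') ≤ 8 / 5 * C₁ * (Real.sqrt (e k ^ 2 + e (k + 1) ^ 2) * g k' * w (k + k')))
    (hhigh : ∀ k k', k + k' ≤ m → k' ≤ k →
      T (k + k') (k, k') ≤ 8 / 5 * C₁ * (Real.sqrt (g k' ^ 2 + g (k' + 1) ^ 2) * e k * w (k + k'))) :
    ∑ l ∈ Finset.range (m + 1), ∑ b ∈ Finset.HasAntidiagonal.antidiagonal l,
      (l.choose b.1 : ℝ) * T l b
    ≤ 2 * constA m * C₁ ^ 2 * (Real.sqrt (∑ k ∈ Finset.range (m + 1), e k ^ 2)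
      * Real.sqrt (∑ k ∈ Finset.range (m + 1), g k ^ 2)
      * Real.sqrt (∑ k ∈ Finset.range (m + 1), w k ^ 2)) := by
  -- If `k + k' ≤ m`, the smaller index is at most `m / 2`, so it lies in `range n`. The sequence
  -- attached to that index enters in `ℓ¹`, over `n` terms only.
  set n := m / 2 + 1 with hn
  set B : ℝ := (m.choose ((m + 1) / 2) : ℝ) with hB
  have hB0 : 0 ≤ B := Nat.cast_nonneg _
  set ce : ℕ → ℝ := fun k => Real.sqrt (e k ^ 2 + e (k + 1) ^ 2) with hce
  set cg : ℕ → ℝ := fun k => Real.sqrt (g k ^ 2 + g (k + 1) ^ 2) with hcg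
  have hce0 : ∀ k, 0 ≤ ce k := fun k => Real.sqrt_nonneg _
  have hcg0 : ∀ k, 0 ≤ cg k := fun k => Real.sqrt_nonneg _
  have key : ∀ l ∈ Finset.range (m + 1), ∀ b ∈ Finset.HasAntidiagonal.antidiagonal l,
      (l.choose b.1 : ℝ) * T l b ≤ B * (8 / 5 * C₁)
        * ((if b.1 < n then ce b.1 * g b.2 * w l else 0)
          + if b.2 < n then cg b.2 * e b.1 * w l else 0) := by
    rintro l hl ⟨k, k'⟩ hb
    rw [Finset.mem_range] at hl
    rw [Finset.HasAntidiagonal.mem_antidiagonal] at hb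
    simp only at hb ⊢
    have hch : ((l.choose k : ℕ) : ℝ) ≤ B := by
      rw [hB]; exact_mod_cast choose_le_middle' (show l ≤ m by omega)
    have p1 : 0 ≤ ce k * g k' * w l := mul_nonneg (mul_nonneg (hce0 k) (hg k')) (hw l)
    have p2 : 0 ≤ cg k' * e k * w l := mul_nonneg (mul_nonneg (hcg0 k') (he k)) (hw l)
    subst hb
    rw [mul_assoc B]
    rcases le_total k k' with hk | hk
    · have h1 := hlow k k' (by omega) hk
      rw [if_pos (show k < n by omega)]
      calc _ ≤ ((k + k').choose k : ℝ) * (8 / 5 * C₁ * (ce k * g k' * w (k + k'))) := by gcongr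
        _ ≤ B * (8 / 5 * C₁ * (ce k * g k' * w (k + k'))) := by gcongr
        _ ≤ _ := by
          gcongr
          refine le_add_of_nonneg_right ?_
          split_ifs
          · exact p2
          · exact le_rfl
    · have h1 := hhigh k k' (by omega) hk
      rw [if_pos (show k' < n by omega)]
      calc _ ≤ ((k + k').choose k : ℝ) * (8 / 5 * C₁ * (cg k' * e k * w (k + k'))) := by gcongr
        _ ≤ B * (8 / 5 * C₁ * (cg k' * e k * w (k + k'))) := by gcongr
        _ ≤ _ := by
          gcongr
          refine le_add_of_nonneg_left ?_
          split_ifs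
          · exact p1
          · exact le_rfl
  set SE := Real.sqrt (∑ k ∈ Finset.range (m + 1), e k ^ 2) with hSE
  set SG := Real.sqrt (∑ k ∈ Finset.range (m + 1), g k ^ 2) with hSG
  set SW := Real.sqrt (∑ k ∈ Finset.range (m + 1), w k ^ 2) with hSW
  have hSE0 : 0 ≤ SE := Real.sqrt_nonneg _
  have hSG0 : 0 ≤ SG := Real.sqrt_nonneg _
  have hSW0 : 0 ≤ SW := Real.sqrt_nonneg _
  have s1 := sum_sum_range_le (n := n) (m := m) (c := ce) (g := g) (w := w) hce0
  have s2 := sum_sum_range_le (n := n) (m := m) (c := cg) (g := e) (w := w) hcg0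
  have s2' : ∑ l ∈ Finset.range (m + 1), ∑ p ∈ Finset.HasAntidiagonal.antidiagonal l,
      (if p.2 < n then cg p.2 * e p.1 * w l else 0)
      = ∑ l ∈ Finset.range (m + 1), ∑ p ∈ Finset.HasAntidiagonal.antidiagonal l,
      (if p.1 < n then cg p.1 * e p.2 * w l else 0) :=
    Finset.sum_congr rfl fun l _ => Finset.Nat.sum_antidiagonal_swap
      (f := fun p : ℕ × ℕ => if p.1 < n then cg p.1 * e p.2 * w l else 0)
  have r1 := sum_range_sqrt_le (show n ≤ m by omega) e
  have r2 := sum_range_sqrt_le (show n ≤ m by omega) g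
  -- Here `2n ≤ m + 2`, and `m + 2 ≤ (25/16)(m + 1)` as soon as `m ≥ 1`.
  have hsq : Real.sqrt (2 * (n : ℝ)) ≤ 5 / 4 * Real.sqrt (m + 1) := by
    rw [show (5 / 4 : ℝ) = Real.sqrt ((5 / 4) ^ 2) by rw [Real.sqrt_sq (by norm_num)],
      ← Real.sqrt_mul (by norm_num)]
    refine Real.sqrt_le_sqrt ?_
    have h1 : (2 * n : ℕ) ≤ m + 2 := by omega
    have h2 : (2 * (n : ℝ)) ≤ m + 2 := by exact_mod_cast h1
    have h3 : (1 : ℝ) ≤ m := by exact_mod_cast hm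
    nlinarith
  have hA : 2 * Real.sqrt (m + 1) * B ≤ constA m := by
    unfold constA
    have := Real.sqrt_nonneg ((m : ℝ) + 1)
    linarith
  calc ∑ l ∈ Finset.range (m + 1), ∑ b ∈ Finset.HasAntidiagonal.antidiagonal l,
      (l.choose b.1 : ℝ) * T l b
      ≤ ∑ l ∈ Finset.range (m + 1), ∑ b ∈ Finset.HasAntidiagonal.antidiagonal l,
        B * (8 / 5 * C₁) * ((if b.1 < n then ce b.1 * g b.2 * w l else 0)
          + if b.2 < n then cg b.2 * e b.1 * w l else 0) :=
        Finset.sum_le_sum fun l hl => Finset.sum_le_sum fun b hb => key l hl b hb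
    _ = B * (8 / 5 * C₁) * ((∑ l ∈ Finset.range (m + 1),
          ∑ p ∈ Finset.HasAntidiagonal.antidiagonal l, (if p.1 < n then ce p.1 * g p.2 * w l else 0))
        + ∑ l ∈ Finset.range (m + 1), ∑ p ∈ Finset.HasAntidiagonal.antidiagonal l,
          (if p.1 < n then cg p.1 * e p.2 * w l else 0)) := by
        rw [← s2', ← Finset.sum_add_distrib, Finset.mul_sum]
        refine Finset.sum_congr rfl fun l _ => ?_
        rw [← Finset.sum_add_distrib, Finset.mul_sum]
    _ ≤ B * (8 / 5 * C₁) * (Real.sqrt (2 * n) * SE * (SG * SW)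
          + Real.sqrt (2 * n) * SG * (SE * SW)) := by
        gcongr
        · exact s1.trans (by gcongr)
        · exact s2.trans (by gcongr)
    _ = (16 / 5 * B * Real.sqrt (2 * n)) * C₁ * (SE * SG * SW) := by ring
    _ ≤ (16 / 5 * B * (5 / 4 * Real.sqrt (m + 1))) * C₁ * (SE * SG * SW) := by gcongr
    -- The numerical constants combine as `2 · (8/5) · (5/4) = 4`. The binomial part of `A`
    -- therefore suffices, and `C₁ ≤ C₁²` because `C₁ ≥ 1`.
    _ = 2 * (2 * Real.sqrt (m + 1) * B) * C₁ * (SE * SG * SW) := by ring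
    _ ≤ 2 * constA m * C₁ ^ 2 * (SE * SG * SW) := by
        have hA0 : 0 ≤ constA m := le_trans (by positivity) hA
        gcongr
        nlinarith

section Trilinear

variable {Iz : Set ℝ} {dens : ℝ → ℝ} {C₁ : ℝ} {m : ℕ} {E : ℕ → ℕ → ℝ → ℝ → ℝ}
  {G W : ℕ → ℕ → ℝ → ℝ → ℝ → ℝ}

/-- Products of `∂_x^j ∂_z^k E` and `∂_x^j' ∂_z^k' G` are square integrable. -/
theorem memLp_product (hm : 1 ≤ m) (hπ : IsDensity Iz dens) (hC : IsSobolevConst Iz dens C₁)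
    (hE : Chain Iz m E)
    (hE2 : ∀ j ≤ 1, ∀ k ≤ m, MemLp (fun p : ℝ × ℝ => E j k p.1 p.2) 2 (xzMeasure Iz dens))
    (hG : ∀ v, Chain Iz m fun j k x z => G j k x v z)
    (hG2 : ∀ j ≤ 1, ∀ k ≤ m,
      MemLp (fun q : (ℝ × ℝ) × ℝ => G j k q.1.1 q.2 q.1.2) 2 (xzvMeasure Iz dens))
    {j j' k k' : ℕ} (hj : j + j' ≤ 1) (hk : k + k' ≤ m) :
    MemLp (fun q : (ℝ × ℝ) × ℝ => E j k q.1.1 q.1.2 * G j' k' q.1.1 q.2 q.1.2) 2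
      (xzvMeasure Iz dens) := by
  rcases le_total k k' with h | h
  · exact (product_low hπ hC hE hE2 hG hG2 hj (by omega) (by omega)).1
  · exact (product_high hπ hC hE hE2 hG hG2 hj (by omega) (by omega)).1

/-- The Leibniz sum in `x` is only a sum of three terms and is collapsed first, leaving a purely
discrete problem in the `z`-orders for the sequences of `H¹_x` norms. The product estimate used for
a given pair of orders depends on which of them is smaller. -/
theorem abs_trilinear_le (hm : 1 ≤ m) (hπ : IsDensity Iz dens) (hC : IsSobolevConst Iz dens C₁)
    (hE : Chain Iz m E)
    (hE2 : ∀ j ≤ 1, ∀ k ≤ m, MemLp (fun p : ℝ × ℝ => E j k p.1 p.2) 2 (xzMeasure Iz dens))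
    (hG : ∀ v, Chain Iz m fun j k x z => G j k x v z)
    (hG2 : ∀ j ≤ 1, ∀ k ≤ m,
      MemLp (fun q : (ℝ × ℝ) × ℝ => G j k q.1.1 q.2 q.1.2) 2 (xzvMeasure Iz dens))
    (hW2 : ∀ j ≤ 1, ∀ k ≤ m,
      MemLp (fun q : (ℝ × ℝ) × ℝ => W j k q.1.1 q.2 q.1.2) 2 (xzvMeasure Iz dens)) :
    |∑ i ∈ Finset.range 2, ∑ l ∈ Finset.range (m + 1),
      ∑ a ∈ Finset.HasAntidiagonal.antidiagonal i, ∑ b ∈ Finset.HasAntidiagonal.antidiagonal l,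
        ((i.choose a.1 : ℝ) * (l.choose b.1 : ℝ)) *
          ∫ q, (E a.1 b.1 q.1.1 q.1.2 * G a.2 b.2 q.1.1 q.2 q.1.2) * W i l q.1.1 q.2 q.1.2
            ∂(xzvMeasure Iz dens)|
    ≤ 2 * constA m * C₁ ^ 2 *
      (Real.sqrt (∑ i ∈ Finset.range 2, ∑ l ∈ Finset.range (m + 1),
          ∫ p, E i l p.1 p.2 ^ 2 ∂(xzMeasure Iz dens))
        * Real.sqrt (∑ i ∈ Finset.range 2, ∑ l ∈ Finset.range (m + 1),
          ∫ q, G i l q.1.1 q.2 q.1.2 ^ 2 ∂(xzvMeasure Iz dens))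
        * Real.sqrt (∑ i ∈ Finset.range 2, ∑ l ∈ Finset.range (m + 1),
          ∫ q, W i l q.1.1 q.2 q.1.2 ^ 2 ∂(xzvMeasure Iz dens))) := by
  have hC1 := hC.1
  set nE : ℕ → ℕ → ℝ := fun j k => ∫ p, E j k p.1 p.2 ^ 2 ∂(xzMeasure Iz dens) with hnE
  set nG : ℕ → ℕ → ℝ := fun j k => ∫ q, G j k q.1.1 q.2 q.1.2 ^ 2 ∂(xzvMeasure Iz dens) with hnG
  set nW : ℕ → ℕ → ℝ := fun j k => ∫ q, W j k q.1.1 q.2 q.1.2 ^ 2 ∂(xzvMeasure Iz dens) with hnW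
  have hnE0 : ∀ j k, 0 ≤ nE j k := fun j k => integral_nonneg fun _ => sq_nonneg _
  have hnG0 : ∀ j k, 0 ≤ nG j k := fun j k => integral_nonneg fun _ => sq_nonneg _
  have hnW0 : ∀ j k, 0 ≤ nW j k := fun j k => integral_nonneg fun _ => sq_nonneg _
  set I : ℕ → ℕ → ℕ × ℕ → ℕ × ℕ → ℝ := fun i l a b =>
    ∫ q, (E a.1 b.1 q.1.1 q.1.2 * G a.2 b.2 q.1.1 q.2 q.1.2) * W i l q.1.1 q.2 q.1.2
            ∂(xzvMeasure Iz dens) with hI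
  set e : ℕ → ℝ := fun k => Real.sqrt (nE 0 k + nE 1 k) with he
  set g : ℕ → ℝ := fun k => Real.sqrt (nG 0 k + nG 1 k) with hg
  set w : ℕ → ℝ := fun k => Real.sqrt (nW 0 k + nW 1 k) with hw
  have he2 : ∀ k, e k ^ 2 = nE 0 k + nE 1 k := fun k =>
    Real.sq_sqrt (add_nonneg (hnE0 _ _) (hnE0 _ _))
  have hg2 : ∀ k, g k ^ 2 = nG 0 k + nG 1 k := fun k =>
    Real.sq_sqrt (add_nonneg (hnG0 _ _) (hnG0 _ _))
  have hw2 : ∀ k, w k ^ 2 = nW 0 k + nW 1 k := fun k =>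
    Real.sq_sqrt (add_nonneg (hnW0 _ _) (hnW0 _ _))
  -- One term has `i = 0` and two have `i = 1`, each at most `C₁ c / √2` times the norm of `W`.
  -- Since `w₀ + 2w₁ ≤ √5 · √(w₀² + w₁²)`, the total constant is `√(5/2) < 8/5`.
  have bound : ∀ {c : ℝ} {k k' : ℕ}, 0 ≤ c → k + k' ≤ m →
      (∀ j j', j + j' ≤ 1 → 2 * ∫ q, (E j k q.1.1 q.1.2 * G j' k' q.1.1 q.2 q.1.2) ^ 2
        ∂(xzvMeasure Iz dens) ≤ (C₁ * c) ^ 2) →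
      |I 0 (k + k') (0, 0) (k, k')| + (|I 1 (k + k') (0, 1) (k, k')|
        + |I 1 (k + k') (1, 0) (k, k')|) ≤ 8 / 5 * C₁ * (c * w (k + k')) := by
    intro c k k' hc hkk h
    have h1 : ∀ i j j', j + j' = i → i ≤ 1 → |I i (k + k') (j, j') (k, k')|
        ≤ Real.sqrt ((C₁ * c) ^ 2 / 2) * Real.sqrt (nW i (k + k')) := by
      intro i j j' hij hi
      refine (abs_integral_mul_le (memLp_product hm hπ hC hE hE2 hG hG2 (hij.trans_le hi) hkk)
        (hW2 i hi (k + k') hkk)).trans ?_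
      refine mul_le_mul_of_nonneg_right (Real.sqrt_le_sqrt ?_) (Real.sqrt_nonneg _)
      have := h j j' (hij.trans_le hi)
      linarith
    have a0 := h1 0 0 0 rfl (by norm_num)
    have a1 := h1 1 0 1 rfl (by norm_num)
    have a2 := h1 1 1 0 rfl (by norm_num)
    set s := Real.sqrt ((C₁ * c) ^ 2 / 2) with hs
    set w0 := Real.sqrt (nW 0 (k + k')) with hw0
    set w1 := Real.sqrt (nW 1 (k + k')) with hw1
    have hs2 : s ^ 2 = (C₁ * c) ^ 2 / 2 := Real.sq_sqrt (by positivity)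
    have hw02 : w0 ^ 2 = nW 0 (k + k') := Real.sq_sqrt (hnW0 _ _)
    have hw12 : w1 ^ 2 = nW 1 (k + k') := Real.sq_sqrt (hnW0 _ _)
    have hwn : 0 ≤ w (k + k') := Real.sqrt_nonneg _
    refine (add_le_add a0 (add_le_add a1 a2)).trans ?_
    refine abs_le_of_sq_le_sq' ?_ (by positivity) |>.2
    have e1 : (s * w0 + (s * w1 + s * w1)) ^ 2 = (C₁ * c) ^ 2 / 2 * (w0 + 2 * w1) ^ 2 := by
      rw [← hs2]; ring
    have e2 : (8 / 5 * C₁ * (c * w (k + k'))) ^ 2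
        = (C₁ * c) ^ 2 / 2 * (128 / 25 * (w0 ^ 2 + w1 ^ 2)) := by
      rw [hw02, hw12, ← hw2]; ring
    rw [e1, e2]
    refine mul_le_mul_of_nonneg_left ?_ (by positivity)
    nlinarith [sq_nonneg (2 * w0 - w1), sq_nonneg w0, sq_nonneg w1]
  have hsplit : ∑ i ∈ Finset.range 2, ∑ l ∈ Finset.range (m + 1),
      ∑ a ∈ Finset.HasAntidiagonal.antidiagonal i, ∑ b ∈ Finset.HasAntidiagonal.antidiagonal l,
        ((i.choose a.1 : ℝ) * (l.choose b.1 : ℝ)) * I i l a b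
      = ∑ l ∈ Finset.range (m + 1), ∑ b ∈ Finset.HasAntidiagonal.antidiagonal l,
        (l.choose b.1 : ℝ) * (I 0 l (0, 0) b + (I 1 l (0, 1) b + I 1 l (1, 0) b)) := by
    rw [sum_range_two_comm]
    refine Finset.sum_congr rfl fun l _ => ?_
    have a0 : Finset.HasAntidiagonal.antidiagonal 0 = {((0 : ℕ), (0 : ℕ))} := rfl
    have a1 : Finset.HasAntidiagonal.antidiagonal 1 = {((0 : ℕ), (1 : ℕ)), (1, 0)} := rfl
    rw [a0, a1, Finset.sum_singleton, Finset.sum_pair (by decide), ← Finset.sum_add_distrib,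
      ← Finset.sum_add_distrib]
    refine Finset.sum_congr rfl fun b _ => ?_
    simp
    ring
  rw [hsplit]
  have habs : |∑ l ∈ Finset.range (m + 1), ∑ b ∈ Finset.HasAntidiagonal.antidiagonal l,
        (l.choose b.1 : ℝ) * (I 0 l (0, 0) b + (I 1 l (0, 1) b + I 1 l (1, 0) b))|
      ≤ ∑ l ∈ Finset.range (m + 1), ∑ b ∈ Finset.HasAntidiagonal.antidiagonal l,
        (l.choose b.1 : ℝ) * (|I 0 l (0, 0) b| + (|I 1 l (0, 1) b| + |I 1 l (1, 0) b|)) := by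
    refine (Finset.abs_sum_le_sum_abs _ _).trans (Finset.sum_le_sum fun l _ => ?_)
    refine (Finset.abs_sum_le_sum_abs _ _).trans (Finset.sum_le_sum fun b _ => ?_)
    rw [abs_mul, Nat.abs_cast]
    refine mul_le_mul_of_nonneg_left ?_ (Nat.cast_nonneg _)
    exact (abs_add_le _ _).trans (add_le_add le_rfl (abs_add_le _ _))
  refine habs.trans ?_
  have := sum_trilinear_le hm hC1
    (T := fun l b => |I 0 l (0, 0) b| + (|I 1 l (0, 1) b| + |I 1 l (1, 0) b|))
    (e := e) (g := g) (w := w) (fun _ => Real.sqrt_nonneg _) (fun _ => Real.sqrt_nonneg _)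
    (fun _ => Real.sqrt_nonneg _) (fun k k' hk hkk => ?_) (fun k k' hk hkk => ?_)
  · simp only [he2, hg2, hw2] at this
    rw [sum_range_two_comm, sum_range_two_comm, sum_range_two_comm]
    exact this
  · refine bound (mul_nonneg (Real.sqrt_nonneg _) (Real.sqrt_nonneg _)) hk fun j j' hj => ?_
    refine (product_low hπ hC hE hE2 hG hG2 hj (by omega) (by omega)).2.trans_eq ?_
    rw [mul_pow, mul_pow, Real.sq_sqrt (by positivity), he2, he2, hg2, mul_assoc]
  · refine bound (mul_nonneg (Real.sqrt_nonneg _) (Real.sqrt_nonneg _)) hk fun j j' hj => ?_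
    refine (product_high hπ hC hE hE2 hG hG2 hj (by omega) (by omega)).2.trans_eq ?_
    rw [mul_pow, mul_pow, Real.sq_sqrt (by positivity), hg2, hg2, he2, mul_assoc]

end Trilinear

/-! ### Differentiable curves in `L²` -/

section Curve

variable {α : Type*} [MeasurableSpace α] {μ : Measure α}

/-- `s ↦ f s` is a curve in `L²(μ)` near `t`, differentiable at `t` with derivative `f'`. -/
structure HasL2DerivAt (μ : Measure α) (f : ℝ → α → ℝ) (f' : α → ℝ) (t : ℝ) : Prop where
  memLp : ∀ᶠ s in 𝓝 t, MemLp (f s) 2 μ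
  memLp_deriv : MemLp f' 2 μ
  tendsto : Tendsto (fun s => eLpNorm (fun x => (f s x - f t x) / (s - t) - f' x) 2 μ)
    (𝓝[≠] t) (𝓝 0)

open Classical in
/-- The curve as a map into `Lp`. -/
def lpCurve (μ : Measure α) (f : ℝ → α → ℝ) (s : ℝ) : Lp ℝ 2 μ :=
  if h : MemLp (f s) 2 μ then h.toLp (f s) else 0

theorem lpCurve_eq {f : ℝ → α → ℝ} {s : ℝ} (h : MemLp (f s) 2 μ) :
    lpCurve μ f s = h.toLp (f s) := dif_pos h

/-- The difference quotient of representatives represents the slope in `Lp`, so convergence of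
seminorms is the Fréchet notion. Product rules for integrals then follow from differentiability of
the Hilbert inner product. -/
theorem HasL2DerivAt.hasDerivAt {f : ℝ → α → ℝ} {f' : α → ℝ} {t : ℝ}
    (h : HasL2DerivAt μ f f' t) :
    HasDerivAt (lpCurve μ f) (h.memLp_deriv.toLp f') t := by
  rw [hasDerivAt_iff_tendsto_slope, tendsto_iff_norm_sub_tendsto_zero]
  have h0 : Tendsto (fun s => (eLpNorm (fun x => (f s x - f t x) / (s - t) - f' x) 2 μ).toReal)
      (𝓝[≠] t) (𝓝 0) := by
    have := (ENNReal.tendsto_toReal ENNReal.zero_ne_top).comp h.tendsto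
    simpa [Function.comp_def] using this
  refine h0.congr' ?_
  filter_upwards [h.memLp.filter_mono nhdsWithin_le_nhds] with s hs
  have ht := h.memLp.self_of_nhds
  have hm : MemLp (fun x => (f s x - f t x) / (s - t) - f' x) 2 μ := by
    have := ((hs.sub ht).const_mul (s - t)⁻¹).sub h.memLp_deriv
    refine this.ae_eq (Eventually.of_forall fun x => ?_)
    simp only [Pi.sub_apply]
    ring
  rw [← Lp.norm_toLp _ hm]
  congr 1
  rw [slope_def_module, lpCurve_eq hs, lpCurve_eq ht, ← MemLp.toLp_sub, ← MemLp.toLp_const_smul,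
    ← MemLp.toLp_sub]
  refine MemLp.toLp_congr _ _ (Eventually.of_forall fun x => ?_)
  simp only [Pi.sub_apply, Pi.smul_apply, smul_eq_mul]
  ring

theorem inner_toLp {f g : α → ℝ} (hf : MemLp f 2 μ) (hg : MemLp g 2 μ) :
    inner ℝ (hf.toLp f) (hg.toLp g) = ∫ x, f x * g x ∂μ := by
  rw [L2.inner_def]
  refine integral_congr_ae ?_
  filter_upwards [hf.coeFn_toLp, hg.coeFn_toLp] with x h1 h2
  rw [h1, h2]
  simp [mul_comm]

theorem HasL2DerivAt.hasDerivAt_integral_mul {f g : ℝ → α → ℝ} {f' g' : α → ℝ} {t : ℝ}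
    (hf : HasL2DerivAt μ f f' t) (hg : HasL2DerivAt μ g g' t) :
    HasDerivAt (fun s => ∫ x, f s x * g s x ∂μ)
      ((∫ x, f t x * g' x ∂μ) + ∫ x, f' x * g t x ∂μ) t := by
  have h := hf.hasDerivAt.inner ℝ hg.hasDerivAt
  rw [lpCurve_eq hf.memLp.self_of_nhds, lpCurve_eq hg.memLp.self_of_nhds, inner_toLp,
    inner_toLp] at h
  refine h.congr_of_eventuallyEq ?_
  filter_upwards [hf.memLp, hg.memLp] with s h1 h2
  rw [lpCurve_eq h1, lpCurve_eq h2, inner_toLp]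

theorem HasL2DerivAt.hasDerivAt_integral_sq {f : ℝ → α → ℝ} {f' : α → ℝ} {t : ℝ}
    (hf : HasL2DerivAt μ f f' t) :
    HasDerivAt (fun s => ∫ x, f s x ^ 2 ∂μ) (2 * ∫ x, f' x * f t x ∂μ) t := by
  have h := hf.hasDerivAt_integral_mul hf
  simp only [← sq] at h
  refine h.congr_deriv ?_
  have : ∫ x, f t x * f' x ∂μ = ∫ x, f' x * f t x ∂μ := by simp only [mul_comm]
  rw [this]; ring

theorem HasL2DerivAt.aestronglyMeasurable {f : ℝ → α → ℝ} {f' : α → ℝ} {t : ℝ}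
    (h : HasL2DerivAt μ f f' t) : ∀ᶠ s in 𝓝[≠] t,
      AEStronglyMeasurable (fun x => (f s x - f t x) / (s - t) - f' x) μ := by
  filter_upwards [h.memLp.filter_mono nhdsWithin_le_nhds] with s hs
  have := ((hs.sub h.memLp.self_of_nhds).const_mul (s - t)⁻¹).sub h.memLp_deriv
  refine this.aestronglyMeasurable.congr (Eventually.of_forall fun x => ?_)
  simp only [Pi.sub_apply]
  ring

theorem HasL2DerivAt.comp_measurePreserving {β : Type*} [MeasurableSpace β] {ρ : Measure β}
    {e : β → α} (he : MeasurePreserving e ρ μ) {f : ℝ → α → ℝ} {f' : α → ℝ} {t : ℝ}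
    (h : HasL2DerivAt μ f f' t) : HasL2DerivAt ρ (fun s x => f s (e x)) (fun x => f' (e x)) t := by
  refine ⟨h.memLp.mono fun s hs => hs.comp_measurePreserving he,
    h.memLp_deriv.comp_measurePreserving he, h.tendsto.congr' ?_⟩
  filter_upwards [h.aestronglyMeasurable] with s hs
  exact (eLpNorm_comp_measurePreserving hs he).symm

theorem HasL2DerivAt.congr {f g : ℝ → α → ℝ} {f' g' : α → ℝ} {t : ℝ}
    (h : HasL2DerivAt μ f f' t) (hfg : ∀ᶠ s in 𝓝 t, g s =ᵐ[μ] f s) (hfg' : g' =ᵐ[μ] f') :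
    HasL2DerivAt μ g g' t := by
  refine ⟨?_, h.memLp_deriv.ae_eq hfg'.symm, h.tendsto.congr' ?_⟩
  · filter_upwards [h.memLp, hfg] with s h1 h2 using h1.ae_eq h2.symm
  · filter_upwards [hfg.filter_mono nhdsWithin_le_nhds] with s hs
    refine eLpNorm_congr_ae ?_
    filter_upwards [hs, hfg.self_of_nhds, hfg'] with x h1 h2 h3
    rw [h1, h2, h3]

end Curve

/-! ### Velocity moments in `L²` -/

section Moment

variable {Iz : Set ℝ} {dens : ℝ → ℝ}

theorem enorm_sq_integral_mul_le {f ψ : ℝ → ℝ} (hf : AEStronglyMeasurable f volume)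
    (hψ : MemLp ψ 2 volume) (h1 : ∫ v, ψ v ^ 2 = 1) :
    ‖∫ v, f v * ψ v‖ₑ ^ 2 ≤ ∫⁻ v, ‖f v‖ₑ ^ 2 := by
  by_cases htop : ∫⁻ v, ‖f v‖ₑ ^ 2 = ∞
  · rw [htop]; exact le_top
  have hf2 : MemLp f 2 volume := memLp_two_of_lintegral_lt_top hf (lt_top_iff_ne_top.2 htop)
  rw [← ofReal_integral_sq hf2, ← enorm_pow, Real.enorm_of_nonneg (sq_nonneg _)]
  refine ENNReal.ofReal_le_ofReal ?_
  have := sq_integral_mul_le hf2 hψ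
  rwa [h1, mul_one] at this

/-- Cauchy–Schwarz in `v` on almost every fibre: a moment against a unit vector of `L²_v` is a
contraction from kinetic to macroscopic `L²`. -/
theorem lintegral_moment_le [SFinite (zMeasure Iz dens)] {K : ℝ → ℝ → ℝ → ℝ} {ψ : ℝ → ℝ}
    (hK : AEStronglyMeasurable (fun q : (ℝ × ℝ) × ℝ => K q.1.1 q.2 q.1.2) (xzvMeasure Iz dens))
    (hψ : MemLp ψ 2 volume) (h1 : ∫ v, ψ v ^ 2 = 1) :
    ∫⁻ p : ℝ × ℝ, ‖∫ v, K p.1 v p.2 * ψ v‖ₑ ^ 2 ∂(xzMeasure Iz dens)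
      ≤ ∫⁻ q : (ℝ × ℝ) × ℝ, ‖K q.1.1 q.2 q.1.2‖ₑ ^ 2 ∂(xzvMeasure Iz dens) := by
  unfold xzvMeasure at hK ⊢
  rw [lintegral_prod _ (hK.enorm.pow_const 2)]
  refine lintegral_mono_ae ?_
  filter_upwards [hK.prodMk_left] with p hp
  exact enorm_sq_integral_mul_le hp hψ h1

theorem eLpNorm_moment_le [SFinite (zMeasure Iz dens)] {K : ℝ → ℝ → ℝ → ℝ} {ψ : ℝ → ℝ}
    (hK : AEStronglyMeasurable (fun q : (ℝ × ℝ) × ℝ => K q.1.1 q.2 q.1.2) (xzvMeasure Iz dens))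
    (hψ : MemLp ψ 2 volume) (h1 : ∫ v, ψ v ^ 2 = 1) :
    eLpNorm (fun p : ℝ × ℝ => ∫ v, K p.1 v p.2 * ψ v) 2 (xzMeasure Iz dens)
      ≤ eLpNorm (fun q : (ℝ × ℝ) × ℝ => K q.1.1 q.2 q.1.2) 2 (xzvMeasure Iz dens) := by
  have := lintegral_moment_le hK hψ h1
  rw [← eLpNorm_two_sq, ← eLpNorm_two_sq] at this
  exact (ENNReal.pow_le_pow_left_iff two_ne_zero).1 this

theorem memLp_moment [SFinite (zMeasure Iz dens)] {K : ℝ → ℝ → ℝ → ℝ} {ψ : ℝ → ℝ}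
    (hK : MemLp (fun q : (ℝ × ℝ) × ℝ => K q.1.1 q.2 q.1.2) 2 (xzvMeasure Iz dens))
    (hψ : MemLp ψ 2 volume) (h1 : ∫ v, ψ v ^ 2 = 1) :
    MemLp (fun p : ℝ × ℝ => ∫ v, K p.1 v p.2 * ψ v) 2 (xzMeasure Iz dens) := by
  refine memLp_two_of_lintegral_lt_top ?_ ((lintegral_moment_le hK.aestronglyMeasurable hψ h1).trans_lt
    (lintegral_enorm_sq_lt_top hK))
  have : AEStronglyMeasurable (fun q : (ℝ × ℝ) × ℝ => K q.1.1 q.2 q.1.2 * ψ q.2)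
      ((xzMeasure Iz dens).prod volume) :=
    AEStronglyMeasurable.mul hK.aestronglyMeasurable hψ.aestronglyMeasurable.comp_snd
  exact this.integral_prod_right'

theorem integral_sq_moment_le [SFinite (zMeasure Iz dens)] {K : ℝ → ℝ → ℝ → ℝ} {ψ : ℝ → ℝ}
    (hK : MemLp (fun q : (ℝ × ℝ) × ℝ => K q.1.1 q.2 q.1.2) 2 (xzvMeasure Iz dens))
    (hψ : MemLp ψ 2 volume) (h1 : ∫ v, ψ v ^ 2 = 1) :
    ∫ p : ℝ × ℝ, (∫ v, K p.1 v p.2 * ψ v) ^ 2 ∂(xzMeasure Iz dens)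
      ≤ ∫ q : (ℝ × ℝ) × ℝ, K q.1.1 q.2 q.1.2 ^ 2 ∂(xzvMeasure Iz dens) := by
  refine (ENNReal.ofReal_le_ofReal_iff (integral_nonneg fun _ => sq_nonneg _)).1 ?_
  rw [ofReal_integral_sq (memLp_moment hK hψ h1), ofReal_integral_sq hK]
  exact lintegral_moment_le hK.aestronglyMeasurable hψ h1

theorem memLp_tensor [SFinite (zMeasure Iz dens)] {Φ : ℝ → ℝ → ℝ} {ψ : ℝ → ℝ}
    (hΦ : MemLp (fun p : ℝ × ℝ => Φ p.1 p.2) 2 (xzMeasure Iz dens)) (hψ : MemLp ψ 2 volume) :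
    MemLp (fun q : (ℝ × ℝ) × ℝ => Φ q.1.1 q.1.2 * ψ q.2) 2 (xzvMeasure Iz dens) := by
  refine memLp_two_of_lintegral_lt_top (AEStronglyMeasurable.mul
    hΦ.aestronglyMeasurable.comp_fst hψ.aestronglyMeasurable.comp_snd) ?_
  simp only [enorm_mul, mul_pow]
  unfold xzvMeasure
  rw [lintegral_prod_mul (f := fun p : ℝ × ℝ => ‖Φ p.1 p.2‖ₑ ^ 2) (g := fun v => ‖ψ v‖ₑ ^ 2)
    (hΦ.aestronglyMeasurable.enorm.pow_const 2) (hψ.aestronglyMeasurable.enorm.pow_const 2)]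
  exact ENNReal.mul_lt_top (lintegral_enorm_sq_lt_top hΦ) (lintegral_enorm_sq_lt_top hψ)

/-- Fubini for a product of a macroscopic function, a weight and a kinetic function. -/
theorem integral_tensor_mul [SFinite (zMeasure Iz dens)] {Φ : ℝ → ℝ → ℝ} {ψ : ℝ → ℝ}
    {K : ℝ → ℝ → ℝ → ℝ}
    (hi : Integrable (fun q : (ℝ × ℝ) × ℝ => (Φ q.1.1 q.1.2 * ψ q.2) * K q.1.1 q.2 q.1.2)
      (xzvMeasure Iz dens)) :
    ∫ q : (ℝ × ℝ) × ℝ, (Φ q.1.1 q.1.2 * ψ q.2) * K q.1.1 q.2 q.1.2 ∂(xzvMeasure Iz dens)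
      = ∫ p : ℝ × ℝ, Φ p.1 p.2 * (∫ v, K p.1 v p.2 * ψ v) ∂(xzMeasure Iz dens) := by
  unfold xzvMeasure at hi ⊢
  rw [integral_prod _ hi]
  refine integral_congr_ae (Eventually.of_forall fun p => ?_)
  simp only
  rw [← integral_const_mul]
  congr 1; ext v; ring

theorem integral_tensor_mul_tensor [SFinite (zMeasure Iz dens)] {Φ Φ' : ℝ → ℝ → ℝ} {ψ : ℝ → ℝ}
    (h1 : ∫ v, ψ v ^ 2 = 1) :
    ∫ q : (ℝ × ℝ) × ℝ, (Φ q.1.1 q.1.2 * ψ q.2) * (Φ' q.1.1 q.1.2 * ψ q.2) ∂(xzvMeasure Iz dens)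
      = ∫ p : ℝ × ℝ, Φ p.1 p.2 * Φ' p.1 p.2 ∂(xzMeasure Iz dens) := by
  have := integral_prod_mul (μ := xzMeasure Iz dens) (ν := (volume : Measure ℝ))
    (fun p => Φ p.1 p.2 * Φ' p.1 p.2) (fun v => ψ v ^ 2)
  rw [h1, mul_one] at this
  rw [← this]
  unfold xzvMeasure
  congr 1; ext q; ring

theorem measurePreserving_reorder [SFinite (zMeasure Iz dens)] :
    MeasurePreserving (fun q : (ℝ × ℝ) × ℝ => (q.1.1, q.2, q.1.2)) (xzvMeasure Iz dens)
      (xvzMeasure Iz dens) := by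
  unfold xzvMeasure xvzMeasure xzMeasure
  have h1 := measurePreserving_prodAssoc (volume : Measure ℝ) (zMeasure Iz dens) (volume : Measure ℝ)
  have h2 : MeasurePreserving (Prod.swap : ℝ × ℝ → ℝ × ℝ) ((zMeasure Iz dens).prod volume)
      ((volume : Measure ℝ).prod (zMeasure Iz dens)) := Measure.measurePreserving_swap
  exact ((MeasurePreserving.id (volume : Measure ℝ)).prod h2).comp h1

theorem measurableEmbedding_reorder :
    MeasurableEmbedding (fun q : (ℝ × ℝ) × ℝ => (q.1.1, q.2, q.1.2)) :=
  ((MeasurableEquiv.prodAssoc (α := ℝ) (β := ℝ) (γ := ℝ)).trans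
    ((MeasurableEquiv.refl ℝ).prodCongr MeasurableEquiv.prodComm)).measurableEmbedding

theorem integral_reorder [SFinite (zMeasure Iz dens)] (F : ℝ → ℝ → ℝ → ℝ) :
    ∫ p : ℝ × ℝ × ℝ, F p.1 p.2.1 p.2.2 ∂(xvzMeasure Iz dens)
      = ∫ q : (ℝ × ℝ) × ℝ, F q.1.1 q.2 q.1.2 ∂(xzvMeasure Iz dens) :=
  (measurePreserving_reorder.integral_comp measurableEmbedding_reorder
    fun p : ℝ × ℝ × ℝ => F p.1 p.2.1 p.2.2).symm

theorem memLp_reorder [SFinite (zMeasure Iz dens)] {F : ℝ → ℝ → ℝ → ℝ}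
    (h : MemLp (fun p : ℝ × ℝ × ℝ => F p.1 p.2.1 p.2.2) 2 (xvzMeasure Iz dens)) :
    MemLp (fun q : (ℝ × ℝ) × ℝ => F q.1.1 q.2 q.1.2) 2 (xzvMeasure Iz dens) :=
  h.comp_measurePreserving measurePreserving_reorder

theorem integrable_reorder_iff [SFinite (zMeasure Iz dens)] {F : ℝ → ℝ → ℝ → ℝ} :
    Integrable (fun q : (ℝ × ℝ) × ℝ => F q.1.1 q.2 q.1.2) (xzvMeasure Iz dens) ↔
      Integrable (fun p : ℝ × ℝ × ℝ => F p.1 p.2.1 p.2.2) (xvzMeasure Iz dens) :=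
  measurePreserving_reorder.integrable_comp_emb measurableEmbedding_reorder
    (g := fun p : ℝ × ℝ × ℝ => F p.1 p.2.1 p.2.2)

theorem IsDensity.xzv_ae_mem (h : IsDensity Iz dens) :
    ∀ᵐ q ∂(xzvMeasure Iz dens), q.1.2 ∈ Iz := by
  have := h.prob
  exact Measure.quasiMeasurePreserving_fst.ae h.xz_ae_mem

/-- The moment contraction is applied to the error of the difference quotient. Fibrewise
integrability is needed because the moment is linear only on integrable functions. -/
theorem HasL2DerivAt.moment [SFinite (zMeasure Iz dens)] {K : ℝ → ℝ → ℝ → ℝ → ℝ}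
    {K' : ℝ → ℝ → ℝ → ℝ} {t : ℝ} {ψ : ℝ → ℝ}
    (h : HasL2DerivAt (xzvMeasure Iz dens) (fun s q => K s q.1.1 q.2 q.1.2)
      (fun q => K' q.1.1 q.2 q.1.2) t) (hψ : MemLp ψ 2 volume) (h1 : ∫ v, ψ v ^ 2 = 1)
    (hi : ∀ᶠ s in 𝓝 t, ∀ᵐ p ∂(xzMeasure Iz dens), Integrable fun v => K s p.1 v p.2 * ψ v)
    (hi' : ∀ᵐ p ∂(xzMeasure Iz dens), Integrable fun v => K' p.1 v p.2 * ψ v) :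
    HasL2DerivAt (xzMeasure Iz dens) (fun s p => ∫ v, K s p.1 v p.2 * ψ v)
      (fun p => ∫ v, K' p.1 v p.2 * ψ v) t := by
  refine ⟨h.memLp.mono fun s hs => memLp_moment hs hψ h1, memLp_moment h.memLp_deriv hψ h1, ?_⟩
  refine tendsto_of_tendsto_of_tendsto_of_le_of_le' tendsto_const_nhds h.tendsto
    (Eventually.of_forall fun _ => zero_le) ?_
  filter_upwards [h.aestronglyMeasurable, hi.filter_mono nhdsWithin_le_nhds] with s hs his
  refine le_trans (le_of_eq ?_) (eLpNorm_moment_le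
    (K := fun x v z => (K s x v z - K t x v z) / (s - t) - K' x v z) hs hψ h1)
  refine eLpNorm_congr_ae ?_
  filter_upwards [his, hi.self_of_nhds, hi'] with p a1 a2 a3
  have a4 : Integrable fun v => (K s p.1 v p.2 * ψ v - K t p.1 v p.2 * ψ v) / (s - t) :=
    (a1.sub a2).div_const _
  rw [← integral_sub a1 a2, ← integral_div, ← integral_sub a4 a3]
  congr 1; ext v; ring

end Moment

/-! ### Differentiation of velocity moments -/

/-- Differentiation under the integral: locally uniform polynomial growth in `v` of the derivative,
multiplied by the rapidly decaying weight, is an integrable majorant on a compact neighbourhood. -/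
theorem hasDerivAt_integral_mul_rapid {ψ : ℝ → ℝ} (hψ : Rapid ψ) {U : Set ℝ} (hU : IsOpen U)
    {f f' : ℝ → ℝ → ℝ} (hd : ∀ s ∈ U, ∀ v, HasDerivAt (fun s => f s v) (f' s v) s)
    (hf : ∀ s ∈ U, PolyGrowth (f s)) (hf' : ∀ s ∈ U, PolyGrowth (f' s))
    (hb : ∀ K ⊆ U, IsCompact K → ∃ (C : ℝ) (N : ℕ), ∀ s ∈ K, ∀ v, |f' s v| ≤ C * (1 + |v|) ^ N)
    {s : ℝ} (hs : s ∈ U) :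
    HasDerivAt (fun s => ∫ v, f s v * ψ v) (∫ v, f' s v * ψ v) s := by
  obtain ⟨K, hK, hsK, hKU⟩ := exists_compact_subset hU hs
  obtain ⟨C, N, hC⟩ := hb K hKU hK
  refine (hasDerivAt_integral_of_dominated_loc_of_deriv_le (F := fun s v => f s v * ψ v)
    (F' := fun s v => f' s v * ψ v) (bound := fun v => C * ((1 + |v|) ^ N * |ψ v|))
    (mem_interior_iff_mem_nhds.1 hsK) ?_ (hψ.integrable_mul (hf s hs)) ?_ ?_
    ((hψ.integrable N).const_mul C) ?_).2
  · filter_upwards [hU.mem_nhds hs] with r hr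
    exact ((hf r hr).cont.mul hψ.cont).aestronglyMeasurable
  · exact ((hf' s hs).cont.mul hψ.cont).aestronglyMeasurable
  · refine Eventually.of_forall fun v r hr => ?_
    rw [Real.norm_eq_abs, abs_mul, ← mul_assoc]
    gcongr
    exact hC r hr v
  · exact Eventually.of_forall fun v r hr => (hd r (hKU hr) v).mul_const _

/-- A family of mixed partial derivatives `∂_z^l ∂_t^k ∂_x^i ∂_v^j`, as in `MixedRegular`. -/
structure MixedFamily (J Iz : Set ℝ) (m : ℕ) (D : ℕ → ℕ → ℕ → ℕ → ℝ → ℝ → ℝ → ℝ → ℝ) :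
    Prop where
  cont : ∀ k i j l, k + i + j ≤ 3 → l ≤ m →
      ContinuousOn (fun p : ℝ × ℝ × ℝ × ℝ => D k i j l p.1 p.2.1 p.2.2.1 p.2.2.2)
        (J ×ˢ (univ ×ˢ (univ ×ˢ Iz)))
  bound : ∀ k i j l, k + i + j ≤ 3 → l ≤ m →
      ∀ K : Set (ℝ × ℝ × ℝ), IsCompact K → K ⊆ J ×ˢ (univ ×ˢ Iz) →
        ∃ (C : ℝ) (N : ℕ), ∀ p ∈ K, ∀ v : ℝ,
          |D k i j l p.1 p.2.1 v p.2.2| ≤ C * (1 + |v|) ^ N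
  deriv : ∀ k i j l, k + i + j < 3 → l ≤ m → ∀ t ∈ J, ∀ x v : ℝ, ∀ z ∈ Iz,
      HasDerivAt (fun s => D k i j l s x v z) (D (k + 1) i j l t x v z) t ∧
      HasDerivAt (fun y => D k i j l t y v z) (D k (i + 1) j l t x v z) x ∧
      HasDerivAt (fun w => D k i j l t x w z) (D k i (j + 1) l t x v z) v
  deriv_z : ∀ k i j l, k + i + j ≤ 3 → l < m → ∀ t ∈ J, ∀ x v : ℝ, ∀ z ∈ Iz,
      HasDerivAt (fun y => D k i j l t x v y) (D k i j (l + 1) t x v z) z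

/-- The velocity moment `∫ ∂_z^l ∂_t^k ∂_x^i F ψ dv`. -/
def moment (D : ℕ → ℕ → ℕ → ℕ → ℝ → ℝ → ℝ → ℝ → ℝ) (ψ : ℝ → ℝ) (k i l : ℕ) (t x z : ℝ) : ℝ :=
  ∫ v, D k i 0 l t x v z * ψ v

section MixedFamily

variable {J Iz : Set ℝ} {m : ℕ} {D : ℕ → ℕ → ℕ → ℕ → ℝ → ℝ → ℝ → ℝ → ℝ} {ψ : ℝ → ℝ}

theorem MixedFamily.polyGrowth (hD : MixedFamily J Iz m D) {k i j l : ℕ} (h : k + i + j ≤ 3)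
    (hl : l ≤ m) {t : ℝ} (ht : t ∈ J) (x : ℝ) {z : ℝ} (hz : z ∈ Iz) :
    PolyGrowth fun v => D k i j l t x v z := by
  constructor
  · rw [← continuousOn_univ]
    exact (hD.cont k i j l h hl).comp (f := fun v : ℝ => (t, x, v, z)) (by fun_prop)
      fun v _ => ⟨ht, mem_univ _, mem_univ _, hz⟩
  · obtain ⟨C, N, hC⟩ := hD.bound k i j l h hl {(t, x, z)} isCompact_singleton (by
      rintro p rfl; exact ⟨ht, mem_univ _, hz⟩)
    exact ⟨C, N, fun v => hC _ rfl v⟩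

theorem MixedFamily.integrable_mul (hD : MixedFamily J Iz m D) (hψ : Rapid ψ) {k i j l : ℕ}
    (h : k + i + j ≤ 3) (hl : l ≤ m) {t : ℝ} (ht : t ∈ J) (x : ℝ) {z : ℝ} (hz : z ∈ Iz) :
    Integrable fun v => D k i j l t x v z * ψ v :=
  hψ.integrable_mul (hD.polyGrowth h hl ht x hz)

theorem MixedFamily.continuous_xv (hD : MixedFamily J Iz m D) {k i j l : ℕ} (h : k + i + j ≤ 3)
    (hl : l ≤ m) {t : ℝ} (ht : t ∈ J) {z : ℝ} (hz : z ∈ Iz) :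
    Continuous fun p : ℝ × ℝ => D k i j l t p.1 p.2 z := by
  rw [← continuousOn_univ]
  exact (hD.cont k i j l h hl).comp (f := fun p : ℝ × ℝ => (t, p.1, p.2, z)) (by fun_prop)
    fun v _ => ⟨ht, mem_univ _, mem_univ _, hz⟩

theorem MixedFamily.continuousOn_xz (hD : MixedFamily J Iz m D) {k i j l : ℕ}
    (h : k + i + j ≤ 3) (hl : l ≤ m) {t : ℝ} (ht : t ∈ J) (v : ℝ) :
    ContinuousOn (fun p : ℝ × ℝ => D k i j l t p.1 v p.2) (univ ×ˢ Iz) :=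
  (hD.cont k i j l h hl).comp (f := fun p : ℝ × ℝ => (t, p.1, v, p.2)) (by fun_prop)
    fun p hp => ⟨ht, mem_univ _, mem_univ _, hp.2⟩

theorem MixedFamily.hasDerivAt_moment_t (hD : MixedFamily J Iz m D) (hJ : IsOpen J)
    (hψ : Rapid ψ) {k i l : ℕ} (h : k + i < 3) (hl : l ≤ m) {t : ℝ} (ht : t ∈ J) (x : ℝ)
    {z : ℝ} (hz : z ∈ Iz) :
    HasDerivAt (fun s => moment D ψ k i l s x z) (moment D ψ (k + 1) i l t x z) t :=
  hasDerivAt_integral_mul_rapid hψ hJ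
    (fun s hs v => (hD.deriv k i 0 l (by omega) hl s hs x v z hz).1)
    (fun s hs => hD.polyGrowth (by omega) hl hs x hz)
    (fun s hs => hD.polyGrowth (by omega) hl hs x hz)
    (fun K hK hKc => by
      obtain ⟨C, N, hC⟩ := hD.bound (k + 1) i 0 l (by omega) hl ((fun s => (s, x, z)) '' K)
        (hKc.image (by fun_prop)) (by rintro _ ⟨s, hs, rfl⟩; exact ⟨hK hs, mem_univ _, hz⟩)
      exact ⟨C, N, fun s hs v => hC _ (mem_image_of_mem _ hs) v⟩) ht

theorem MixedFamily.hasDerivAt_moment_x (hD : MixedFamily J Iz m D)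
    (hψ : Rapid ψ) {k i l : ℕ} (h : k + i < 3) (hl : l ≤ m) {t : ℝ} (ht : t ∈ J) (x : ℝ)
    {z : ℝ} (hz : z ∈ Iz) :
    HasDerivAt (fun y => moment D ψ k i l t y z) (moment D ψ k (i + 1) l t x z) x :=
  hasDerivAt_integral_mul_rapid hψ isOpen_univ
    (fun y _ v => (hD.deriv k i 0 l (by omega) hl t ht y v z hz).2.1)
    (fun y _ => hD.polyGrowth (by omega) hl ht y hz)
    (fun y _ => hD.polyGrowth (by omega) hl ht y hz)
    (fun K _ hKc => by
      obtain ⟨C, N, hC⟩ := hD.bound k (i + 1) 0 l (by omega) hl ((fun y => (t, y, z)) '' K)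
        (hKc.image (by fun_prop)) (by rintro _ ⟨s, hs, rfl⟩; exact ⟨ht, mem_univ _, hz⟩)
      exact ⟨C, N, fun s hs v => hC _ (mem_image_of_mem _ hs) v⟩) (mem_univ x)

theorem MixedFamily.hasDerivAt_moment_z (hD : MixedFamily J Iz m D) (hIz : IsOpen Iz)
    (hψ : Rapid ψ) {k i l : ℕ} (h : k + i ≤ 3) (hl : l < m) {t : ℝ} (ht : t ∈ J) (x : ℝ)
    {z : ℝ} (hz : z ∈ Iz) :
    HasDerivAt (fun y => moment D ψ k i l t x y) (moment D ψ k i (l + 1) t x z) z :=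
  hasDerivAt_integral_mul_rapid hψ hIz
    (fun y hy v => hD.deriv_z k i 0 l (by omega) hl t ht x v y hy)
    (fun y hy => hD.polyGrowth (by omega) hl.le ht x hy)
    (fun y hy => hD.polyGrowth (by omega) hl ht x hy)
    (fun K hK hKc => by
      obtain ⟨C, N, hC⟩ := hD.bound k i 0 (l + 1) (by omega) hl ((fun y => (t, x, y)) '' K)
        (hKc.image (by fun_prop)) (by rintro _ ⟨s, hs, rfl⟩; exact ⟨ht, mem_univ _, hK hs⟩)
      exact ⟨C, N, fun s hs v => hC _ (mem_image_of_mem _ hs) v⟩) hz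

theorem MixedFamily.continuousOn_moment (hD : MixedFamily J Iz m D) (hIz : IsOpen Iz)
    (hψ : Rapid ψ) {k i l : ℕ} (h : k + i ≤ 3) (hl : l ≤ m) {t : ℝ} (ht : t ∈ J) :
    ContinuousOn (fun p : ℝ × ℝ => moment D ψ k i l t p.1 p.2) (univ ×ˢ Iz) := by
  intro p hp
  have ho : IsOpen (univ ×ˢ Iz : Set (ℝ × ℝ)) := isOpen_univ.prod hIz
  obtain ⟨K, hK, hpK, hKU⟩ := exists_compact_subset ho hp
  obtain ⟨C, N, hC⟩ := hD.bound k i 0 l (by omega) hl ((fun p => (t, p)) '' K)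
    (hK.image (by fun_prop)) (by
      rintro _ ⟨s, hs, rfl⟩; exact ⟨ht, hKU hs⟩)
  refine continuousWithinAt_of_dominated (bound := fun v => C * ((1 + |v|) ^ N * |ψ v|)) ?_ ?_
    ((hψ.integrable N).const_mul C) ?_
  · filter_upwards [self_mem_nhdsWithin] with q hq
    exact ((hD.polyGrowth (j := 0) (by omega) hl ht q.1 hq.2).cont.mul hψ.cont).aestronglyMeasurable
  · filter_upwards [nhdsWithin_le_nhds (mem_interior_iff_mem_nhds.1 hpK)] with q hq
    refine Eventually.of_forall fun v => ?_
    rw [Real.norm_eq_abs, abs_mul, ← mul_assoc]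
    gcongr
    exact hC _ (mem_image_of_mem _ hq) v
  · exact Eventually.of_forall fun v =>
      (hD.continuousOn_xz (by omega) hl ht v p hp).mul continuousWithinAt_const

end MixedFamily

/-! ### Integrals with integrability -/

/-- `f` is integrable with integral `a`. -/
def HasInt {α : Type*} [MeasurableSpace α] (f : α → ℝ) (a : ℝ)
    (μ : Measure α := by volume_tac) : Prop := Integrable f μ ∧ ∫ v, f v ∂μ = a

section HasInt

variable {α : Type*} [MeasurableSpace α] {μ : Measure α} {f g : α → ℝ} {a b : ℝ}

theorem HasInt.add (hf : HasInt f a μ) (hg : HasInt g b μ) :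
    HasInt (fun v => f v + g v) (a + b) μ :=
  ⟨hf.1.add hg.1, by rw [integral_add hf.1 hg.1, hf.2, hg.2]⟩

theorem HasInt.sub (hf : HasInt f a μ) (hg : HasInt g b μ) :
    HasInt (fun v => f v - g v) (a - b) μ :=
  ⟨hf.1.sub hg.1, by rw [integral_sub hf.1 hg.1, hf.2, hg.2]⟩

theorem HasInt.const_mul (hf : HasInt f a μ) (c : ℝ) : HasInt (fun v => c * f v) (c * a) μ :=
  ⟨hf.1.const_mul c, by rw [integral_const_mul, hf.2]⟩

theorem HasInt.sum {ι : Type*} {s : Finset ι} {f : ι → α → ℝ} {a : ι → ℝ}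
    (hf : ∀ i ∈ s, HasInt (f i) (a i) μ) :
    HasInt (fun v => ∑ i ∈ s, f i v) (∑ i ∈ s, a i) μ :=
  ⟨integrable_finsetSum s fun i hi => (hf i hi).1, by
    rw [integral_finsetSum s fun i hi => (hf i hi).1]
    exact Finset.sum_congr rfl fun i hi => (hf i hi).2⟩

theorem HasInt.congr (hf : HasInt f a μ) (h : ∀ v, g v = f v) : HasInt g a μ := by
  rwa [show g = f from funext h]

theorem HasInt.congr_ae (hf : HasInt f a μ) (h : ∀ᵐ v ∂μ, g v = f v) : HasInt g a μ :=
  ⟨hf.1.congr (h.mono fun _ hx => hx.symm), (integral_congr_ae h).trans hf.2⟩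

theorem HasInt.unique (hf : HasInt f a μ) (hg : HasInt f b μ) : a = b :=
  hf.2.symm.trans hg.2

theorem hasInt_mul (hf : MemLp f 2 μ) (hg : MemLp g 2 μ) :
    HasInt (fun x => f x * g x) (∫ x, f x * g x ∂μ) μ :=
  ⟨integrable_mul_of_memLp hf hg, rfl⟩

theorem hasInt_sq (hf : MemLp f 2 μ) : HasInt (fun x => f x ^ 2) (∫ x, f x ^ 2 ∂μ) μ :=
  ⟨hf.integrable_sq, rfl⟩

end HasInt

theorem hasInt_deriv {f f' : ℝ → ℝ} (hd : ∀ v, HasDerivAt f (f' v) v) (hf : Integrable f)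
    (hf' : Integrable f') : HasInt f' 0 :=
  ⟨hf', integral_eq_zero_of_hasDerivAt_of_integrable hd hf' hf⟩

theorem rapid_id_mul_sqrtM : Rapid fun v => v * sqrtM v := rapid_sqrtM.mul_id

theorem Rapid.hasInt {ψ f : ℝ → ℝ} (h : Rapid ψ) (hf : PolyGrowth f) :
    HasInt (fun v => f v * ψ v) (∫ v, f v * ψ v) := ⟨h.integrable_mul hf, rfl⟩

/-! ### Moments of the force and collision operators against `√M` and `v√M`. -/

section VelocityIdentities

variable {f f' f'' : ℝ → ℝ} (hf : PolyGrowth f) (hf' : PolyGrowth f') (hf'' : PolyGrowth f'')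
  (hd : ∀ v, HasDerivAt f (f' v) v) (hd' : ∀ v, HasDerivAt f' (f'' v) v)

-- Integrate the total derivative of `f √M`. Equivalently, `∂_v f - (v/2) f` has no mass, which is
-- why the force disappears from the continuity equation.
include hf hf' hd in
theorem integral_deriv_mul_sqrtM :
    ∫ v, f' v * sqrtM v = 1 / 2 * ∫ v, f v * (v * sqrtM v) := by
  have h := (rapid_sqrtM.hasInt hf').sub ((rapid_id_mul_sqrtM.hasInt hf).const_mul (1 / 2))
  have h2 := hasInt_deriv (f := fun v => f v * sqrtM v)
    (fun v => ((hd v).fun_mul (hasDerivAt_sqrtM v)).congr_deriv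
      (by ring : _ = f' v * sqrtM v - 1 / 2 * (f v * (v * sqrtM v))))
    (rapid_sqrtM.integrable_mul hf) h.1
  linarith [h.unique h2]

-- Integrate the total derivative of `f v√M`. The force operator `∂_v - v/2` therefore has momentum
-- `-∫ f √M`, which produces the term `F σ` in the momentum balance.
include hf hf' hd in
theorem integral_deriv_mul_id_mul_sqrtM :
    ∫ v, f' v * (v * sqrtM v)
      = 1 / 2 * (∫ v, f v * (v * (v * sqrtM v))) - ∫ v, f v * sqrtM v := by
  have h := ((rapid_id_mul_sqrtM.hasInt hf').sub
    ((rapid_id_mul_sqrtM.mul_id.hasInt hf).const_mul (1 / 2))).add (rapid_sqrtM.hasInt hf)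
  have h2 := hasInt_deriv (f := fun v => f v * (v * sqrtM v))
    (fun v => ((hd v).fun_mul ((hasDerivAt_id' v).fun_mul (hasDerivAt_sqrtM v))).congr_deriv
      (by ring : _ = f' v * (v * sqrtM v) - 1 / 2 * (f v * (v * (v * sqrtM v))) + f v * sqrtM v))
    (rapid_id_mul_sqrtM.integrable_mul hf) h.1
  linarith [h.unique h2]

include hf hf'' in
theorem hasInt_linFP {χ : ℝ → ℝ} (hχ : Rapid χ) :
    HasInt (fun v => (f'' v + (1 / 2 - v ^ 2 / 4) * f v) * χ v)
      ((∫ v, f'' v * χ v) + (1 / 2 * (∫ v, f v * χ v) - 1 / 4 * ∫ v, f v * (v * (v * χ v)))) :=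
  ((hχ.hasInt hf'').add (((hχ.hasInt hf).const_mul (1 / 2)).sub
    ((hχ.mul_id.mul_id.hasInt hf).const_mul (1 / 4)))).congr fun v => by ring

-- Collisions conserve mass: the integrand is the derivative of `√M (f' + (v/2) f)`.
include hf hf' hf'' hd hd' in
theorem integral_linFP_mul_sqrtM :
    ∫ v, (f'' v + (1 / 2 - v ^ 2 / 4) * f v) * sqrtM v = 0 := by
  have h := hasInt_linFP hf hf'' rapid_sqrtM
  exact (hasInt_deriv (f := fun v => f' v * sqrtM v + 1 / 2 * (f v * (v * sqrtM v)))
    (fun v => (((hd' v).fun_mul (hasDerivAt_sqrtM v)).fun_add (((hd v).fun_mul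
      ((hasDerivAt_id' v).fun_mul (hasDerivAt_sqrtM v))).const_mul (1 / 2))).congr_deriv
      (by ring : _ = (f'' v + (1 / 2 - v ^ 2 / 4) * f v) * sqrtM v))
    ((rapid_sqrtM.integrable_mul hf').add ((rapid_id_mul_sqrtM.integrable_mul hf).const_mul _))
    h.1).2

-- `v√M` is an eigenfunction of the symmetric operator `𝓛` with eigenvalue `-1`; the integrand plus
-- `f v√M` is an exact derivative. This is the friction on the current.
include hf hf' hf'' hd hd' in
theorem integral_linFP_mul_id_mul_sqrtM :
    ∫ v, (f'' v + (1 / 2 - v ^ 2 / 4) * f v) * (v * sqrtM v) = -∫ v, f v * (v * sqrtM v) := by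
  have h := hasInt_linFP hf hf'' rapid_id_mul_sqrtM
  have h1 := rapid_id_mul_sqrtM.hasInt hf
  have h2 := hasInt_deriv (f := fun v => f' v * (v * sqrtM v)
      + (1 / 2 * (f v * (v * (v * sqrtM v))) - f v * sqrtM v))
    (fun v => (((hd' v).fun_mul ((hasDerivAt_id' v).fun_mul (hasDerivAt_sqrtM v))).fun_add
      ((((hd v).fun_mul ((hasDerivAt_id' v).fun_mul ((hasDerivAt_id' v).fun_mul
        (hasDerivAt_sqrtM v)))).const_mul (1 / 2)).fun_sub
        ((hd v).fun_mul (hasDerivAt_sqrtM v)))).congr_deriv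
      (by ring : _ = (f'' v + (1 / 2 - v ^ 2 / 4) * f v) * (v * sqrtM v) + f v * (v * sqrtM v)))
    ((rapid_id_mul_sqrtM.integrable_mul hf').add
      (((rapid_id_mul_sqrtM.mul_id.integrable_mul hf).const_mul _).sub
      (rapid_sqrtM.integrable_mul hf))) (h.1.add h1.1)
  have h3 := h.add h1
  have e := h3.unique h2
  rw [h.2]
  linarith

end VelocityIdentities

/-! ### Iterated derivatives -/

theorem iteratedDeriv_eqOn {U : Set ℝ} (hU : IsOpen U) {f : ℝ → ℝ} {F : ℕ → ℝ → ℝ} {n : ℕ}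
    (h0 : EqOn f (F 0) U) (h : ∀ k < n, ∀ z ∈ U, HasDerivAt (F k) (F (k + 1) z) z) :
    ∀ k ≤ n, EqOn (iteratedDeriv k f) (F k) U := by
  intro k
  induction k with
  | zero => intro _; simpa using h0
  | succ k ih =>
    intro hk z hz
    rw [iteratedDeriv_succ, (Filter.eventuallyEq_of_mem (hU.mem_nhds hz)
      (ih (by omega))).deriv_eq]
    exact (h k hk z hz).deriv

/-- The `x`-derivatives are taken first, at every `z` of the open set. They are thus required only
at `z`-order zero, and the `z`-derivatives only at the final `x`-order. -/
theorem iteratedDeriv_iteratedDeriv_eq {Iz : Set ℝ} (hIz : IsOpen Iz) {G : ℝ → ℝ → ℝ}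
    {A : ℕ → ℕ → ℝ → ℝ → ℝ} {i l : ℕ} (h0 : ∀ x, ∀ z ∈ Iz, G x z = A 0 0 x z)
    (hx : ∀ i' < i, ∀ x, ∀ z ∈ Iz, HasDerivAt (fun y => A i' 0 y z) (A (i' + 1) 0 x z) x)
    (hz : ∀ l' < l, ∀ x, ∀ z ∈ Iz, HasDerivAt (fun y => A i l' x y) (A i (l' + 1) x z) z)
    (x : ℝ) {z : ℝ} (hzI : z ∈ Iz) :
    iteratedDeriv l (fun z' => iteratedDeriv i (fun x' => G x' z') x) z = A i l x z := by
  refine iteratedDeriv_eqOn hIz (F := fun l z => A i l x z) (n := l) (fun z' hz' => ?_)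
    (fun l' hl' z' hz' => hz l' hl' x z' hz') l le_rfl hzI
  exact iteratedDeriv_eqOn isOpen_univ (F := fun i y => A i 0 y z') (n := i)
    (fun y _ => h0 y z' hz') (fun i' hi' y _ => hx i' hi' y z' hz') i le_rfl (mem_univ x)

/-- The device by which pointwise equations are differentiated: a residual vanishing on an open set
has vanishing derivative there. -/
theorem HasDerivAt.eq_zero_of_eqOn {U : Set ℝ} (hU : IsOpen U) {f : ℝ → ℝ} {f' s : ℝ}
    (h0 : ∀ r ∈ U, f r = 0) (hs : s ∈ U) (h : HasDerivAt f f' s) : f' = 0 := by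
  have h1 : HasDerivAt f 0 s := (hasDerivAt_const s (0 : ℝ)).congr_of_eventuallyEq
    (Filter.eventuallyEq_of_mem (hU.mem_nhds hs) h0)
  exact h.unique h1

/-- Leibniz rule for a binomial convolution. -/
theorem hasDerivAt_sum_antidiagonal {f g : ℕ → ℝ → ℝ} {l : ℕ} {z : ℝ}
    (hf : ∀ k ≤ l, HasDerivAt (f k) (f (k + 1) z) z)
    (hg : ∀ k ≤ l, HasDerivAt (g k) (g (k + 1) z) z) :
    HasDerivAt (fun y => ∑ b ∈ Finset.HasAntidiagonal.antidiagonal l,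
        (l.choose b.1 : ℝ) * (f b.1 y * g b.2 y))
      (∑ b ∈ Finset.HasAntidiagonal.antidiagonal (l + 1),
        ((l + 1).choose b.1 : ℝ) * (f b.1 z * g b.2 z)) z := by
  rw [Finset.sum_antidiagonal_choose_succ_mul (fun a b => f a z * g b z) l,
    ← Finset.sum_add_distrib]
  refine HasDerivAt.fun_sum fun b hb => ?_
  have hb' := Finset.HasAntidiagonal.mem_antidiagonal.1 hb
  have hch : l.choose b.2 = l.choose b.1 := Nat.choose_symm_of_eq_add (by omega)
  refine (((hf b.1 (by omega)).fun_mul (hg b.2 (by omega))).const_mul _).congr_deriv ?_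
  rw [hch]; ring

/-- Binomial convolution in `(x, z)` derivatives. -/
def conv (E G : ℕ → ℕ → ℝ) (i l : ℕ) : ℝ :=
  ∑ a ∈ Finset.HasAntidiagonal.antidiagonal i, ∑ b ∈ Finset.HasAntidiagonal.antidiagonal l,
    ((i.choose a.1 : ℝ) * (l.choose b.1 : ℝ)) * (E a.1 b.1 * G a.2 b.2)

theorem hasDerivAt_conv_z {E G : ℕ → ℕ → ℝ → ℝ} {i l : ℕ} {z : ℝ}
    (hE : ∀ a ≤ i, ∀ k ≤ l, HasDerivAt (E a k) (E a (k + 1) z) z)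
    (hG : ∀ a ≤ i, ∀ k ≤ l, HasDerivAt (G a k) (G a (k + 1) z) z) :
    HasDerivAt (fun y => conv (fun a b => E a b y) (fun a b => G a b y) i l)
      (conv (fun a b => E a b z) (fun a b => G a b z) i (l + 1)) z := by
  unfold conv
  refine HasDerivAt.fun_sum fun a ha => ?_
  have ha' := Finset.HasAntidiagonal.mem_antidiagonal.1 ha
  have := (hasDerivAt_sum_antidiagonal (fun k hk => hE a.1 (by omega) k hk)
    (fun k hk => hG a.2 (by omega) k hk)).const_mul (i.choose a.1 : ℝ)
  simpa only [Finset.mul_sum, mul_assoc] using this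

theorem hasDerivAt_conv_x {E G : ℕ → ℕ → ℝ → ℝ} {i : ℕ} {x : ℝ}
    (hE : ∀ a ≤ i, HasDerivAt (E a 0) (E (a + 1) 0 x) x)
    (hG : ∀ a ≤ i, HasDerivAt (G a 0) (G (a + 1) 0 x) x) :
    HasDerivAt (fun y => conv (fun a b => E a b y) (fun a b => G a b y) i 0)
      (conv (fun a b => E a b x) (fun a b => G a b x) (i + 1) 0) x := by
  have := hasDerivAt_sum_antidiagonal (f := fun a => E a 0) (g := fun a => G a 0) hE hG
  unfold conv
  simpa using this

theorem HasInt.conv {E : ℕ → ℕ → ℝ} {G : ℕ → ℕ → ℝ → ℝ} {g : ℕ → ℕ → ℝ} {i l : ℕ}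
    (h : ∀ a ≤ i, ∀ b ≤ l, HasInt (G a b) (g a b)) :
    HasInt (fun v => conv E (fun a b => G a b v) i l) (conv E g i l) := by
  unfold VPFP.conv
  refine HasInt.sum fun a ha => HasInt.sum fun b hb => ?_
  have ha' := Finset.HasAntidiagonal.mem_antidiagonal.1 ha
  have hb' := Finset.HasAntidiagonal.mem_antidiagonal.1 hb
  exact (((h a.2 (by omega) b.2 (by omega)).const_mul _).const_mul _)

/-! ### The differentiated system -/

/-- `∂_x^a ∂_z^b ∂_x φ`, from a family of derivatives of `φ`. -/
def field (Q : ℕ → ℕ → ℕ → ℕ → ℝ → ℝ → ℝ → ℝ → ℝ) (a b : ℕ) (t x z : ℝ) : ℝ :=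
  Q 0 (a + 1) 0 b t x 0 z

/-- The Vlasov-Poisson-Fokker-Planck system in terms of families of derivatives. -/
structure System (m : ℕ) (ε δ : ℝ) (J Iz : Set ℝ)
    (D Q : ℕ → ℕ → ℕ → ℕ → ℝ → ℝ → ℝ → ℝ → ℝ) : Prop where
  openJ : IsOpen J
  openIz : IsOpen Iz
  famD : MixedFamily J Iz m D
  famQ : MixedFamily J Iz m Q
  kinetic : ∀ t ∈ J, ∀ x v : ℝ, ∀ z ∈ Iz,
    ε * δ * D 1 0 0 0 t x v z + ε * (v * D 0 1 0 0 t x v z)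
      - δ * (field Q 0 0 t x z * D 0 0 1 0 t x v z)
      + δ * (v / 2 * (field Q 0 0 t x z * D 0 0 0 0 t x v z))
      + δ * (v * sqrtM v * field Q 0 0 t x z)
      = D 0 0 2 0 t x v z + (1 / 2 - v ^ 2 / 4) * D 0 0 0 0 t x v z
  poisson : ∀ t ∈ J, ∀ x : ℝ, ∀ z ∈ Iz, Q 0 2 0 0 t x 0 z = -moment D sqrtM 0 0 0 t x z

section System

variable {m : ℕ} {ε δ : ℝ} {J Iz : Set ℝ} {D Q : ℕ → ℕ → ℕ → ℕ → ℝ → ℝ → ℝ → ℝ → ℝ}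

theorem MixedFamily.hasDerivAt_field_x (hQ : MixedFamily J Iz m Q) {a b : ℕ} (ha : a ≤ 1)
    (hb : b ≤ m) {t : ℝ} (ht : t ∈ J) (x : ℝ) {z : ℝ} (hz : z ∈ Iz) :
    HasDerivAt (fun y => field Q a b t y z) (field Q (a + 1) b t x z) x :=
  (hQ.deriv 0 (a + 1) 0 b (by omega) hb t ht x 0 z hz).2.1

theorem MixedFamily.hasDerivAt_field_z (hQ : MixedFamily J Iz m Q) {a b : ℕ} (ha : a ≤ 2)
    (hb : b < m) {t : ℝ} (ht : t ∈ J) (x : ℝ) {z : ℝ} (hz : z ∈ Iz) :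
    HasDerivAt (fun y => field Q a b t x y) (field Q a (b + 1) t x z) z :=
  hQ.deriv_z 0 (a + 1) 0 b (by omega) hb t ht x 0 z hz

theorem conv_zero_zero (E G : ℕ → ℕ → ℝ) : conv E G 0 0 = E 0 0 * G 0 0 := by
  simp [conv]

/-- The residual of the differentiated kinetic equation. -/
def residual (ε δ : ℝ) (D Q : ℕ → ℕ → ℕ → ℕ → ℝ → ℝ → ℝ → ℝ → ℝ) (i l : ℕ) (t x v z : ℝ) : ℝ :=
  ε * δ * D 1 i 0 l t x v z + ε * (v * D 0 (i + 1) 0 l t x v z)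
    - δ * conv (fun a b => field Q a b t x z) (fun a b => D 0 a 1 b t x v z) i l
    + δ * (v / 2 * conv (fun a b => field Q a b t x z) (fun a b => D 0 a 0 b t x v z) i l)
    + δ * (v * sqrtM v * field Q i l t x z)
    - (D 0 i 2 l t x v z + (1 / 2 - v ^ 2 / 4) * D 0 i 0 l t x v z)

/-- The equation is differentiated at most once in `x` and then by induction `l` times in `z`. The
force term follows the Leibniz rule encoded in `conv`; the other coefficients depend on `v` only. -/
theorem System.residual_eq_zero (S : System m ε δ J Iz D Q) {i l : ℕ} (hi : i ≤ 1) (hl : l ≤ m)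
    {t : ℝ} (ht : t ∈ J) (x v : ℝ) {z : ℝ} (hz : z ∈ Iz) : residual ε δ D Q i l t x v z = 0 := by
  have hD := S.famD
  have hQ := S.famQ
  have h00 : ∀ x, ∀ z ∈ Iz, residual ε δ D Q 0 0 t x v z = 0 := by
    intro x z hz
    have := S.kinetic t ht x v z hz
    simp only [residual, conv_zero_zero, zero_add]
    linarith
  have h10 : ∀ x, ∀ z ∈ Iz, residual ε δ D Q 1 0 t x v z = 0 := by
    intro x z hz
    refine HasDerivAt.eq_zero_of_eqOn isOpen_univ (f := fun y => residual ε δ D Q 0 0 t y v z)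
      (fun y _ => h00 y z hz) (mem_univ x) ?_
    have c1 := hasDerivAt_conv_x (i := 0) (E := fun a b y => field Q a b t y z)
      (G := fun a b y => D 0 a 1 b t y v z)
      (fun a ha => hQ.hasDerivAt_field_x (by omega) (Nat.zero_le m) ht x hz)
      (fun a ha => (hD.deriv 0 a 1 0 (by omega) (Nat.zero_le m) t ht x v z hz).2.1)
    have c2 := hasDerivAt_conv_x (i := 0) (E := fun a b y => field Q a b t y z)
      (G := fun a b y => D 0 a 0 b t y v z)
      (fun a ha => hQ.hasDerivAt_field_x (by omega) (Nat.zero_le m) ht x hz)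
      (fun a ha => (hD.deriv 0 a 0 0 (by omega) (Nat.zero_le m) t ht x v z hz).2.1)
    have d1 := (hD.deriv 1 0 0 0 (by omega) (Nat.zero_le m) t ht x v z hz).2.1
    have d2 := (hD.deriv 0 1 0 0 (by omega) (Nat.zero_le m) t ht x v z hz).2.1
    have d3 := hQ.hasDerivAt_field_x (a := 0) (by omega) (Nat.zero_le m) ht x hz
    have d4 := (hD.deriv 0 0 2 0 (by omega) (Nat.zero_le m) t ht x v z hz).2.1
    have d5 := (hD.deriv 0 0 0 0 (by omega) (Nat.zero_le m) t ht x v z hz).2.1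
    exact ((((((d1.const_mul (ε * δ)).fun_add ((d2.const_mul v).const_mul ε)).fun_sub
      (c1.const_mul δ)).fun_add ((c2.const_mul (v / 2)).const_mul δ)).fun_add
      ((d3.const_mul (v * sqrtM v)).const_mul δ)).fun_sub (d4.fun_add (d5.const_mul _)))
  have key : ∀ l ≤ m, ∀ x, ∀ z ∈ Iz, residual ε δ D Q i l t x v z = 0 := by
    intro l
    induction l with
    | zero => intro _; interval_cases i
              · exact h00
              · exact h10
    | succ l ih =>
      intro hl x z hz
      refine HasDerivAt.eq_zero_of_eqOn S.openIz (f := fun y => residual ε δ D Q i l t x v y)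
        (fun y hy => ih (by omega) x y hy) hz ?_
      have c1 := hasDerivAt_conv_z (i := i) (l := l) (E := fun a b y => field Q a b t x y)
        (G := fun a b y => D 0 a 1 b t x v y)
        (fun a ha k hk => hQ.hasDerivAt_field_z (by omega) (by omega) ht x hz)
        (fun a ha k hk => hD.deriv_z 0 a 1 k (by omega) (by omega) t ht x v z hz)
      have c2 := hasDerivAt_conv_z (i := i) (l := l) (E := fun a b y => field Q a b t x y)
        (G := fun a b y => D 0 a 0 b t x v y)
        (fun a ha k hk => hQ.hasDerivAt_field_z (by omega) (by omega) ht x hz)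
        (fun a ha k hk => hD.deriv_z 0 a 0 k (by omega) (by omega) t ht x v z hz)
      have d1 := hD.deriv_z 1 i 0 l (by omega) hl t ht x v z hz
      have d2 := hD.deriv_z 0 (i + 1) 0 l (by omega) hl t ht x v z hz
      have d3 := hQ.hasDerivAt_field_z (a := i) (by omega) hl ht x hz
      have d4 := hD.deriv_z 0 i 2 l (by omega) hl t ht x v z hz
      have d5 := hD.deriv_z 0 i 0 l (by omega) hl t ht x v z hz
      exact ((((((d1.const_mul (ε * δ)).fun_add ((d2.const_mul v).const_mul ε)).fun_sub
        (c1.const_mul δ)).fun_add ((c2.const_mul (v / 2)).const_mul δ)).fun_add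
        ((d3.const_mul (v * sqrtM v)).const_mul δ)).fun_sub (d4.fun_add (d5.const_mul _)))
  exact key l hl x z hz

/-- The differentiated kinetic equation integrated against a velocity weight. -/
theorem System.moment_eq (S : System m ε δ J Iz D Q) {i l : ℕ} (hi : i ≤ 1) (hl : l ≤ m)
    {t : ℝ} (ht : t ∈ J) (x : ℝ) {z : ℝ} (hz : z ∈ Iz) {χ : ℝ → ℝ} (hχ : Rapid χ) :
    ε * δ * moment D χ 1 i l t x z + ε * moment D (fun v => v * χ v) 0 (i + 1) l t x z
      - δ * conv (fun a b => field Q a b t x z) (fun a b => (∫ v, D 0 a 1 b t x v z * χ v)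
        - 1 / 2 * ∫ v, D 0 a 0 b t x v z * (v * χ v)) i l
      + δ * (field Q i l t x z * ∫ v, v * sqrtM v * χ v)
      = ∫ v, (D 0 i 2 l t x v z + (1 / 2 - v ^ 2 / 4) * D 0 i 0 l t x v z) * χ v := by
  have hD := S.famD
  have pg : ∀ k i j l, k + i + j ≤ 3 → l ≤ m → PolyGrowth fun v => D k i j l t x v z :=
    fun k i j l h hl => hD.polyGrowth h hl ht x hz
  have hs : PolyGrowth fun v => v * sqrtM v := by
    refine ⟨rapid_id_mul_sqrtM.cont, 1, 1, fun v => ?_⟩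
    have h1 : sqrtM v ≤ 1 := by
      unfold sqrtM
      rw [Real.sqrt_le_iff, one_pow]
      refine ⟨zero_le_one, ?_⟩
      unfold maxwellian
      refine mul_le_one₀ ?_ (Real.exp_nonneg _) (Real.exp_le_one_iff.2 (by nlinarith [sq_nonneg v]))
      rw [div_le_one (Real.sqrt_pos.2 (by positivity))]
      exact Real.one_le_sqrt.2 (by nlinarith [Real.pi_gt_three])
    rw [abs_mul, abs_of_pos (sqrtM_pos v), one_mul, pow_one]
    nlinarith [abs_nonneg v]
  have t1 := (hχ.hasInt (pg 1 i 0 l (by omega) hl)).const_mul (ε * δ)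
  have t2 := (hχ.mul_id.hasInt (pg 0 (i + 1) 0 l (by omega) hl)).const_mul ε
  have t3 := (HasInt.conv (E := fun a b => field Q a b t x z) (i := i) (l := l)
    (G := fun a b v => D 0 a 1 b t x v z * χ v - 1 / 2 * (D 0 a 0 b t x v z * (v * χ v)))
    (fun a ha b hb => (hχ.hasInt (pg 0 a 1 b (by omega) (by omega))).sub
      ((hχ.mul_id.hasInt (pg 0 a 0 b (by omega) (by omega))).const_mul (1 / 2)))).const_mul δ
  have t4 := ((hχ.hasInt hs).const_mul (field Q i l t x z)).const_mul δ
  have t5 := hasInt_linFP (pg 0 i 0 l (by omega) hl) (pg 0 i 2 l (by omega) hl) hχ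
  have h := (((t1.add t2).sub t3).add t4).sub t5
  -- The combination of all terms is the residual times `χ`, hence the zero function. Comparing its
  -- integral with the sum of the individual integrals gives the moment identity.
  have h0 : HasInt (fun _ : ℝ => (0 : ℝ)) 0 := ⟨integrable_zero _ _ _, integral_zero _ _⟩
  have := (h0.congr fun v => ?_).unique h
  · rw [t5.2]
    unfold moment
    linarith
  · have hr := S.residual_eq_zero hi hl ht x v hz
    have hc : conv (fun a b => field Q a b t x z)
        (fun a b => D 0 a 1 b t x v z * χ v - 1 / 2 * (D 0 a 0 b t x v z * (v * χ v))) i l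
        = conv (fun a b => field Q a b t x z) (fun a b => D 0 a 1 b t x v z) i l * χ v
          - 1 / 2 * (conv (fun a b => field Q a b t x z) (fun a b => D 0 a 0 b t x v z) i l
            * (v * χ v)) := by
      unfold conv
      simp only [Finset.sum_mul, Finset.mul_sum, ← Finset.sum_sub_distrib]
      refine Finset.sum_congr rfl fun a _ => Finset.sum_congr rfl fun b _ => ?_
      ring
    rw [hc]
    unfold residual at hr
    linear_combination (χ v) * hr

theorem conv_zero_right (E : ℕ → ℕ → ℝ) (i l : ℕ) : conv E (fun _ _ => 0) i l = 0 := by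
  simp [conv]

theorem conv_congr {E G G' : ℕ → ℕ → ℝ} {i l : ℕ} (h : ∀ a ≤ i, ∀ b ≤ l, G a b = G' a b) :
    conv E G i l = conv E G' i l := by
  unfold conv
  refine Finset.sum_congr rfl fun a ha => Finset.sum_congr rfl fun b hb => ?_
  have ha' := Finset.HasAntidiagonal.mem_antidiagonal.1 ha
  have hb' := Finset.HasAntidiagonal.mem_antidiagonal.1 hb
  rw [h a.2 (by omega) b.2 (by omega)]

/-- Local conservation of mass. -/
theorem System.mass (S : System m ε δ J Iz D Q) (hε : ε ≠ 0) {i l : ℕ} (hi : i ≤ 1) (hl : l ≤ m)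
    {t : ℝ} (ht : t ∈ J) (x : ℝ) {z : ℝ} (hz : z ∈ Iz) :
    δ * moment D sqrtM 1 i l t x z + moment D (fun v => v * sqrtM v) 0 (i + 1) l t x z = 0 := by
  have hD := S.famD
  have h := S.moment_eq hi hl ht x hz rapid_sqrtM
  rw [integral_linFP_mul_sqrtM (hD.polyGrowth (by omega) hl ht x hz)
    (hD.polyGrowth (j := 1) (by omega) hl ht x hz) (hD.polyGrowth (by omega) hl ht x hz)
    (fun v => (hD.deriv 0 i 0 l (by omega) hl t ht x v z hz).2.2)
    (fun v => (hD.deriv 0 i 1 l (by omega) hl t ht x v z hz).2.2),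
    conv_congr (G' := fun _ _ => 0), conv_zero_right] at h
  · have h2 : ∫ v, v * sqrtM v * sqrtM v = 0 := by
      rw [← integral_id_mul_maxwellian]
      congr 1; ext v; rw [mul_assoc, sqrtM_mul_self]
    rw [h2] at h
    have : ε * (δ * moment D sqrtM 1 i l t x z
        + moment D (fun v => v * sqrtM v) 0 (i + 1) l t x z) = 0 := by linarith
    exact (mul_eq_zero.1 this).resolve_left hε
  · intro a ha b hb
    rw [integral_deriv_mul_sqrtM (hD.polyGrowth (by omega) (by omega) ht x hz)
      (hD.polyGrowth (by omega) (by omega) ht x hz)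
      (fun v => (hD.deriv 0 a 0 b (by omega) (by omega) t ht x v z hz).2.2)]
    ring

/-- Local balance of momentum. -/
theorem System.momentum (S : System m ε δ J Iz D Q) {i l : ℕ} (hi : i ≤ 1) (hl : l ≤ m)
    {t : ℝ} (ht : t ∈ J) (x : ℝ) {z : ℝ} (hz : z ∈ Iz) :
    ε * δ * moment D (fun v => v * sqrtM v) 1 i l t x z
      + ε * moment D (fun v => v * (v * sqrtM v)) 0 (i + 1) l t x z
      + δ * conv (fun a b => field Q a b t x z) (fun a b => moment D sqrtM 0 a b t x z) i l
      + δ * field Q i l t x z = -moment D (fun v => v * sqrtM v) 0 i l t x z := by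
  have hD := S.famD
  have h := S.moment_eq hi hl ht x hz rapid_id_mul_sqrtM
  rw [integral_linFP_mul_id_mul_sqrtM (hD.polyGrowth (by omega) hl ht x hz)
    (hD.polyGrowth (j := 1) (by omega) hl ht x hz) (hD.polyGrowth (by omega) hl ht x hz)
    (fun v => (hD.deriv 0 i 0 l (by omega) hl t ht x v z hz).2.2)
    (fun v => (hD.deriv 0 i 1 l (by omega) hl t ht x v z hz).2.2),
    conv_congr (G' := fun a b => -moment D sqrtM 0 a b t x z)] at h
  · have h2 : ∫ v, v * sqrtM v * (v * sqrtM v) = 1 := by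
      rw [← integral_sq_mul_maxwellian]
      congr 1; ext v; rw [← sqrtM_mul_self]; ring
    have h3 : conv (fun a b => field Q a b t x z) (fun a b => -moment D sqrtM 0 a b t x z) i l
        = -conv (fun a b => field Q a b t x z) (fun a b => moment D sqrtM 0 a b t x z) i l := by
      simp [conv]
    rw [h2, h3] at h
    have h4 : ∫ v, D 0 i 0 l t x v z * (v * sqrtM v)
        = moment D (fun v => v * sqrtM v) 0 i l t x z := rfl
    rw [h4] at h
    linarith
  · intro a ha b hb
    rw [integral_deriv_mul_id_mul_sqrtM (hD.polyGrowth (by omega) (by omega) ht x hz)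
      (hD.polyGrowth (by omega) (by omega) ht x hz)
      (fun v => (hD.deriv 0 a 0 b (by omega) (by omega) t ht x v z hz).2.2)]
    unfold moment
    ring

/-- The differentiated Poisson equation. -/
theorem System.poisson_deriv (S : System m ε δ J Iz D Q) {k i l : ℕ} (hki : k + i ≤ 1)
    (hl : l ≤ m) {t : ℝ} (ht : t ∈ J) (x : ℝ) {z : ℝ} (hz : z ∈ Iz) :
    Q k (2 + i) 0 l t x 0 z + moment D sqrtM k i l t x z = 0 := by
  have hD := S.famD
  have hQ := S.famQ
  have h0 : ∀ t ∈ J, ∀ x, ∀ z ∈ Iz, Q 0 2 0 0 t x 0 z + moment D sqrtM 0 0 0 t x z = 0 :=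
    fun t ht x z hz => by rw [S.poisson t ht x z hz]; ring
  have hkey : ∀ x, ∀ z ∈ Iz, Q k (2 + i) 0 0 t x 0 z + moment D sqrtM k i 0 t x z = 0 := by
    intro x z hz
    rcases (show k = 0 ∧ i = 0 ∨ k = 1 ∧ i = 0 ∨ k = 0 ∧ i = 1 by omega) with h | h | h
    · obtain ⟨rfl, rfl⟩ := h
      exact h0 t ht x z hz
    · obtain ⟨rfl, rfl⟩ := h
      exact HasDerivAt.eq_zero_of_eqOn S.openJ (fun s hs => h0 s hs x z hz) ht
        ((hQ.deriv 0 2 0 0 (by omega) (Nat.zero_le m) t ht x 0 z hz).1.fun_add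
          (hD.hasDerivAt_moment_t S.openJ rapid_sqrtM (by omega) (Nat.zero_le m) ht x hz))
    · obtain ⟨rfl, rfl⟩ := h
      exact HasDerivAt.eq_zero_of_eqOn isOpen_univ (fun y _ => h0 t ht y z hz) (mem_univ x)
        ((hQ.deriv 0 2 0 0 (by omega) (Nat.zero_le m) t ht x 0 z hz).2.1.fun_add
          (hD.hasDerivAt_moment_x rapid_sqrtM (by omega) (Nat.zero_le m) ht x hz))
  have hall : ∀ l ≤ m, ∀ z ∈ Iz, Q k (2 + i) 0 l t x 0 z + moment D sqrtM k i l t x z = 0 := by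
    intro l
    induction l with
    | zero => exact fun _ z hz => hkey x z hz
    | succ l ih =>
      intro hl z hz
      exact HasDerivAt.eq_zero_of_eqOn S.openIz (fun y hy => ih (by omega) y hy) hz
        ((hQ.deriv_z k (2 + i) 0 l (by omega) hl t ht x 0 z hz).fun_add
          (hD.hasDerivAt_moment_z S.openIz rapid_sqrtM (by omega) hl ht x hz))
  exact hall l hl z hz

/-- `δ ∂_t ∂_x^i ∂_x φ - ∂_x^i u` is independent of `x` (`i = 0`). -/
theorem System.current_const (S : System m ε δ J Iz D Q) (hε : ε ≠ 0) {l : ℕ} (hl : l ≤ m)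
    {t : ℝ} (ht : t ∈ J) (x : ℝ) {z : ℝ} (hz : z ∈ Iz) :
    δ * Q 1 1 0 l t x 0 z - moment D (fun v => v * sqrtM v) 0 0 l t x z
      = δ * Q 1 1 0 l t 0 0 z - moment D (fun v => v * sqrtM v) 0 0 l t 0 z := by
  have hd : ∀ y, HasDerivAt (fun y => δ * Q 1 1 0 l t y 0 z
      - moment D (fun v => v * sqrtM v) 0 0 l t y z) 0 y := by
    intro y
    refine (((S.famQ.deriv 1 1 0 l (by omega) hl t ht y 0 z hz).2.1.const_mul δ).fun_sub
      (S.famD.hasDerivAt_moment_x rapid_id_mul_sqrtM (by omega) hl ht y hz)).congr_deriv ?_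
    have h1 := S.poisson_deriv (k := 1) (i := 0) (by omega) hl ht y hz
    have h2 := S.mass hε (i := 0) (by omega) hl ht y hz
    simp only [add_zero, zero_add] at h1 h2 ⊢
    have h3 : Q 1 (1 + 1) 0 l t y 0 z = -moment D sqrtM 1 0 l t y z := by linarith
    rw [h3]; linarith
  exact is_const_of_deriv_eq_zero (fun y => (hd y).differentiableAt) (fun y => (hd y).deriv) x 0

end System

/-! ### Hydrodynamic quantities of a family of derivatives -/

section Quantities

variable (D : ℕ → ℕ → ℕ → ℕ → ℝ → ℝ → ℝ → ℝ → ℝ) (i l : ℕ) (t : ℝ)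

/-- `∂_x^i ∂_z^l σ` -/
def sig (x z : ℝ) : ℝ := moment D sqrtM 0 i l t x z

/-- `∂_x^i ∂_z^l u` -/
def cur (x z : ℝ) : ℝ := moment D (fun v => v * sqrtM v) 0 i l t x z

/-- `∂_x^i ∂_z^l ∫ v² √M h dv` -/
def press (x z : ℝ) : ℝ := moment D (fun v => v * (v * sqrtM v)) 0 i l t x z

/-- `(∂_v + v/2) ∂_x^i ∂_z^l h` -/
def annih (x v z : ℝ) : ℝ := D 0 i 1 l t x v z + v / 2 * D 0 i 0 l t x v z

/-- `∂_x^i ∂_z^l (1 - Π) h` -/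
def microPart (x v z : ℝ) : ℝ :=
  D 0 i 0 l t x v z - sig D i l t x z * sqrtM v - cur D i l t x z * (v * sqrtM v)

/-- `∂_v ∂_x^i ∂_z^l (1 - Π) h` -/
def microDv (x v z : ℝ) : ℝ :=
  D 0 i 1 l t x v z - sig D i l t x z * (-(v / 2) * sqrtM v)
    - cur D i l t x z * (sqrtM v + v * (-(v / 2) * sqrtM v))

/-- `(∂_v + v/2) ∂_x^i ∂_z^l (1 - Π) h` -/
def microAnnih (x v z : ℝ) : ℝ := annih D i l t x v z - cur D i l t x z * sqrtM v

/-- `∂_x^i ∂_z^l (h - σ √M)` -/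
def nonMass (x v z : ℝ) : ℝ := D 0 i 0 l t x v z - sig D i l t x z * sqrtM v

end Quantities

theorem integral_sqrtM_sq : ∫ v, sqrtM v ^ 2 = 1 := by
  simp only [sq, sqrtM_mul_self]; exact integral_maxwellian

theorem integral_id_mul_sqrtM_sq : ∫ v, (v * sqrtM v) ^ 2 = 1 := by
  rw [← integral_sq_mul_maxwellian]
  congr 1; ext v; rw [← sqrtM_mul_self]; ring

theorem memLp_sq_mul_sqrtM : MemLp (fun v => v * (v * sqrtM v)) 2 volume :=
  (memLp_two_iff_integrable_sq rapid_id_mul_sqrtM.mul_id.cont.aestronglyMeasurable).2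
    (rapid_maxwellian.mul_id.mul_id.mul_id.mul_id.integrable'.congr
      (Eventually.of_forall fun v => by simp only [← sqrtM_mul_self]; ring))

/-- A solution at a fixed time with finite energy and dissipation. -/
structure EnergyData (m : ℕ) (ε δ : ℝ) (J Iz : Set ℝ) (dens : ℝ → ℝ)
    (D Q : ℕ → ℕ → ℕ → ℕ → ℝ → ℝ → ℝ → ℝ → ℝ) (t : ℝ) : Prop where
  sys : System m ε δ J Iz D Q
  density : IsDensity Iz dens
  mem : t ∈ J
  order : 1 ≤ m
  memLp_h : ∀ i ≤ 1, ∀ l ≤ m,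
    MemLp (fun q : (ℝ × ℝ) × ℝ => D 0 i 0 l t q.1.1 q.2 q.1.2) 2 (xzvMeasure Iz dens)
  memLp_vh : ∀ i ≤ 1, ∀ l ≤ m,
    MemLp (fun q : (ℝ × ℝ) × ℝ => q.2 * D 0 i 0 l t q.1.1 q.2 q.1.2) 2 (xzvMeasure Iz dens)
  memLp_dvh : ∀ i ≤ 1, ∀ l ≤ m,
    MemLp (fun q : (ℝ × ℝ) × ℝ => D 0 i 1 l t q.1.1 q.2 q.1.2) 2 (xzvMeasure Iz dens)
  memLp_field : ∀ i ≤ 1, ∀ l ≤ m,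
    MemLp (fun p : ℝ × ℝ => field Q i l t p.1 p.2) 2 (xzMeasure Iz dens)
  deriv_h : ∀ i ≤ 1, ∀ l ≤ m, HasL2DerivAt (xzvMeasure Iz dens)
    (fun s q => D 0 i 0 l s q.1.1 q.2 q.1.2) (fun q => D 1 i 0 l t q.1.1 q.2 q.1.2) t
  deriv_field : ∀ i ≤ 1, ∀ l ≤ m, HasL2DerivAt (xzMeasure Iz dens)
    (fun s p => field Q i l s p.1 p.2) (fun p => Q 1 (i + 1) 0 l t p.1 0 p.2) t

namespace EnergyData

variable {m : ℕ} {ε δ : ℝ} {J Iz : Set ℝ} {dens : ℝ → ℝ}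
  {D Q : ℕ → ℕ → ℕ → ℕ → ℝ → ℝ → ℝ → ℝ → ℝ} {t : ℝ} {i l : ℕ}

theorem memLp_sig (H : EnergyData m ε δ J Iz dens D Q t) (hi : i ≤ 1) (hl : l ≤ m) :
    MemLp (fun p : ℝ × ℝ => sig D i l t p.1 p.2) 2 (xzMeasure Iz dens) :=
  have := H.density.prob
  memLp_moment (H.memLp_h i hi l hl) memLp_sqrtM integral_sqrtM_sq

theorem memLp_cur (H : EnergyData m ε δ J Iz dens D Q t) (hi : i ≤ 1) (hl : l ≤ m) :
    MemLp (fun p : ℝ × ℝ => cur D i l t p.1 p.2) 2 (xzMeasure Iz dens) :=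
  have := H.density.prob
  memLp_moment (H.memLp_h i hi l hl) memLp_id_mul_sqrtM integral_id_mul_sqrtM_sq

/-- One factor `v` is moved onto `h`, so that the `L²` bound on `v h` and the unit vector `v√M` can
be used. -/
theorem press_eq (x z : ℝ) :
    press D i l t x z = ∫ v, (v * D 0 i 0 l t x v z) * (v * sqrtM v) := by
  unfold press moment
  congr 1; ext v; ring

theorem memLp_press (H : EnergyData m ε δ J Iz dens D Q t) (hi : i ≤ 1) (hl : l ≤ m) :
    MemLp (fun p : ℝ × ℝ => press D i l t p.1 p.2) 2 (xzMeasure Iz dens) := by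
  have := H.density.prob
  simp only [press_eq]
  exact memLp_moment (K := fun x v z => v * D 0 i 0 l t x v z) (H.memLp_vh i hi l hl)
    memLp_id_mul_sqrtM integral_id_mul_sqrtM_sq

theorem memLp_sig_tensor (H : EnergyData m ε δ J Iz dens D Q t) (hi : i ≤ 1) (hl : l ≤ m)
    {ψ : ℝ → ℝ} (hψ : MemLp ψ 2 volume) :
    MemLp (fun q : (ℝ × ℝ) × ℝ => sig D i l t q.1.1 q.1.2 * ψ q.2) 2 (xzvMeasure Iz dens) :=
  have := H.density.prob
  memLp_tensor (H.memLp_sig hi hl) hψ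

theorem memLp_cur_tensor (H : EnergyData m ε δ J Iz dens D Q t) (hi : i ≤ 1) (hl : l ≤ m)
    {ψ : ℝ → ℝ} (hψ : MemLp ψ 2 volume) :
    MemLp (fun q : (ℝ × ℝ) × ℝ => cur D i l t q.1.1 q.1.2 * ψ q.2) 2 (xzvMeasure Iz dens) :=
  have := H.density.prob
  memLp_tensor (H.memLp_cur hi hl) hψ

theorem memLp_nonMass (H : EnergyData m ε δ J Iz dens D Q t) (hi : i ≤ 1) (hl : l ≤ m) :
    MemLp (fun q : (ℝ × ℝ) × ℝ => nonMass D i l t q.1.1 q.2 q.1.2) 2 (xzvMeasure Iz dens) :=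
  (H.memLp_h i hi l hl).sub (H.memLp_sig_tensor hi hl memLp_sqrtM)

theorem memLp_annih (H : EnergyData m ε δ J Iz dens D Q t) (hi : i ≤ 1) (hl : l ≤ m) :
    MemLp (fun q : (ℝ × ℝ) × ℝ => annih D i l t q.1.1 q.2 q.1.2) 2 (xzvMeasure Iz dens) := by
  refine ((H.memLp_dvh i hi l hl).add ((H.memLp_vh i hi l hl).const_mul (1 / 2))).ae_eq
    (Eventually.of_forall fun q => ?_)
  simp only [Pi.add_apply, annih]; ring

theorem memLp_microAnnih (H : EnergyData m ε δ J Iz dens D Q t) (hi : i ≤ 1) (hl : l ≤ m) :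
    MemLp (fun q : (ℝ × ℝ) × ℝ => microAnnih D i l t q.1.1 q.2 q.1.2) 2 (xzvMeasure Iz dens) :=
  (H.memLp_annih hi hl).sub (H.memLp_cur_tensor hi hl memLp_sqrtM)

theorem memLp_microPart (H : EnergyData m ε δ J Iz dens D Q t) (hi : i ≤ 1) (hl : l ≤ m) :
    MemLp (fun q : (ℝ × ℝ) × ℝ => microPart D i l t q.1.1 q.2 q.1.2) 2 (xzvMeasure Iz dens) :=
  ((H.memLp_h i hi l hl).sub (H.memLp_sig_tensor hi hl memLp_sqrtM)).sub
    (H.memLp_cur_tensor hi hl memLp_id_mul_sqrtM)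

theorem memLp_v_microPart (H : EnergyData m ε δ J Iz dens D Q t) (hi : i ≤ 1) (hl : l ≤ m) :
    MemLp (fun q : (ℝ × ℝ) × ℝ => q.2 * microPart D i l t q.1.1 q.2 q.1.2) 2
      (xzvMeasure Iz dens) := by
  refine (((H.memLp_vh i hi l hl).sub (H.memLp_sig_tensor hi hl memLp_id_mul_sqrtM)).sub
    (H.memLp_cur_tensor hi hl memLp_sq_mul_sqrtM)).ae_eq (Eventually.of_forall fun q => ?_)
  simp only [Pi.sub_apply, microPart]; ring

theorem memLp_microDv (H : EnergyData m ε δ J Iz dens D Q t) (hi : i ≤ 1) (hl : l ≤ m) :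
    MemLp (fun q : (ℝ × ℝ) × ℝ => microDv D i l t q.1.1 q.2 q.1.2) 2 (xzvMeasure Iz dens) := by
  refine ((((H.memLp_dvh i hi l hl).add
    ((H.memLp_sig_tensor hi hl memLp_id_mul_sqrtM).const_mul (1 / 2))).sub
    (H.memLp_cur_tensor hi hl memLp_sqrtM)).add
    ((H.memLp_cur_tensor hi hl memLp_sq_mul_sqrtM).const_mul (1 / 2))).ae_eq
    (Eventually.of_forall fun q => ?_)
  simp only [Pi.sub_apply, Pi.add_apply, microDv]; ring

theorem microAnnih_eq (x v z : ℝ) :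
    microAnnih D i l t x v z = microDv D i l t x v z + v / 2 * microPart D i l t x v z := by
  unfold microAnnih annih microDv microPart; ring

theorem hasDerivAt_microPart (H : EnergyData m ε δ J Iz dens D Q t) (hi : i ≤ 1) (hl : l ≤ m)
    (x v : ℝ) {z : ℝ} (hz : z ∈ Iz) :
    HasDerivAt (fun w => microPart D i l t x w z) (microDv D i l t x v z) v :=
  ((H.sys.famD.deriv 0 i 0 l (by omega) hl t H.mem x v z hz).2.2.fun_sub
    ((hasDerivAt_sqrtM v).const_mul _)).fun_sub
    ((((hasDerivAt_id' v).fun_mul (hasDerivAt_sqrtM v)).congr_deriv (by ring)).const_mul _)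

theorem polyGrowth (H : EnergyData m ε δ J Iz dens D Q t) {k i j l : ℕ} (h : k + i + j ≤ 3)
    (hl : l ≤ m) (x : ℝ) {z : ℝ} (hz : z ∈ Iz) : PolyGrowth fun v => D k i j l t x v z :=
  H.sys.famD.polyGrowth h hl H.mem x hz

theorem integral_nonMass_mul_sqrtM (H : EnergyData m ε δ J Iz dens D Q t) (hi : i ≤ 1)
    (hl : l ≤ m) (x : ℝ) {z : ℝ} (hz : z ∈ Iz) :
    ∫ v, nonMass D i l t x v z * sqrtM v = 0 := by
  have h1 := rapid_sqrtM.hasInt (H.polyGrowth (k := 0) (i := i) (j := 0) (by omega) hl x hz)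
  have h2 : HasInt (fun v => sqrtM v ^ 2) 1 := ⟨memLp_sqrtM.integrable_sq, integral_sqrtM_sq⟩
  have h := (h1.sub (h2.const_mul (sig D i l t x z))).congr
    (g := fun v => nonMass D i l t x v z * sqrtM v) (fun v => by unfold nonMass; ring)
  rw [h.2]
  unfold sig moment
  ring

theorem integral_microPart_mul_sqrtM (H : EnergyData m ε δ J Iz dens D Q t) (hi : i ≤ 1)
    (hl : l ≤ m) (x : ℝ) {z : ℝ} (hz : z ∈ Iz) :
    ∫ v, microPart D i l t x v z * sqrtM v = 0 := by
  have h1 := rapid_sqrtM.hasInt (H.polyGrowth (k := 0) (i := i) (j := 0) (by omega) hl x hz)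
  have h2 : HasInt (fun v => sqrtM v ^ 2) 1 := ⟨memLp_sqrtM.integrable_sq, integral_sqrtM_sq⟩
  have h3 : HasInt (fun v => v * maxwellian v) 0 :=
    ⟨rapid_maxwellian.mul_id.integrable', integral_id_mul_maxwellian⟩
  have h := ((h1.sub (h2.const_mul (sig D i l t x z))).sub (h3.const_mul (cur D i l t x z))).congr
    (g := fun v => microPart D i l t x v z * sqrtM v)
    (fun v => by rw [← sqrtM_mul_self]; unfold microPart; ring)
  rw [h.2]
  unfold sig moment
  ring

/-- The stress is `σ` plus a moment of the microscopic part. -/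
theorem press_eq_sig_add (H : EnergyData m ε δ J Iz dens D Q t) (hi : i ≤ 1)
    (hl : l ≤ m) (x : ℝ) {z : ℝ} (hz : z ∈ Iz) :
    press D i l t x z = sig D i l t x z
      + ∫ v, (v * microPart D i l t x v z) * (v * sqrtM v) := by
  have h1 := rapid_id_mul_sqrtM.mul_id.hasInt
    (H.polyGrowth (k := 0) (i := i) (j := 0) (by omega) hl x hz)
  have h2 : HasInt (fun v => v * (v * maxwellian v)) 1 :=
    ⟨rapid_maxwellian.mul_id.mul_id.integrable', integral_sq_mul_maxwellian⟩
  have h3 : HasInt (fun v => v * (v * (v * maxwellian v))) 0 :=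
    ⟨rapid_maxwellian.mul_id.mul_id.mul_id.integrable', integral_cube_mul_maxwellian⟩
  have h := ((h1.sub (h2.const_mul (sig D i l t x z))).sub (h3.const_mul (cur D i l t x z))).congr
    (g := fun v => (v * microPart D i l t x v z) * (v * sqrtM v))
    (fun v => by rw [← sqrtM_mul_self]; unfold microPart; ring)
  rw [h.2]
  unfold press moment
  ring

/-- The adjoint of `∂_v + v/2` sends `√M` to `v√M`, so the `√M` component of `(∂_v + v/2) h` is
exactly `u`, which `microAnnih` subtracts. -/
theorem integral_microAnnih_mul_sqrtM (H : EnergyData m ε δ J Iz dens D Q t) (hi : i ≤ 1)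
    (hl : l ≤ m) (x : ℝ) {z : ℝ} (hz : z ∈ Iz) :
    ∫ v, microAnnih D i l t x v z * sqrtM v = 0 := by
  have p0 := H.polyGrowth (k := 0) (i := i) (j := 0) (by omega) hl x hz
  have p1 := H.polyGrowth (k := 0) (i := i) (j := 1) (by omega) hl x hz
  have h1 := rapid_sqrtM.hasInt p1
  have h1' := (rapid_id_mul_sqrtM.hasInt p0).const_mul (1 / 2)
  have h2 : HasInt (fun v => sqrtM v ^ 2) 1 := ⟨memLp_sqrtM.integrable_sq, integral_sqrtM_sq⟩
  have h := ((h1.add h1').sub (h2.const_mul (cur D i l t x z))).congr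
    (g := fun v => microAnnih D i l t x v z * sqrtM v)
    (fun v => by unfold microAnnih annih; ring)
  rw [h.2, integral_deriv_mul_sqrtM p0 p1
    (fun v => (H.sys.famD.deriv 0 i 0 l (by omega) hl t H.mem x v z hz).2.2)]
  unfold cur moment
  ring

theorem chain_field (H : EnergyData m ε δ J Iz dens D Q t) :
    Chain Iz m fun j k x z => field Q j k t x z where
  cont j hj k hk := H.sys.famQ.continuousOn_xz (by omega) hk H.mem 0
  dx k hk x z hz := H.sys.famQ.hasDerivAt_field_x (by omega) hk H.mem x hz
  dz j hj k hk x z hz := H.sys.famQ.hasDerivAt_field_z (by omega) hk H.mem x hz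

theorem chain_sig_tensor (H : EnergyData m ε δ J Iz dens D Q t) (v : ℝ) :
    Chain Iz m fun j k x z => sig D j k t x z * sqrtM v where
  cont j hj k hk := (H.sys.famD.continuousOn_moment H.sys.openIz rapid_sqrtM (by omega) hk
    H.mem).mul continuousOn_const
  dx k hk x z hz := (H.sys.famD.hasDerivAt_moment_x rapid_sqrtM (by omega) hk H.mem x hz).mul_const _
  dz j hj k hk x z hz :=
    (H.sys.famD.hasDerivAt_moment_z H.sys.openIz rapid_sqrtM (by omega) hk H.mem x hz).mul_const _

theorem chain_h (H : EnergyData m ε δ J Iz dens D Q t) (v : ℝ) :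
    Chain Iz m fun j k x z => D 0 j 0 k t x v z where
  cont j hj k hk := H.sys.famD.continuousOn_xz (by omega) hk H.mem v
  dx k hk x z hz := (H.sys.famD.deriv 0 0 0 k (by omega) hk t H.mem x v z hz).2.1
  dz j hj k hk x z hz := H.sys.famD.deriv_z 0 j 0 k (by omega) hk t H.mem x v z hz

theorem chain_nonMass (H : EnergyData m ε δ J Iz dens D Q t) (v : ℝ) :
    Chain Iz m fun j k x z => nonMass D j k t x v z where
  cont j hj k hk := ((H.chain_h v).cont j hj k hk).sub ((H.chain_sig_tensor v).cont j hj k hk)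
  dx k hk x z hz := ((H.chain_h v).dx k hk x z hz).fun_sub ((H.chain_sig_tensor v).dx k hk x z hz)
  dz j hj k hk x z hz :=
    ((H.chain_h v).dz j hj k hk x z hz).fun_sub ((H.chain_sig_tensor v).dz j hj k hk x z hz)

/-! ### Quadratic products with the field, and orthogonal splittings of the dissipation. -/

variable {C₁ : ℝ} {j j' k k' : ℕ}

theorem memLp_field_mul_h (H : EnergyData m ε δ J Iz dens D Q t)
    (hC : IsSobolevConst Iz dens C₁) (hj : j + j' ≤ 1) (hk : k + k' ≤ m) :
    MemLp (fun q : (ℝ × ℝ) × ℝ => field Q j k t q.1.1 q.1.2 * D 0 j' 0 k' t q.1.1 q.2 q.1.2) 2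
      (xzvMeasure Iz dens) :=
  memLp_product H.order H.density hC H.chain_field H.memLp_field H.chain_h H.memLp_h hj hk

theorem memLp_field_mul_sig (H : EnergyData m ε δ J Iz dens D Q t)
    (hC : IsSobolevConst Iz dens C₁) (hj : j + j' ≤ 1) (hk : k + k' ≤ m) :
    MemLp (fun q : (ℝ × ℝ) × ℝ => field Q j k t q.1.1 q.1.2
      * (sig D j' k' t q.1.1 q.1.2 * sqrtM q.2)) 2 (xzvMeasure Iz dens) :=
  memLp_product H.order H.density hC H.chain_field H.memLp_field
    (G := fun j k x v z => sig D j k t x z * sqrtM v) H.chain_sig_tensor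
    (fun _ hj _ hk => H.memLp_sig_tensor hj hk memLp_sqrtM) hj hk

theorem memLp_field_mul_nonMass (H : EnergyData m ε δ J Iz dens D Q t)
    (hC : IsSobolevConst Iz dens C₁) (hj : j + j' ≤ 1) (hk : k + k' ≤ m) :
    MemLp (fun q : (ℝ × ℝ) × ℝ => field Q j k t q.1.1 q.1.2 * nonMass D j' k' t q.1.1 q.2 q.1.2) 2
      (xzvMeasure Iz dens) :=
  memLp_product H.order H.density hC H.chain_field H.memLp_field H.chain_nonMass
    (fun _ hj _ hk => H.memLp_nonMass hj hk) hj hk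

/-- Splitting of the trilinear term along `h = σ √M + (h - σ √M)`. -/
theorem integral_trilinear_split (H : EnergyData m ε δ J Iz dens D Q t)
    (hC : IsSobolevConst Iz dens C₁) (hj : j + j' ≤ 1) (hk : k + k' ≤ m) (hi : i ≤ 1)
    (hl : l ≤ m) :
    ∫ q, (field Q j k t q.1.1 q.1.2 * D 0 j' 0 k' t q.1.1 q.2 q.1.2)
        * annih D i l t q.1.1 q.2 q.1.2 ∂(xzvMeasure Iz dens)
      = (∫ q, (field Q j k t q.1.1 q.1.2 * (sig D j' k' t q.1.1 q.1.2 * sqrtM q.2))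
          * (cur D i l t q.1.1 q.1.2 * sqrtM q.2) ∂(xzvMeasure Iz dens))
        + ∫ q, (field Q j k t q.1.1 q.1.2 * nonMass D j' k' t q.1.1 q.2 q.1.2)
          * microAnnih D i l t q.1.1 q.2 q.1.2 ∂(xzvMeasure Iz dens) := by
  have := H.density.prob
  have mS := H.memLp_field_mul_sig hC hj hk
  have mN := H.memLp_field_mul_nonMass hC hj hk
  have mU := H.memLp_cur_tensor hi hl memLp_sqrtM
  have mA := H.memLp_microAnnih hi hl
  have h1 := hasInt_mul mS mU
  have h2 := hasInt_mul mN mA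
  have h3 := hasInt_mul mS mA
  have h4 := hasInt_mul mN mU
  -- The first factor is `√M` times a function of `(x, z)`, and the second has zero `√M` moment at
  -- almost every `(x, z)`.
  have z3 : ∫ q, (field Q j k t q.1.1 q.1.2 * (sig D j' k' t q.1.1 q.1.2 * sqrtM q.2))
      * microAnnih D i l t q.1.1 q.2 q.1.2 ∂(xzvMeasure Iz dens) = 0 := by
    have e := integral_tensor_mul (Φ := fun x z => field Q j k t x z * sig D j' k' t x z)
      (ψ := sqrtM) (K := microAnnih D i l t)
      (h3.1.congr (Eventually.of_forall fun q => by ring))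
    simp only [← mul_assoc] at e ⊢
    rw [e]
    refine integral_eq_zero_of_ae ?_
    filter_upwards [H.density.xz_ae_mem] with p hp
    rw [H.integral_microAnnih_mul_sqrtM hi hl p.1 hp]
    simp
  -- The same cancellation with the roles exchanged: here `h - σ√M` has no mass.
  have z4 : ∫ q, (field Q j k t q.1.1 q.1.2 * nonMass D j' k' t q.1.1 q.2 q.1.2)
      * (cur D i l t q.1.1 q.1.2 * sqrtM q.2) ∂(xzvMeasure Iz dens) = 0 := by
    have e := integral_tensor_mul (Φ := fun x z => field Q j k t x z * cur D i l t x z)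
      (ψ := sqrtM) (K := nonMass D j' k' t)
      (h4.1.congr (Eventually.of_forall fun q => by ring))
    have e2 : ∀ q : (ℝ × ℝ) × ℝ, (field Q j k t q.1.1 q.1.2 * nonMass D j' k' t q.1.1 q.2 q.1.2)
      * (cur D i l t q.1.1 q.1.2 * sqrtM q.2) = (field Q j k t q.1.1 q.1.2
        * cur D i l t q.1.1 q.1.2 * sqrtM q.2) * nonMass D j' k' t q.1.1 q.2 q.1.2 :=
      fun q => by ring
    simp only [e2]
    rw [e]
    refine integral_eq_zero_of_ae ?_
    filter_upwards [H.density.xz_ae_mem] with p hp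
    rw [H.integral_nonMass_mul_sqrtM (by omega) (by omega) p.1 hp]
    simp
  have hs := ((h1.add h2).add (h3.add h4)).congr
    (g := fun q => (field Q j k t q.1.1 q.1.2 * D 0 j' 0 k' t q.1.1 q.2 q.1.2)
        * annih D i l t q.1.1 q.2 q.1.2) (fun q => by unfold nonMass microAnnih; ring)
  rw [hs.2, z3, z4]
  ring

/-- Orthogonal decomposition of the Fokker-Planck dissipation. -/
theorem integral_annih_sq (H : EnergyData m ε δ J Iz dens D Q t) (hi : i ≤ 1) (hl : l ≤ m) :
    ∫ q, annih D i l t q.1.1 q.2 q.1.2 ^ 2 ∂(xzvMeasure Iz dens)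
      = (∫ q, microAnnih D i l t q.1.1 q.2 q.1.2 ^ 2 ∂(xzvMeasure Iz dens))
        + ∫ p, cur D i l t p.1 p.2 ^ 2 ∂(xzMeasure Iz dens) := by
  have := H.density.prob
  have mU := H.memLp_cur_tensor hi hl memLp_sqrtM
  have mA := H.memLp_microAnnih hi hl
  have h1 := hasInt_sq mA
  have h2 := hasInt_mul mU mU
  have h3 := hasInt_mul mU mA
  have z3 : ∫ q, (cur D i l t q.1.1 q.1.2 * sqrtM q.2)
      * microAnnih D i l t q.1.1 q.2 q.1.2 ∂(xzvMeasure Iz dens) = 0 := by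
    rw [integral_tensor_mul (ψ := sqrtM) (K := microAnnih D i l t) h3.1]
    refine integral_eq_zero_of_ae ?_
    filter_upwards [H.density.xz_ae_mem] with p hp
    rw [H.integral_microAnnih_mul_sqrtM hi hl p.1 hp]
    simp
  have hs := ((h1.add h2).add (h3.const_mul 2)).congr
    (g := fun q => annih D i l t q.1.1 q.2 q.1.2 ^ 2) (fun q => by unfold microAnnih; ring)
  rw [hs.2, z3, integral_tensor_mul_tensor integral_sqrtM_sq]
  simp only [← sq]
  ring

/-- `‖∂_x^i ∂_z^l (1 - Π) h‖²_ν`. -/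
def nuSq (Iz : Set ℝ) (dens : ℝ → ℝ) (D : ℕ → ℕ → ℕ → ℕ → ℝ → ℝ → ℝ → ℝ → ℝ) (i l : ℕ) (t : ℝ) :
    ℝ :=
  ∫ q : (ℝ × ℝ) × ℝ, ((1 + q.2 ^ 2) * microPart D i l t q.1.1 q.2 q.1.2 ^ 2
    + microDv D i l t q.1.1 q.2 q.1.2 ^ 2) ∂(xzvMeasure Iz dens)

theorem hasInt_nuSq (H : EnergyData m ε δ J Iz dens D Q t) (hi : i ≤ 1) (hl : l ≤ m) :
    HasInt (fun q : (ℝ × ℝ) × ℝ => (1 + q.2 ^ 2) * microPart D i l t q.1.1 q.2 q.1.2 ^ 2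
      + microDv D i l t q.1.1 q.2 q.1.2 ^ 2) (nuSq Iz dens D i l t) (xzvMeasure Iz dens) := by
  refine ⟨?_, rfl⟩
  exact (((H.memLp_microPart hi hl).integrable_sq.add (H.memLp_v_microPart hi hl).integrable_sq).add
    (H.memLp_microDv hi hl).integrable_sq).congr (Eventually.of_forall fun q => by
      simp only [Pi.add_apply]; ring)

/-- The one-dimensional coercivity is applied on the velocity line above almost every `(x, z)`; by
Fubini almost every such line carries the required square integrability. -/
theorem lambda0_mul_nuSq_le (H : EnergyData m ε δ J Iz dens D Q t) (hi : i ≤ 1) (hl : l ≤ m) :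
    lambda0 * nuSq Iz dens D i l t
      ≤ ∫ q, microAnnih D i l t q.1.1 q.2 q.1.2 ^ 2 ∂(xzvMeasure Iz dens) := by
  have := H.density.prob
  have n1 := (H.hasInt_nuSq hi hl).1
  have n2 := (H.memLp_microAnnih hi hl).integrable_sq
  have s1 := (H.memLp_microPart hi hl).integrable_sq
  have s2 := (H.memLp_v_microPart hi hl).integrable_sq
  have s3 := (H.memLp_microDv hi hl).integrable_sq
  unfold nuSq
  unfold xzvMeasure at n1 n2 s1 s2 s3 ⊢
  rw [integral_prod _ n1, integral_prod _ n2, ← integral_const_mul]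
  refine integral_mono_ae (n1.integral_prod_left.const_mul _) n2.integral_prod_left ?_
  filter_upwards [H.density.xz_ae_mem, s1.prod_right_ae, s2.prod_right_ae, s3.prod_right_ae]
    with p hp a1 a2 a3
  have hd := fun v => H.hasDerivAt_microPart hi hl p.1 v hp
  have c0 : Continuous fun v => microPart D i l t p.1 v p.2 :=
    continuous_iff_continuousAt.2 fun v => (hd v).continuousAt
  have c1 : Continuous fun v => microDv D i l t p.1 v p.2 := by
    have := (H.polyGrowth (k := 0) (i := i) (j := 1) (by omega) hl p.1 hp).cont
    have := continuous_sqrtM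
    unfold microDv
    fun_prop
  have := lambda0_mul_integral_le hd c1
    ((memLp_two_iff_integrable_sq c0.aestronglyMeasurable).2 a1)
    ((memLp_two_iff_integrable_sq (continuous_id'.mul c0).aestronglyMeasurable).2 a2)
    ((memLp_two_iff_integrable_sq c1.aestronglyMeasurable).2 a3)
    (H.integral_microPart_mul_sqrtM hi hl p.1 hp)
  simpa only [microAnnih_eq] using this

theorem integral_microAnnih_sq_le (H : EnergyData m ε δ J Iz dens D Q t) (hi : i ≤ 1)
    (hl : l ≤ m) : ∫ q, microAnnih D i l t q.1.1 q.2 q.1.2 ^ 2 ∂(xzvMeasure Iz dens)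
      ≤ 2 * nuSq Iz dens D i l t := by
  have h := (H.hasInt_nuSq hi hl).const_mul 2
  rw [← h.2]
  refine integral_mono (H.memLp_microAnnih hi hl).integrable_sq h.1 fun q => ?_
  simp only [microAnnih_eq]
  nlinarith [sq_nonneg (microDv D i l t q.1.1 q.2 q.1.2
    - q.2 / 2 * microPart D i l t q.1.1 q.2 q.1.2),
    sq_nonneg (microPart D i l t q.1.1 q.2 q.1.2),
    sq_nonneg (q.2 * microPart D i l t q.1.1 q.2 q.1.2)]

/-- `h - σ√M` is `(1-Π)h + u v√M`, and `v√M` is a unit vector. The quadratic error is thus paid for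
by dissipated quantities rather than by the full energy of `h`. -/
theorem integral_nonMass_sq_le (H : EnergyData m ε δ J Iz dens D Q t) (hi : i ≤ 1)
    (hl : l ≤ m) : ∫ q, nonMass D i l t q.1.1 q.2 q.1.2 ^ 2 ∂(xzvMeasure Iz dens)
      ≤ 2 * (∫ p, cur D i l t p.1 p.2 ^ 2 ∂(xzMeasure Iz dens)) + 2 * nuSq Iz dens D i l t := by
  have := H.density.prob
  have mU := H.memLp_cur_tensor hi hl memLp_id_mul_sqrtM
  have h1 := (hasInt_mul mU mU).const_mul 2
  rw [integral_tensor_mul_tensor integral_id_mul_sqrtM_sq] at h1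
  simp only [← sq] at h1
  have h := h1.add ((H.hasInt_nuSq hi hl).const_mul 2)
  rw [← h.2]
  refine integral_mono (H.memLp_nonMass hi hl).integrable_sq h.1 fun q => ?_
  have e : nonMass D i l t q.1.1 q.2 q.1.2 = microPart D i l t q.1.1 q.2 q.1.2
      + cur D i l t q.1.1 q.1.2 * (q.2 * sqrtM q.2) := by unfold nonMass microPart; ring
  simp only [e]
  nlinarith [sq_nonneg (microPart D i l t q.1.1 q.2 q.1.2
      - cur D i l t q.1.1 q.1.2 * (q.2 * sqrtM q.2)), sq_nonneg (microDv D i l t q.1.1 q.2 q.1.2),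
      sq_nonneg (q.2 * microPart D i l t q.1.1 q.2 q.1.2)]

/-- With `P = σ + q` one has `Pσ ≥ σ²/2 - q²/2`, because the difference is `(σ + q)²/2`. Here `q` is
the moment of `v (1-Π)h` against the unit vector `v√M`, so `‖q‖²` is at most the `ν`-norm squared.
-/
theorem abs_integral_press_sub_mul_sig_le (H : EnergyData m ε δ J Iz dens D Q t) (hi : i ≤ 1)
    (hl : l ≤ m) :
    (1 / 2 * ∫ p, sig D i l t p.1 p.2 ^ 2 ∂(xzMeasure Iz dens)) - 1 / 2 * nuSq Iz dens D i l t
      ≤ ∫ p, press D i l t p.1 p.2 * sig D i l t p.1 p.2 ∂(xzMeasure Iz dens) := by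
  have := H.density.prob
  have hq := memLp_moment (K := fun x v z => v * microPart D i l t x v z)
    (H.memLp_v_microPart hi hl) memLp_id_mul_sqrtM integral_id_mul_sqrtM_sq
  have hq2 := integral_sq_moment_le (K := fun x v z => v * microPart D i l t x v z)
    (H.memLp_v_microPart hi hl) memLp_id_mul_sqrtM integral_id_mul_sqrtM_sq
  have hn := H.hasInt_nuSq hi hl
  have hv : ∫ q : (ℝ × ℝ) × ℝ, (q.2 * microPart D i l t q.1.1 q.2 q.1.2) ^ 2
      ∂(xzvMeasure Iz dens) ≤ nuSq Iz dens D i l t := by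
    rw [← hn.2]
    refine integral_mono (H.memLp_v_microPart hi hl).integrable_sq hn.1 fun q => ?_
    nlinarith [sq_nonneg (microPart D i l t q.1.1 q.2 q.1.2),
      sq_nonneg (microDv D i l t q.1.1 q.2 q.1.2)]
  have h1 := (hasInt_sq (H.memLp_sig hi hl)).const_mul (1 / 2)
  have h2 := (hasInt_sq hq).const_mul (1 / 2)
  have h3 := h1.sub h2
  refine le_trans ?_ (le_trans h3.2.ge ?_)
  · linarith
  · refine integral_mono_ae h3.1 (integrable_mul_of_memLp (H.memLp_press hi hl)
      (H.memLp_sig hi hl)) ?_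
    filter_upwards [H.density.xz_ae_mem] with p hp
    rw [H.press_eq_sig_add hi hl p.1 hp]
    nlinarith [sq_nonneg (sig D i l t p.1 p.2
      + ∫ v, (v * microPart D i l t p.1 v p.2) * (v * sqrtM v))]

end EnergyData

/-! ### Energy identities -/

section ConvIntegral

variable {α : Type*} [MeasurableSpace α] {μ : Measure α}

theorem memLp_conv {E G : ℕ → ℕ → α → ℝ} {i l : ℕ}
    (h : ∀ a ∈ Finset.HasAntidiagonal.antidiagonal i, ∀ b ∈ Finset.HasAntidiagonal.antidiagonal l,
      MemLp (fun q => E a.1 b.1 q * G a.2 b.2 q) 2 μ) :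
    MemLp (fun q => conv (fun a b => E a b q) (fun a b => G a b q) i l) 2 μ := by
  unfold conv
  exact memLp_finsetSum _ fun a ha => memLp_finsetSum _ fun b hb => (h a ha b hb).const_mul _

theorem hasInt_conv_mul {E G : ℕ → ℕ → α → ℝ} {W : α → ℝ} {i l : ℕ}
    (h : ∀ a ∈ Finset.HasAntidiagonal.antidiagonal i, ∀ b ∈ Finset.HasAntidiagonal.antidiagonal l,
      MemLp (fun q => E a.1 b.1 q * G a.2 b.2 q) 2 μ) (hW : MemLp W 2 μ) :
    HasInt (fun q => conv (fun a b => E a b q) (fun a b => G a b q) i l * W q)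
      (∑ a ∈ Finset.HasAntidiagonal.antidiagonal i, ∑ b ∈ Finset.HasAntidiagonal.antidiagonal l,
        ((i.choose a.1 : ℝ) * (l.choose b.1 : ℝ)) *
          ∫ q, (E a.1 b.1 q * G a.2 b.2 q) * W q ∂μ) μ := by
  refine (HasInt.sum fun a ha => HasInt.sum fun b hb =>
    (hasInt_mul (h a ha b hb) hW).const_mul
      ((i.choose a.1 : ℝ) * (l.choose b.1 : ℝ))).congr fun q => ?_
  unfold conv
  simp only [Finset.sum_mul, mul_assoc]

end ConvIntegral

namespace EnergyData

variable {m : ℕ} {ε δ : ℝ} {J Iz : Set ℝ} {dens : ℝ → ℝ}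
  {D Q : ℕ → ℕ → ℕ → ℕ → ℝ → ℝ → ℝ → ℝ → ℝ} {t : ℝ} {i l : ℕ} {C₁ : ℝ}

theorem antidiagonal_le {i l : ℕ} (hi : i ≤ 1) (hl : l ≤ m) {a b : ℕ × ℕ}
    (ha : a ∈ Finset.HasAntidiagonal.antidiagonal i)
    (hb : b ∈ Finset.HasAntidiagonal.antidiagonal l) : a.1 + a.2 ≤ 1 ∧ b.1 + b.2 ≤ m := by
  have ha' := Finset.HasAntidiagonal.mem_antidiagonal.1 ha
  have hb' := Finset.HasAntidiagonal.mem_antidiagonal.1 hb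
  omega

/-- Ampère's law `δ ∂_t ∂_x φ = u`. -/
theorem ampere (H : EnergyData m ε δ J Iz dens D Q t) (hε : ε ≠ 0) (hi : i ≤ 1) (hl : l ≤ m) :
    ∀ᵐ p ∂(xzMeasure Iz dens), δ * Q 1 (i + 1) 0 l t p.1 0 p.2 = cur D i l t p.1 p.2 := by
  have := H.density.prob
  rcases (show i = 1 ∨ i = 0 by omega) with rfl | rfl
  -- With one `x`-derivative, the law is the time-differentiated Poisson equation combined with
  -- conservation of mass.
  · filter_upwards [H.density.xz_ae_mem] with p hp
    have h1 := H.sys.poisson_deriv (k := 1) (i := 0) (by omega) hl H.mem p.1 hp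
    have h2 := H.sys.mass hε (i := 0) (by omega) hl H.mem p.1 hp
    simp only [add_zero, zero_add, Nat.reduceAdd] at h1 h2 ⊢
    unfold cur
    linear_combination δ * h1 - h2
  -- Without an `x`-derivative the difference is only known to be constant in `x`. For almost every
  -- `z` its square is integrable over the whole line, which forces the constant to be zero.
  · have hm := ((H.deriv_field 0 (by omega) l hl).memLp_deriv.const_mul δ).sub
      (H.memLp_cur (i := 0) (by omega) hl)
    have hs := hm.integrable_sq
    have hz : ∀ᵐ z ∂(zMeasure Iz dens), ∀ x, δ * Q 1 1 0 l t x 0 z = cur D 0 l t x z := by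
      unfold xzMeasure at hs
      filter_upwards [hs.prod_left_ae, H.density.ae_mem] with z h1 h2 x
      have hc : ∀ y, δ * Q 1 1 0 l t y 0 z - cur D 0 l t y z
          = δ * Q 1 1 0 l t x 0 z - cur D 0 l t x z := fun y => by
        unfold cur
        rw [H.sys.current_const hε hl H.mem y h2, H.sys.current_const hε hl H.mem x h2]
      have h3 : Integrable (fun _ : ℝ => (δ * Q 1 1 0 l t x 0 z - cur D 0 l t x z) ^ 2) :=
        h1.congr (Eventually.of_forall fun y => by simp only [Pi.sub_apply, zero_add, hc y])
      rcases integrable_const_iff.1 h3 with h | h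
      · exact sub_eq_zero.1 (pow_eq_zero_iff two_ne_zero |>.1 h)
      · have := h.1
        simp at this
    filter_upwards [Measure.quasiMeasurePreserving_snd.ae hz] with p hp using hp p.1

theorem integral_ampere_mul (H : EnergyData m ε δ J Iz dens D Q t) (hε : ε ≠ 0) (hi : i ≤ 1)
    (hl : l ≤ m) (f : ℝ × ℝ → ℝ) :
    δ * ∫ p, Q 1 (i + 1) 0 l t p.1 0 p.2 * f p ∂(xzMeasure Iz dens)
      = ∫ p, cur D i l t p.1 p.2 * f p ∂(xzMeasure Iz dens) := by
  rw [← integral_const_mul]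
  refine integral_congr_ae ?_
  filter_upwards [H.ampere hε hi hl] with p hp
  rw [← hp]; ring

theorem continuous_field (H : EnergyData m ε δ J Iz dens D Q t) {a b : ℕ} (ha : a ≤ 1)
    (hb : b ≤ m) {z : ℝ} (hz : z ∈ Iz) : Continuous fun x => field Q a b t x z :=
  (H.sys.famQ.continuous_xv (k := 0) (i := a + 1) (j := 0) (by omega) hb H.mem hz).comp
    (f := fun x : ℝ => (x, (0 : ℝ))) (by fun_prop)

theorem continuous_conv (H : EnergyData m ε δ J Iz dens D Q t) (hi : i ≤ 1) (hl : l ≤ m) {j : ℕ}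
    (hj : j ≤ 1) {z : ℝ} (hz : z ∈ Iz) : Continuous fun p : ℝ × ℝ =>
      conv (fun a b => field Q a b t p.1 z) (fun a b => D 0 a j b t p.1 p.2 z) i l := by
  unfold conv
  refine continuous_finsetSum _ fun a ha => continuous_finsetSum _ fun b hb => ?_
  have h := antidiagonal_le hi hl ha hb
  exact continuous_const.mul (((H.continuous_field (by omega) (by omega) hz).comp continuous_fst).mul
    (H.sys.famD.continuous_xv (by omega) (by omega) H.mem hz))

theorem hasDerivAt_conv_v (H : EnergyData m ε δ J Iz dens D Q t) (hi : i ≤ 1) (hl : l ≤ m)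
    (x v : ℝ) {z : ℝ} (hz : z ∈ Iz) :
    HasDerivAt (fun w => conv (fun a b => field Q a b t x z) (fun a b => D 0 a 0 b t x w z) i l)
      (conv (fun a b => field Q a b t x z) (fun a b => D 0 a 1 b t x v z) i l) v := by
  unfold conv
  refine HasDerivAt.fun_sum fun a ha => HasDerivAt.fun_sum fun b hb => ?_
  have h := antidiagonal_le hi hl ha hb
  exact (((H.sys.famD.deriv 0 a.2 0 b.2 (by omega) (by omega) t H.mem x v z hz).2.2).const_mul
    _).const_mul _

/-- Energy identity for `∂_x^i ∂_z^l h`. -/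
theorem kinetic_energy (H : EnergyData m ε δ J Iz dens D Q t) (hC : IsSobolevConst Iz dens C₁)
    (hi : i ≤ 1) (hl : l ≤ m) :
    ε * δ * (∫ q, D 1 i 0 l t q.1.1 q.2 q.1.2 * D 0 i 0 l t q.1.1 q.2 q.1.2
        ∂(xzvMeasure Iz dens))
      + δ * (∑ a ∈ Finset.HasAntidiagonal.antidiagonal i,
          ∑ b ∈ Finset.HasAntidiagonal.antidiagonal l, ((i.choose a.1 : ℝ) * (l.choose b.1 : ℝ)) *
          ∫ q, (field Q a.1 b.1 t q.1.1 q.1.2 * D 0 a.2 0 b.2 t q.1.1 q.2 q.1.2)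
            * annih D i l t q.1.1 q.2 q.1.2 ∂(xzvMeasure Iz dens))
      + δ * (∫ p, cur D i l t p.1 p.2 * field Q i l t p.1 p.2 ∂(xzMeasure Iz dens))
      + ∫ q, annih D i l t q.1.1 q.2 q.1.2 ^ 2 ∂(xzvMeasure Iz dens) = 0 := by
  have := H.density.prob
  have hprod : ∀ a ∈ Finset.HasAntidiagonal.antidiagonal i,
      ∀ b ∈ Finset.HasAntidiagonal.antidiagonal l, MemLp (fun q : (ℝ × ℝ) × ℝ =>
        field Q a.1 b.1 t q.1.1 q.1.2 * D 0 a.2 0 b.2 t q.1.1 q.2 q.1.2) 2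
        (xzvMeasure Iz dens) := fun a ha b hb =>
    H.memLp_field_mul_h hC (antidiagonal_le hi hl ha hb).1 (antidiagonal_le hi hl ha hb).2
  have mh := H.memLp_h i hi l hl
  have mvh := H.memLp_vh i hi l hl
  have mB := H.memLp_annih hi hl
  have mE : MemLp (fun q : (ℝ × ℝ) × ℝ => field Q i l t q.1.1 q.1.2 * (q.2 * sqrtM q.2)) 2
      (xzvMeasure Iz dens) := memLp_tensor (H.memLp_field i hi l hl) memLp_id_mul_sqrtM
  have i1 := (hasInt_mul (H.deriv_h i hi l hl).memLp_deriv mh).const_mul (ε * δ)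
  have i2 := (hasInt_conv_mul
    (E := fun a b (q : (ℝ × ℝ) × ℝ) => field Q a b t q.1.1 q.1.2)
    (G := fun a b q => D 0 a 0 b t q.1.1 q.2 q.1.2) hprod mB).const_mul δ
  have i3 := (hasInt_mul mE mh).const_mul δ
  have i4 := hasInt_sq mB
  have hR := ((i1.add i2).add i3).add i4
  rw [integral_tensor_mul (ψ := fun v => v * sqrtM v) (K := fun x v z => D 0 i 0 l t x v z)
    (hasInt_mul mE mh).1] at hR
  let c : ℝ → ℝ → ℝ → ℝ := fun x v z =>
    conv (fun a b => field Q a b t x z) (fun a b => D 0 a 0 b t x v z) i l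
  let c' : ℝ → ℝ → ℝ → ℝ := fun x v z =>
    conv (fun a b => field Q a b t x z) (fun a b => D 0 a 1 b t x v z) i l
  let h : ℝ → ℝ → ℝ → ℝ := D 0 i 0 l t
  -- The flux in `x` is that of transport. The flux in `v` collects the force, where `-c' h = -∂_v(c
  -- h) + c ∂_v h`, and the collisions, where `h 𝓛h = ∂_v(h a h) - (a h)²` with `a = ∂_v + v/2`.
  let F₁ : ℝ → ℝ → ℝ → ℝ := fun x v z => ε / 2 * ((v * h x v z) * h x v z)
  let F₁' : ℝ → ℝ → ℝ → ℝ := fun x v z => ε * (v * (h x v z * D 0 (i + 1) 0 l t x v z))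
  let F₂ : ℝ → ℝ → ℝ → ℝ := fun x v z => -(δ * (c x v z * h x v z)) - h x v z * annih D i l t x v z
  let F₂' : ℝ → ℝ → ℝ → ℝ := fun x v z =>
    -(δ * (c' x v z * h x v z + c x v z * D 0 i 1 l t x v z))
      - (D 0 i 1 l t x v z * annih D i l t x v z
        + h x v z * (D 0 i 2 l t x v z + (1 / 2 * h x v z + v / 2 * D 0 i 1 l t x v z)))
  have hD := H.sys.famD
  have hpt : ∀ x v, ∀ z ∈ Iz, F₁' x v z + F₂' x v z
      = (-1) * (ε * δ * (D 1 i 0 l t x v z * D 0 i 0 l t x v z)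
        + δ * (c x v z * annih D i l t x v z)
        + δ * ((field Q i l t x z * (v * sqrtM v)) * D 0 i 0 l t x v z)
        + annih D i l t x v z ^ 2) := by
    intro x v z hz
    have hr := H.sys.residual_eq_zero hi hl H.mem x v hz
    simp only [residual] at hr
    simp only [F₁', F₂', c, c', h, annih]
    linear_combination (D 0 i 0 l t x v z) * hr
  -- The individual second derivatives in the divergence need not be square integrable. The equation
  -- identifies the whole divergence with products of `L²` functions, and this is what makes it
  -- integrable.
  have hS := (hR.const_mul (-1)).congr_ae (g := fun q => F₁' q.1.1 q.2 q.1.2 + F₂' q.1.1 q.2 q.1.2)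
    (H.density.xzv_ae_mem.mono fun q hq => hpt q.1.1 q.2 q.1.2 hq)
  have k0 : ∀ z ∈ Iz, Continuous fun p : ℝ × ℝ => h p.1 p.2 z := fun z hz =>
    hD.continuous_xv (by omega) hl H.mem hz
  have kx : ∀ z ∈ Iz, Continuous fun p : ℝ × ℝ => D 0 (i + 1) 0 l t p.1 p.2 z := fun z hz =>
    hD.continuous_xv (by omega) hl H.mem hz
  have k1 : ∀ z ∈ Iz, Continuous fun p : ℝ × ℝ => D 0 i 1 l t p.1 p.2 z := fun z hz =>
    hD.continuous_xv (by omega) hl H.mem hz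
  have k2 : ∀ z ∈ Iz, Continuous fun p : ℝ × ℝ => D 0 i 2 l t p.1 p.2 z := fun z hz =>
    hD.continuous_xv (by omega) hl H.mem hz
  have kc : ∀ z ∈ Iz, Continuous fun p : ℝ × ℝ => c p.1 p.2 z := fun z hz =>
    H.continuous_conv hi hl (by omega) hz
  have kc' : ∀ z ∈ Iz, Continuous fun p : ℝ × ℝ => c' p.1 p.2 z := fun z hz =>
    H.continuous_conv hi hl (by omega) hz
  have kB : ∀ z ∈ Iz, Continuous fun p : ℝ × ℝ => annih D i l t p.1 p.2 z := fun z hz =>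
    (k1 z hz).add ((continuous_snd.div_const 2).mul (k0 z hz))
  have hdiv := integral_xvz_divergence_eq_zero (ν := zMeasure Iz dens) H.density.ae_mem
    (F₁ := F₁) (F₂ := F₂) (F₁' := F₁') (F₂' := F₂')
    (fun x v z hz => by
      have hd := (hD.deriv 0 i 0 l (by omega) hl t H.mem x v z hz).2.1
      exact (((hd.const_mul v).fun_mul hd).const_mul (ε / 2)).congr_deriv (by
        simp only [F₁', h]; ring))
    (fun x v z hz => by
      have hd := (hD.deriv 0 i 0 l (by omega) hl t H.mem x v z hz).2.2
      have hd1 := (hD.deriv 0 i 1 l (by omega) hl t H.mem x v z hz).2.2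
      exact (((H.hasDerivAt_conv_v hi hl x v hz).fun_mul hd).const_mul δ).fun_neg.fun_sub
        (hd.fun_mul (hd1.fun_add (((hasDerivAt_id' v).div_const 2).fun_mul hd))))
    (fun z hz => by
      have := k0 z hz
      simp only [F₁]; fun_prop)
    (fun z hz => by
      have := k0 z hz
      have := kc z hz
      have := kB z hz
      simp only [F₂]; fun_prop)
    (fun z hz => by
      have := k0 z hz
      have := kx z hz
      simp only [F₁']; fun_prop)
    (fun z hz => by
      have := k0 z hz
      have := k1 z hz
      have := k2 z hz
      have := kc z hz
      have := kc' z hz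
      have := kB z hz
      simp only [F₂']; fun_prop)
    (integrable_reorder_iff (F := F₁).1 ((integrable_mul_of_memLp mvh mh).const_mul _))
    (integrable_reorder_iff (F := F₂).1
      (((integrable_mul_of_memLp (memLp_conv
        (E := fun a b (q : (ℝ × ℝ) × ℝ) => field Q a b t q.1.1 q.1.2)
        (G := fun a b q => D 0 a 0 b t q.1.1 q.2 q.1.2) hprod) mh).const_mul δ).neg.sub
        (integrable_mul_of_memLp mh mB)))
    (integrable_reorder_iff (F := fun x v z => F₁' x v z + F₂' x v z).1 hS.1)
  have e2 := (integral_reorder (Iz := Iz) (dens := dens)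
    fun x v z => F₁' x v z + F₂' x v z).symm.trans hdiv
  rw [hS.2] at e2
  have e3 : ∫ p, field Q i l t p.1 p.2 * (∫ v, D 0 i 0 l t p.1 v p.2 * (v * sqrtM v))
      ∂(xzMeasure Iz dens)
      = ∫ p, cur D i l t p.1 p.2 * field Q i l t p.1 p.2 ∂(xzMeasure Iz dens) := by
    simp only [cur, moment, mul_comm (field _ _ _ _ _ _)]
  rw [e3] at e2
  linarith

/-- The current is differentiable in `L²`. -/
theorem deriv_cur (H : EnergyData m ε δ J Iz dens D Q t) (hi : i ≤ 1) (hl : l ≤ m) :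
    HasL2DerivAt (xzMeasure Iz dens) (fun s p => cur D i l s p.1 p.2)
      (fun p => moment D (fun v => v * sqrtM v) 1 i l t p.1 p.2) t := by
  have := H.density.prob
  refine HasL2DerivAt.moment (K := fun s x v z => D 0 i 0 l s x v z)
    (K' := fun x v z => D 1 i 0 l t x v z) (H.deriv_h i hi l hl) memLp_id_mul_sqrtM
    integral_id_mul_sqrtM_sq ?_ ?_
  · filter_upwards [H.sys.openJ.mem_nhds H.mem] with s hs
    filter_upwards [H.density.xz_ae_mem] with p hp
    exact H.sys.famD.integrable_mul rapid_id_mul_sqrtM (by omega) hl hs p.1 hp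
  · filter_upwards [H.density.xz_ae_mem] with p hp
    exact H.sys.famD.integrable_mul rapid_id_mul_sqrtM (by omega) hl H.mem p.1 hp

/-- The kinetic product estimate already covers `F σ √M`; taking its moment against `√M` returns `F
σ` and preserves square integrability. -/
theorem memLp_field_mul_sig_mac (H : EnergyData m ε δ J Iz dens D Q t)
    (hC : IsSobolevConst Iz dens C₁) {j j' k k' : ℕ} (hj : j + j' ≤ 1) (hk : k + k' ≤ m) :
    MemLp (fun p : ℝ × ℝ => field Q j k t p.1 p.2 * sig D j' k' t p.1 p.2) 2
      (xzMeasure Iz dens) := by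
  have := H.density.prob
  have h := memLp_moment (K := fun x v z => field Q j k t x z * (sig D j' k' t x z * sqrtM v))
    (H.memLp_field_mul_sig hC hj hk) memLp_sqrtM integral_sqrtM_sq
  refine h.ae_eq (Eventually.of_forall fun p => ?_)
  have e : ∀ v, field Q j k t p.1 p.2 * (sig D j' k' t p.1 p.2 * sqrtM v) * sqrtM v
      = (field Q j k t p.1 p.2 * sig D j' k' t p.1 p.2) * sqrtM v ^ 2 := fun v => by ring
  simp only [e]
  rw [integral_const_mul, integral_sqrtM_sq, mul_one]

/-- Momentum balance tested against the field. -/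
theorem integral_momentum_mul_field (H : EnergyData m ε δ J Iz dens D Q t)
    (hC : IsSobolevConst Iz dens C₁) (hi : i ≤ 1) (hl : l ≤ m) :
    ε * δ * (∫ p, moment D (fun v => v * sqrtM v) 1 i l t p.1 p.2 * field Q i l t p.1 p.2
        ∂(xzMeasure Iz dens))
      + ε * (∫ p, press D i l t p.1 p.2 * sig D i l t p.1 p.2 ∂(xzMeasure Iz dens))
      + δ * (∑ a ∈ Finset.HasAntidiagonal.antidiagonal i,
          ∑ b ∈ Finset.HasAntidiagonal.antidiagonal l, ((i.choose a.1 : ℝ) * (l.choose b.1 : ℝ)) *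
          ∫ p, (field Q a.1 b.1 t p.1 p.2 * sig D a.2 b.2 t p.1 p.2)
            * field Q i l t p.1 p.2 ∂(xzMeasure Iz dens))
      + δ * (∫ p, field Q i l t p.1 p.2 ^ 2 ∂(xzMeasure Iz dens))
      + ∫ p, cur D i l t p.1 p.2 * field Q i l t p.1 p.2 ∂(xzMeasure Iz dens) = 0 := by
  have := H.density.prob
  have mF := H.memLp_field i hi l hl
  have i1 := (hasInt_mul (H.deriv_cur hi hl).memLp_deriv mF).const_mul (ε * δ)
  have i2 := (hasInt_mul (H.memLp_press hi hl) (H.memLp_sig hi hl)).const_mul ε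
  have i3 := (hasInt_conv_mul (E := fun a b (p : ℝ × ℝ) => field Q a b t p.1 p.2)
    (G := fun a b p => sig D a b t p.1 p.2) (fun a ha b hb => H.memLp_field_mul_sig_mac hC
      (antidiagonal_le hi hl ha hb).1 (antidiagonal_le hi hl ha hb).2) mF).const_mul δ
  have i4 := (hasInt_sq mF).const_mul δ
  have i5 := hasInt_mul (H.memLp_cur hi hl) mF
  have hR := (((i1.add i2).add i3).add i4).add i5
  -- This is `-ε ∂_x(P F)`, using `∂_x F = -σ`. The derivative of `P` has order `i + 1`, not
  -- controlled in `L²` when `i = 1`; integrability of the total is read off from the momentum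
  -- balance.
  let F' : ℝ → ℝ → ℝ := fun x z => -(ε * (press D (i + 1) l t x z * field Q i l t x z
    - press D i l t x z * sig D i l t x z))
  have hS := hR.congr_ae (g := fun p => F' p.1 p.2) (by
    filter_upwards [H.density.xz_ae_mem] with p hp
    have hm := H.sys.momentum hi hl H.mem p.1 hp
    simp only [F', press, cur, sig]
    linear_combination (-field Q i l t p.1 p.2) * hm)
  have hz := integral_xz_deriv_eq_zero (ν := zMeasure Iz dens) H.density.ae_mem
    (F := fun x z => -(ε * (press D i l t x z * field Q i l t x z))) (F' := F')
    (fun x z hz => by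
      have h1 := H.sys.famD.hasDerivAt_moment_x (k := 0) (i := i) rapid_id_mul_sqrtM.mul_id
        (by omega) hl H.mem x hz
      have h2 := H.sys.famQ.hasDerivAt_field_x (a := i) (by omega) hl H.mem x hz
      have h3 : field Q (i + 1) l t x z = -sig D i l t x z := by
        have := H.sys.poisson_deriv (k := 0) (i := i) (by omega) hl H.mem x hz
        rw [show 2 + i = i + 1 + 1 by ring] at this
        unfold field sig
        linarith
      rw [h3] at h2
      exact ((h1.fun_mul h2).const_mul ε).fun_neg.congr_deriv (by
        simp only [F', press]; ring))
    ((integrable_mul_of_memLp (H.memLp_press hi hl) mF).const_mul ε).neg hS.1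
  rw [← hS.2]
  exact hz

/-- Time derivative of the mixed functional. -/
theorem hasDerivAt_cross (H : EnergyData m ε δ J Iz dens D Q t) (hε : ε ≠ 0) (hδ : δ ≠ 0)
    (hC : IsSobolevConst Iz dens C₁) (hi : i ≤ 1) (hl : l ≤ m) :
    HasDerivAt (fun s => (∫ p, cur D i l s p.1 p.2 * field Q i l s p.1 p.2 ∂(xzMeasure Iz dens))
        + 1 / (2 * ε) * ∫ p, field Q i l s p.1 p.2 ^ 2 ∂(xzMeasure Iz dens))
      (1 / δ * (∫ p, cur D i l t p.1 p.2 ^ 2 ∂(xzMeasure Iz dens))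
        - 1 / ε * (∫ p, field Q i l t p.1 p.2 ^ 2 ∂(xzMeasure Iz dens))
        - 1 / δ * (∫ p, press D i l t p.1 p.2 * sig D i l t p.1 p.2 ∂(xzMeasure Iz dens))
        - 1 / ε * (∑ a ∈ Finset.HasAntidiagonal.antidiagonal i,
          ∑ b ∈ Finset.HasAntidiagonal.antidiagonal l, ((i.choose a.1 : ℝ) * (l.choose b.1 : ℝ)) *
          ∫ q, (field Q a.1 b.1 t q.1.1 q.1.2 * (sig D a.2 b.2 t q.1.1 q.1.2 * sqrtM q.2))
            * (field Q i l t q.1.1 q.1.2 * sqrtM q.2) ∂(xzvMeasure Iz dens))) t := by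
  have := H.density.prob
  have hd := ((H.deriv_cur hi hl).hasDerivAt_integral_mul (H.deriv_field i hi l hl)).fun_add
    ((H.deriv_field i hi l hl).hasDerivAt_integral_sq.const_mul (1 / (2 * ε)))
  refine hd.congr_deriv ?_
  -- Ampère's law is used twice. Paired with `u`, it turns `⟨u, ∂_t F⟩` into `‖u‖²/δ`. Paired with
  -- `F`, it makes the friction term `⟨u, F⟩` cancel the derivative of `‖F‖²/(2ε)`.
  have e1 := H.integral_ampere_mul hε hi hl fun p => cur D i l t p.1 p.2
  have e2 := H.integral_ampere_mul hε hi hl fun p => field Q i l t p.1 p.2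
  have e3 := H.integral_momentum_mul_field hC hi hl
  have e4 : ∫ p, cur D i l t p.1 p.2 * Q 1 (i + 1) 0 l t p.1 0 p.2 ∂(xzMeasure Iz dens)
      = ∫ p, Q 1 (i + 1) 0 l t p.1 0 p.2 * cur D i l t p.1 p.2 ∂(xzMeasure Iz dens) := by
    simp only [mul_comm]
  -- Inserting `√M` in two factors does not change the integral, since `√M` has norm one; the
  -- kinetic trilinear estimate thereby applies to this macroscopic term.
  have e5 : ∀ a b : ℕ × ℕ,
      ∫ q, (field Q a.1 b.1 t q.1.1 q.1.2 * (sig D a.2 b.2 t q.1.1 q.1.2 * sqrtM q.2))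
        * (field Q i l t q.1.1 q.1.2 * sqrtM q.2) ∂(xzvMeasure Iz dens)
      = ∫ p, (field Q a.1 b.1 t p.1 p.2 * sig D a.2 b.2 t p.1 p.2)
            * field Q i l t p.1 p.2 ∂(xzMeasure Iz dens) := fun a b => by
    rw [← integral_tensor_mul_tensor
      (Φ := fun x z => field Q a.1 b.1 t x z * sig D a.2 b.2 t x z) (Φ' := field Q i l t)
      integral_sqrtM_sq]
    simp only [mul_assoc]
  simp only [e5, e4]
  simp only [← sq] at e1
  rw [← e1]
  rw [← e2] at e3
  field_simp
  linear_combination (1 : ℝ) * e3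

end EnergyData

/-! ### Energy inequalities -/

/-- Sum over the multi-indices `i ≤ 1`, `l ≤ m`. -/
def sumIndex (m : ℕ) (f : ℕ → ℕ → ℝ) : ℝ :=
  ∑ i ∈ Finset.range 2, ∑ l ∈ Finset.range (m + 1), f i l

section SumIndex

variable {m : ℕ} {f g : ℕ → ℕ → ℝ}

theorem sumIndex_le (h : ∀ i ≤ 1, ∀ l ≤ m, f i l ≤ g i l) : sumIndex m f ≤ sumIndex m g :=
  Finset.sum_le_sum fun i hi => Finset.sum_le_sum fun l hl =>
    h i (by have := Finset.mem_range.1 hi; omega) l (by have := Finset.mem_range.1 hl; omega)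

theorem sumIndex_congr (h : ∀ i ≤ 1, ∀ l ≤ m, f i l = g i l) : sumIndex m f = sumIndex m g :=
  Finset.sum_congr rfl fun i hi => Finset.sum_congr rfl fun l hl =>
    h i (by have := Finset.mem_range.1 hi; omega) l (by have := Finset.mem_range.1 hl; omega)

theorem sumIndex_nonneg (h : ∀ i ≤ 1, ∀ l ≤ m, 0 ≤ f i l) : 0 ≤ sumIndex m f :=
  Finset.sum_nonneg fun i hi => Finset.sum_nonneg fun l hl =>
    h i (by have := Finset.mem_range.1 hi; omega) l (by have := Finset.mem_range.1 hl; omega)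

theorem sumIndex_add (f g : ℕ → ℕ → ℝ) :
    sumIndex m (fun i l => f i l + g i l) = sumIndex m f + sumIndex m g := by
  simp only [sumIndex, Finset.sum_add_distrib]

theorem sumIndex_sub (f g : ℕ → ℕ → ℝ) :
    sumIndex m (fun i l => f i l - g i l) = sumIndex m f - sumIndex m g := by
  simp only [sumIndex, Finset.sum_sub_distrib]

theorem sumIndex_mul (c : ℝ) (f : ℕ → ℕ → ℝ) :
    sumIndex m (fun i l => c * f i l) = c * sumIndex m f := by
  simp only [sumIndex, Finset.mul_sum]

theorem hasDerivAt_sumIndex {f : ℕ → ℕ → ℝ → ℝ} {f' : ℕ → ℕ → ℝ} {t : ℝ}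
    (h : ∀ i ≤ 1, ∀ l ≤ m, HasDerivAt (f i l) (f' i l) t) :
    HasDerivAt (fun s => sumIndex m fun i l => f i l s) (sumIndex m f') t :=
  HasDerivAt.fun_sum fun i hi => HasDerivAt.fun_sum fun l hl =>
    h i (by have := Finset.mem_range.1 hi; omega) l (by have := Finset.mem_range.1 hl; omega)

end SumIndex

/-- Trilinear form summed over the derivatives of `(E G) W`. -/
def trilinear (Iz : Set ℝ) (dens : ℝ → ℝ) (E : ℕ → ℕ → ℝ → ℝ → ℝ) (G W : ℕ → ℕ → ℝ → ℝ → ℝ → ℝ)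
    (i l : ℕ) : ℝ :=
  ∑ a ∈ Finset.HasAntidiagonal.antidiagonal i, ∑ b ∈ Finset.HasAntidiagonal.antidiagonal l,
    ((i.choose a.1 : ℝ) * (l.choose b.1 : ℝ)) *
      ∫ q, (E a.1 b.1 q.1.1 q.1.2 * G a.2 b.2 q.1.1 q.2 q.1.2) * W i l q.1.1 q.2 q.1.2
        ∂(xzvMeasure Iz dens)

/-- Elementary consequence of a trilinear bound. -/
theorem micro_arith {ε δ a K Eh' Eφ Du' Dσ Dn B T₁ T₂ X : ℝ} (hε : 0 < ε) (hδ : 0 < δ) (ha : 0 < a)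
    (hK : 0 ≤ K) (hDu : 0 ≤ Du') (hDσ : 0 ≤ Dσ) (hDn : 0 ≤ Dn) (hEφ : 0 ≤ Eφ)
    (hX : 1 / 2 * X = -(1 / ε) * (T₁ + T₂) - 1 / (δ * ε) * (B + Du'))
    (hB : lambda0 * Dn ≤ B)
    (h1 : |T₁| ≤ 2 * K * (√Eφ * √Dσ * √Du'))
    (h2 : |T₂| ≤ 2 * K * (√Eφ * √(2 * Du' + 2 * Dn) * √(2 * Dn))) :
    1 / 2 * X + lambda0 / (δ * ε) * Dn + 1 / (δ * ε) * Du'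
      ≤ K / (a * ε) * √Eh' * (3 * Du' + 2 * Dn) + 2 * K / ε * √Eφ * ((4 + 1 / a) * Du' + 4 * Dn)
        + a * K / ε * √Eh' * Eφ + a * K / ε * √Eφ * Dσ := by
  -- Young's inequality with weight `a`; this is where the free parameter enters.
  have e1 : √Dσ * √Du' ≤ a / 2 * Dσ + 1 / (2 * a) * Du' := by
    have h := sq_nonneg (a * √Dσ - √Du')
    have s1 := Real.sq_sqrt hDσ
    have s2 := Real.sq_sqrt hDu
    have : a / 2 * Dσ + 1 / (2 * a) * Du' - √Dσ * √Du' = (a * √Dσ - √Du') ^ 2 / (2 * a) := by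
      rw [sub_sq, mul_pow, s1, s2]; field_simp; ring
    have : 0 ≤ (a * √Dσ - √Du') ^ 2 / (2 * a) := by positivity
    linarith
  have e2 : √(2 * Du' + 2 * Dn) * √(2 * Dn) ≤ Du' + 2 * Dn := by
    have h := sq_nonneg (√(2 * Du' + 2 * Dn) - √(2 * Dn))
    have s1 := Real.sq_sqrt (show 0 ≤ 2 * Du' + 2 * Dn by positivity)
    have s2 := Real.sq_sqrt (show 0 ≤ 2 * Dn by positivity)
    nlinarith
  have sE := Real.sqrt_nonneg Eφ
  have b1 : -T₁ ≤ 2 * K * √Eφ * (a / 2 * Dσ + 1 / (2 * a) * Du') :=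
    (neg_le_abs _).trans (h1.trans (by
      rw [mul_assoc √Eφ, ← mul_assoc]
      exact mul_le_mul_of_nonneg_left e1 (by positivity)))
  have b2 : -T₂ ≤ 2 * K * √Eφ * (Du' + 2 * Dn) :=
    (neg_le_abs _).trans (h2.trans (by
      rw [mul_assoc √Eφ, ← mul_assoc]
      exact mul_le_mul_of_nonneg_left e2 (by positivity)))
  have b3 : 1 / (δ * ε) * (lambda0 * Dn) ≤ 1 / (δ * ε) * B :=
    mul_le_mul_of_nonneg_left hB (by positivity)
  have b4 : 1 / ε * (-T₁ + -T₂) ≤ 1 / ε * (2 * K * √Eφ * (a / 2 * Dσ + 1 / (2 * a) * Du')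
      + 2 * K * √Eφ * (Du' + 2 * Dn)) :=
    mul_le_mul_of_nonneg_left (add_le_add b1 b2) (by positivity)
  -- The three nonnegative quantities `p1`, `p2`, `p3` are the slack between the bound obtained and
  -- the bound claimed, including all terms that contain `√Eh'`.
  have p1 : 0 ≤ K / (a * ε) * √Eh' * (3 * Du' + 2 * Dn) := by positivity
  have p2 : 0 ≤ a * K / ε * √Eh' * Eφ := by positivity
  have p3 : 0 ≤ K / ε * √Eφ * (6 * Du' + 4 * Dn + 1 / a * Du') := by positivity
  have q : 2 * K / ε * √Eφ * ((4 + 1 / a) * Du' + 4 * Dn) + a * K / ε * √Eφ * Dσ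
      = 1 / ε * (2 * K * √Eφ * (a / 2 * Dσ + 1 / (2 * a) * Du') + 2 * K * √Eφ * (Du' + 2 * Dn))
        + K / ε * √Eφ * (6 * Du' + 4 * Dn + 1 / a * Du') := by
    field_simp; ring
  have r : lambda0 / (δ * ε) * Dn = 1 / (δ * ε) * (lambda0 * Dn) := by ring
  rw [hX, r]
  linarith

/-- The lower bound on `P` yields half of the `σ` dissipation, at the price of half of the
microscopic one. The trilinear term needs only `2√Dσ √Eφ ≤ Dσ + Eφ`. -/
theorem macro_arith {ε δ K Eφ Du' Dσ Dn P T X : ℝ} (hε : 0 < ε) (hδ : 0 < δ)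
    (hK : 0 ≤ K) (hDσ : 0 ≤ Dσ) (hEφ : 0 ≤ Eφ)
    (hX : X = 1 / δ * Du' - 1 / ε * Eφ - 1 / δ * P - 1 / ε * T)
    (hP : 1 / 2 * Dσ - 1 / 2 * Dn ≤ P) (hT : |T| ≤ 2 * K * (√Eφ * √Dσ * √Eφ)) :
    X + 1 / (2 * δ) * Dσ + 1 / ε * Eφ
      ≤ 1 / δ * Du' + 1 / (2 * δ) * Dn + K / ε * √Eφ * (3 * Dσ + 2 * Eφ) := by
  have e1 : 2 * (√Dσ * √Eφ) ≤ 3 * Dσ + 2 * Eφ := by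
    nlinarith [sq_nonneg (√Dσ - √Eφ), Real.sq_sqrt hDσ, Real.sq_sqrt hEφ]
  have sE := Real.sqrt_nonneg Eφ
  have b1 : -T ≤ K * √Eφ * (3 * Dσ + 2 * Eφ) :=
    (neg_le_abs _).trans (hT.trans (by
      have := mul_le_mul_of_nonneg_left e1 (show 0 ≤ K * √Eφ by positivity)
      linarith))
  have b2 : 1 / ε * (-T) ≤ 1 / ε * (K * √Eφ * (3 * Dσ + 2 * Eφ)) :=
    mul_le_mul_of_nonneg_left b1 (by positivity)
  have b3 := mul_le_mul_of_nonneg_left hP (show 0 ≤ 1 / δ by positivity)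
  have r1 : 1 / δ * (1 / 2 * Dσ - 1 / 2 * Dn) = 1 / (2 * δ) * Dσ - 1 / (2 * δ) * Dn := by
    field_simp
  have r2 : K / ε * √Eφ * (3 * Dσ + 2 * Eφ) = 1 / ε * (K * √Eφ * (3 * Dσ + 2 * Eφ)) := by ring
  rw [hX, r2]
  linarith

theorem constA_nonneg (m : ℕ) : 0 ≤ constA m := by
  unfold constA; positivity

/-! ### Summation of the energy identities over all derivatives. -/

namespace EnergyData

variable {m : ℕ} {ε δ : ℝ} {J Iz : Set ℝ} {dens : ℝ → ℝ}
  {D Q : ℕ → ℕ → ℕ → ℕ → ℝ → ℝ → ℝ → ℝ → ℝ} {t : ℝ} {i l : ℕ} {C₁ : ℝ}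

theorem nuSq_nonneg : 0 ≤ nuSq Iz dens D i l t :=
  integral_nonneg fun _ => by positivity

/-- The trilinear estimate with the field as macroscopic factor, allowing the norms of the two
kinetic factors to be replaced by upper bounds such as the dissipations. -/
theorem abs_sumIndex_trilinear_le (H : EnergyData m ε δ J Iz dens D Q t)
    (hC : IsSobolevConst Iz dens C₁) {G W : ℕ → ℕ → ℝ → ℝ → ℝ → ℝ} {g w : ℝ}
    (hG : ∀ v, Chain Iz m fun j k x z => G j k x v z)
    (hG2 : ∀ j ≤ 1, ∀ k ≤ m,
      MemLp (fun q : (ℝ × ℝ) × ℝ => G j k q.1.1 q.2 q.1.2) 2 (xzvMeasure Iz dens))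
    (hW2 : ∀ j ≤ 1, ∀ k ≤ m,
      MemLp (fun q : (ℝ × ℝ) × ℝ => W j k q.1.1 q.2 q.1.2) 2 (xzvMeasure Iz dens))
    (hg : sumIndex m (fun i l => ∫ q, G i l q.1.1 q.2 q.1.2 ^ 2 ∂(xzvMeasure Iz dens)) ≤ g)
    (hw : sumIndex m (fun i l => ∫ q, W i l q.1.1 q.2 q.1.2 ^ 2 ∂(xzvMeasure Iz dens)) ≤ w) :
    |sumIndex m (trilinear Iz dens (fun a b => field Q a b t) G W)| ≤ 2 * (constA m * C₁ ^ 2) *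
      (√(sumIndex m fun i l => ∫ p, field Q i l t p.1 p.2 ^ 2 ∂(xzMeasure Iz dens)) * √g * √w) := by
  have := constA_nonneg m
  refine (abs_trilinear_le H.order H.density hC H.chain_field H.memLp_field hG hG2 hW2).trans ?_
  rw [mul_assoc 2 (constA m)]
  unfold sumIndex at *
  gcongr

theorem integral_sq_tensor (H : EnergyData m ε δ J Iz dens D Q t) (Φ : ℝ → ℝ → ℝ) :
    ∫ q : (ℝ × ℝ) × ℝ, (Φ q.1.1 q.1.2 * sqrtM q.2) ^ 2 ∂(xzvMeasure Iz dens)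
      = ∫ p : ℝ × ℝ, Φ p.1 p.2 ^ 2 ∂(xzMeasure Iz dens) := by
  have := H.density.prob
  simp only [sq]
  exact integral_tensor_mul_tensor integral_sqrtM_sq

/-- The microscopic energy inequality. -/
theorem micro_inequality (H : EnergyData m ε δ J Iz dens D Q t) (hε : 0 < ε) (hδ : 0 < δ)
    (hC : IsSobolevConst Iz dens C₁) :
    ∃ X, HasDerivAt (fun s => (sumIndex m fun i l => ∫ q, D 0 i 0 l s q.1.1 q.2 q.1.2 ^ 2
          ∂(xzvMeasure Iz dens))
        + δ / ε * sumIndex m fun i l => ∫ p, field Q i l s p.1 p.2 ^ 2 ∂(xzMeasure Iz dens)) X t ∧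
      ∀ a Eh', 0 < a →
      1 / 2 * X + lambda0 / (δ * ε) * (sumIndex m fun i l => nuSq Iz dens D i l t)
        + 1 / (δ * ε) * (sumIndex m fun i l => ∫ p, cur D i l t p.1 p.2 ^ 2 ∂(xzMeasure Iz dens))
      ≤ constA m * C₁ ^ 2 / (a * ε) * √Eh'
          * (3 * (sumIndex m fun i l => ∫ p, cur D i l t p.1 p.2 ^ 2 ∂(xzMeasure Iz dens))
            + 2 * sumIndex m fun i l => nuSq Iz dens D i l t)
        + 2 * (constA m * C₁ ^ 2) / ε
          * √(sumIndex m fun i l => ∫ p, field Q i l t p.1 p.2 ^ 2 ∂(xzMeasure Iz dens))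
          * ((4 + 1 / a)
              * (sumIndex m fun i l => ∫ p, cur D i l t p.1 p.2 ^ 2 ∂(xzMeasure Iz dens))
            + 4 * sumIndex m fun i l => nuSq Iz dens D i l t)
        + a * (constA m * C₁ ^ 2) / ε * √Eh'
          * (sumIndex m fun i l => ∫ p, field Q i l t p.1 p.2 ^ 2 ∂(xzMeasure Iz dens))
        + a * (constA m * C₁ ^ 2) / ε
          * √(sumIndex m fun i l => ∫ p, field Q i l t p.1 p.2 ^ 2 ∂(xzMeasure Iz dens))
          * (sumIndex m fun i l => ∫ p, sig D i l t p.1 p.2 ^ 2 ∂(xzMeasure Iz dens)) := by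
  have := H.density.prob
  have hsq : ∀ (f : ℕ → ℕ → ℝ × ℝ → ℝ), 0 ≤ sumIndex m fun i l =>
      ∫ p, f i l p ^ 2 ∂(xzMeasure Iz dens) :=
    fun f => sumIndex_nonneg fun i _ l _ => integral_nonneg fun _ => sq_nonneg _
  refine ⟨_, (hasDerivAt_sumIndex fun i hi l hl =>
    (H.deriv_h i hi l hl).hasDerivAt_integral_sq).fun_add ((hasDerivAt_sumIndex fun i hi l hl =>
    (H.deriv_field i hi l hl).hasDerivAt_integral_sq).const_mul (δ / ε)), fun a Eh' ha => ?_⟩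
  refine micro_arith hε hδ ha (mul_nonneg (constA_nonneg m) (sq_nonneg _)) (hsq _) (hsq _)
    (sumIndex_nonneg fun i _ l _ => nuSq_nonneg) (hsq _)
    (B := sumIndex m fun i l => ∫ q, microAnnih D i l t q.1.1 q.2 q.1.2 ^ 2 ∂(xzvMeasure Iz dens))
    (T₁ := sumIndex m (trilinear Iz dens (fun a b => field Q a b t)
      (fun j k x v z => sig D j k t x z * sqrtM v) (fun i l x v z => cur D i l t x z * sqrtM v)))
    (T₂ := sumIndex m (trilinear Iz dens (fun a b => field Q a b t)
      (fun j k => nonMass D j k t) (fun i l => microAnnih D i l t))) ?_ ?_ ?_ ?_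
  -- For each multi-index: the energy identity divided by `εδ`, with its dissipation and its
  -- trilinear term split, and with `⟨u, F⟩` cancelled by the derivative of the field energy through
  -- Ampère's law.
  · rw [mul_add, ← sumIndex_add, ← sumIndex_add, ← sumIndex_mul, ← sumIndex_mul, ← sumIndex_mul,
      ← sumIndex_mul, ← sumIndex_mul, ← sumIndex_add, ← sumIndex_sub]
    refine sumIndex_congr fun i hi l hl => ?_
    have k1 := H.kinetic_energy hC hi hl
    have k2 := H.integral_annih_sq hi hl
    have k3 := H.integral_ampere_mul hε.ne' hi hl fun p => field Q i l t p.1 p.2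
    have k4 : ∑ a ∈ Finset.HasAntidiagonal.antidiagonal i,
          ∑ b ∈ Finset.HasAntidiagonal.antidiagonal l, ((i.choose a.1 : ℝ) * (l.choose b.1 : ℝ)) *
          ∫ q, (field Q a.1 b.1 t q.1.1 q.1.2 * D 0 a.2 0 b.2 t q.1.1 q.2 q.1.2)
            * annih D i l t q.1.1 q.2 q.1.2 ∂(xzvMeasure Iz dens)
        = trilinear Iz dens (fun a b => field Q a b t)
          (fun j k x v z => sig D j k t x z * sqrtM v)
          (fun i l x v z => cur D i l t x z * sqrtM v) i l
        + trilinear Iz dens (fun a b => field Q a b t)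
          (fun j k => nonMass D j k t) (fun i l => microAnnih D i l t) i l := by
      unfold trilinear
      rw [← Finset.sum_add_distrib]
      refine Finset.sum_congr rfl fun a ha => ?_
      rw [← Finset.sum_add_distrib]
      refine Finset.sum_congr rfl fun b hb => ?_
      have h := antidiagonal_le hi hl ha hb
      rw [H.integral_trilinear_split hC h.1 h.2 hi hl, mul_add]
    rw [k4, k2, ← k3] at k1
    field_simp
    linear_combination k1
  · rw [← sumIndex_mul]
    exact sumIndex_le fun i hi l hl => H.lambda0_mul_nuSq_le hi hl
  · refine H.abs_sumIndex_trilinear_le hC H.chain_sig_tensor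
      (fun j hj k hk => H.memLp_sig_tensor hj hk memLp_sqrtM)
      (fun j hj k hk => H.memLp_cur_tensor hj hk memLp_sqrtM) ?_ ?_
    · simp only [H.integral_sq_tensor, le_refl]
    · simp only [H.integral_sq_tensor, le_refl]
  · refine H.abs_sumIndex_trilinear_le hC H.chain_nonMass (fun j hj k hk => H.memLp_nonMass hj hk)
      (fun j hj k hk => H.memLp_microAnnih hj hk) ?_ ?_
    · rw [← sumIndex_mul, ← sumIndex_mul, ← sumIndex_add]
      exact sumIndex_le fun i hi l hl => H.integral_nonMass_sq_le hi hl
    · rw [← sumIndex_mul]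
      exact sumIndex_le fun i hi l hl => H.integral_microAnnih_sq_le hi hl

/-- The macroscopic inequality. -/
theorem macro_inequality (H : EnergyData m ε δ J Iz dens D Q t) (hε : 0 < ε) (hδ : 0 < δ)
    (hC : IsSobolevConst Iz dens C₁) :
    ∃ X, HasDerivAt (fun s => (sumIndex m fun i l => ∫ p, cur D i l s p.1 p.2
          * field Q i l s p.1 p.2 ∂(xzMeasure Iz dens))
        + 1 / (2 * ε) * sumIndex m fun i l => ∫ p, field Q i l s p.1 p.2 ^ 2
          ∂(xzMeasure Iz dens)) X t ∧
      X + 1 / (2 * δ) * (sumIndex m fun i l => ∫ p, sig D i l t p.1 p.2 ^ 2 ∂(xzMeasure Iz dens))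
        + 1 / ε * (sumIndex m fun i l => ∫ p, field Q i l t p.1 p.2 ^ 2 ∂(xzMeasure Iz dens))
      ≤ 1 / δ * (sumIndex m fun i l => ∫ p, cur D i l t p.1 p.2 ^ 2 ∂(xzMeasure Iz dens))
        + 1 / (2 * δ) * (sumIndex m fun i l => nuSq Iz dens D i l t)
        + constA m * C₁ ^ 2 / ε
          * √(sumIndex m fun i l => ∫ p, field Q i l t p.1 p.2 ^ 2 ∂(xzMeasure Iz dens))
          * (3 * (sumIndex m fun i l => ∫ p, sig D i l t p.1 p.2 ^ 2 ∂(xzMeasure Iz dens))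
            + 2 * sumIndex m fun i l => ∫ p, field Q i l t p.1 p.2 ^ 2 ∂(xzMeasure Iz dens)) := by
  have := H.density.prob
  have hsq : ∀ (f : ℕ → ℕ → ℝ × ℝ → ℝ), 0 ≤ sumIndex m fun i l =>
      ∫ p, f i l p ^ 2 ∂(xzMeasure Iz dens) :=
    fun f => sumIndex_nonneg fun i _ l _ => integral_nonneg fun _ => sq_nonneg _
  have hd := hasDerivAt_sumIndex (m := m) fun i hi l hl =>
    H.hasDerivAt_cross hε.ne' hδ.ne' hC hi hl
  simp only [sumIndex_add, sumIndex_sub, sumIndex_mul] at hd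
  refine ⟨_, hd, ?_⟩
  refine macro_arith hε hδ (mul_nonneg (constA_nonneg m) (sq_nonneg _)) (hsq _) (hsq _)
    (T := sumIndex m (trilinear Iz dens (fun a b => field Q a b t)
      (fun j k x v z => sig D j k t x z * sqrtM v) (fun i l x v z => field Q i l t x z * sqrtM v)))
    rfl ?_ ?_
  · rw [← sumIndex_mul, ← sumIndex_mul, ← sumIndex_sub]
    exact sumIndex_le fun i hi l hl => H.abs_integral_press_sub_mul_sig_le hi hl
  · refine H.abs_sumIndex_trilinear_le hC H.chain_sig_tensor
      (W := fun i l x v z => field Q i l t x z * sqrtM v)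
      (fun j hj k hk => H.memLp_sig_tensor hj hk memLp_sqrtM)
      (fun j hj k hk => memLp_tensor (H.memLp_field j hj k hk) memLp_sqrtM) ?_ ?_
    · simp only [H.integral_sq_tensor, le_refl]
    · simp only [H.integral_sq_tensor, le_refl]

end EnergyData

/-! ### Families of derivatives of a solution -/

/-- `D` and `Q` are the families of derivatives of a solution `(h, φ)`. -/
structure Represents (m : ℕ) (ε δ : ℝ) (J Iz : Set ℝ) (h : ℝ → ℝ → ℝ → ℝ → ℝ)
    (φ : ℝ → ℝ → ℝ → ℝ) (D Q : ℕ → ℕ → ℕ → ℕ → ℝ → ℝ → ℝ → ℝ → ℝ) : Prop where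
  sys : System m ε δ J Iz D Q
  h_eq : h = D 0 0 0 0
  grad_eq : ∀ t ∈ J, ∀ x : ℝ, ∀ z ∈ Iz, gradPhi φ t x z = field Q 0 0 t x z

variable {m : ℕ} {ε δ : ℝ} {J Iz : Set ℝ} {dens : ℝ → ℝ} {h : ℝ → ℝ → ℝ → ℝ → ℝ}
    {φ : ℝ → ℝ → ℝ → ℝ} {D Q : ℕ → ℕ → ℕ → ℕ → ℝ → ℝ → ℝ → ℝ → ℝ}

/-- Iterated derivatives are traded for one family of mixed derivatives, in which the order of
differentiation plays no role and the operator `𝓛` appears in expanded form. -/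
theorem IsSolution.exists_represents (hsol : IsSolution m ε δ J Iz dens h φ) (hJ : IsOpen J)
    (hIz : IsOpen Iz) : ∃ D Q, Represents m ε δ J Iz h φ D Q := by
  obtain ⟨D, hD0, hD1, hD2, hD3, hD4⟩ := hsol.regular_h
  obtain ⟨Q, hQ0, hQ1, hQ2, hQ3, hQ4⟩ := hsol.regular_phi
  -- The potential is treated as a kinetic function that is constant in `v`; its family of
  -- derivatives is sampled at `v = 0`.
  have hφ : ∀ t x z, φ t x z = Q 0 0 0 0 t x 0 z := fun t x z => by rw [hQ0]
  have hg : ∀ t ∈ J, ∀ x : ℝ, ∀ z ∈ Iz, gradPhi φ t x z = field Q 0 0 t x z := by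
    intro t ht x z hz
    unfold gradPhi
    simp only [hφ]
    exact (hQ3 0 0 0 0 (by omega) (Nat.zero_le m) t ht x 0 z hz).2.1.deriv
  refine ⟨D, Q, ⟨hJ, hIz, ⟨hD1, hD2, hD3, hD4⟩, ⟨hQ1, hQ2, hQ3, hQ4⟩, ?_, ?_⟩, hD0.symm, hg⟩
  · intro t ht x v z hz
    have hk := hsol.kinetic t ht x v z hz
    rw [← hD0] at hk
    have hd := fun v => hD3 0 0 0 0 (by omega) (Nat.zero_le m) t ht x v z hz
    have hd1 := fun v => (hD3 0 0 1 0 (by omega) (Nat.zero_le m) t ht x v z hz).2.2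
    rw [linFP_eq (fun v => (hd v).2.2) hd1, hg t ht x z hz, (hd v).1.deriv, (hd v).2.1.deriv,
      (hd v).2.2.deriv] at hk
    linarith
  · intro t ht x z hz
    have hp := hsol.poisson t ht x z hz
    simp only [hφ] at hp
    rw [iteratedDeriv_eqOn isOpen_univ (F := fun k y => Q 0 k 0 0 t y 0 z) (n := 2)
      (fun _ _ => rfl) (fun k hk y _ =>
        (hQ3 0 k 0 0 (by omega) (Nat.zero_le m) t ht y 0 z hz).2.1) 2 le_rfl (mem_univ x),
      ← hD0] at hp
    exact hp

namespace Represents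

variable {i l : ℕ} {t : ℝ}

theorem dzxMac_gradPhi (R : Represents m ε δ J Iz h φ D Q) (hi : i ≤ 1) (hl : l ≤ m)
    (ht : t ∈ J) (x : ℝ) {z : ℝ} (hz : z ∈ Iz) :
    dzxMac l i (gradPhi φ) t x z = field Q i l t x z :=
  iteratedDeriv_iteratedDeriv_eq R.sys.openIz (G := gradPhi φ t)
    (A := fun i l x z => field Q i l t x z) (fun x z hz => R.grad_eq t ht x z hz)
    (fun i' hi' x z hz => R.sys.famQ.hasDerivAt_field_x (by omega) (Nat.zero_le m) ht x hz)
    (fun l' hl' x z hz => R.sys.famQ.hasDerivAt_field_z (by omega) (by omega) ht x hz) x hz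

theorem iteratedDeriv_moment (R : Represents m ε δ J Iz h φ D Q) (ht : t ∈ J) {ψ : ℝ → ℝ}
    (hψ : Rapid ψ) (hi : i ≤ 1) (hl : l ≤ m) (x : ℝ) {z : ℝ} (hz : z ∈ Iz) :
    iteratedDeriv l (fun z' => iteratedDeriv i (fun x' => ∫ v, h t x' v z' * ψ v) x) z
      = moment D ψ 0 i l t x z := by
  rw [R.h_eq]
  exact iteratedDeriv_iteratedDeriv_eq R.sys.openIz
    (A := fun i l x z => moment D ψ 0 i l t x z) (fun x z hz => rfl)
    (fun i' hi' x z hz => R.sys.famD.hasDerivAt_moment_x hψ (by omega) (Nat.zero_le m) ht x hz)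
    (fun l' hl' x z hz => R.sys.famD.hasDerivAt_moment_z R.sys.openIz hψ (by omega) (by omega)
      ht x hz) x hz

theorem dzxMac_sigma (R : Represents m ε δ J Iz h φ D Q) (hi : i ≤ 1) (hl : l ≤ m)
    (ht : t ∈ J) (x : ℝ) {z : ℝ} (hz : z ∈ Iz) : dzxMac l i (sigma h) t x z = sig D i l t x z :=
  R.iteratedDeriv_moment ht rapid_sqrtM hi hl x hz

theorem dzxMac_vel (R : Represents m ε δ J Iz h φ D Q) (hi : i ≤ 1) (hl : l ≤ m)
    (ht : t ∈ J) (x : ℝ) {z : ℝ} (hz : z ∈ Iz) : dzxMac l i (vel h) t x z = cur D i l t x z :=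
  R.iteratedDeriv_moment ht rapid_id_mul_sqrtM hi hl x hz

theorem dzx_h (R : Represents m ε δ J Iz h φ D Q) (hi : i ≤ 1) (hl : l ≤ m)
    (ht : t ∈ J) (x v : ℝ) {z : ℝ} (hz : z ∈ Iz) : dzx l i h t x v z = D 0 i 0 l t x v z := by
  rw [R.h_eq]
  exact iteratedDeriv_iteratedDeriv_eq R.sys.openIz
    (A := fun i l x z => D 0 i 0 l t x v z) (fun x z hz => rfl)
    (fun i' hi' x z hz => (R.sys.famD.deriv 0 i' 0 0 (by omega) (Nat.zero_le m) t ht x v z hz).2.1)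
    (fun l' hl' x z hz => R.sys.famD.deriv_z 0 i 0 l' (by omega) (by omega) t ht x v z hz) x hz

theorem dzx_micro (R : Represents m ε δ J Iz h φ D Q) (hi : i ≤ 1) (hl : l ≤ m)
    (ht : t ∈ J) (x v : ℝ) {z : ℝ} (hz : z ∈ Iz) :
    dzx l i (micro h) t x v z = microPart D i l t x v z := by
  have hD := R.sys.famD
  rw [R.h_eq]
  exact iteratedDeriv_iteratedDeriv_eq R.sys.openIz
    (A := fun i l x z => microPart D i l t x v z) (fun x z hz => rfl)
    (fun i' hi' x z hz =>
      ((hD.deriv 0 i' 0 0 (by omega) (Nat.zero_le m) t ht x v z hz).2.1.fun_sub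
        ((hD.hasDerivAt_moment_x rapid_sqrtM (by omega) (Nat.zero_le m) ht x hz).mul_const _)).fun_sub
        ((hD.hasDerivAt_moment_x rapid_id_mul_sqrtM (by omega) (Nat.zero_le m) ht x hz).mul_const _))
    (fun l' hl' x z hz =>
      ((hD.deriv_z 0 i 0 l' (by omega) (by omega) t ht x v z hz).fun_sub
        ((hD.hasDerivAt_moment_z R.sys.openIz rapid_sqrtM (by omega) (by omega) ht x hz).mul_const
          _)).fun_sub
        ((hD.hasDerivAt_moment_z R.sys.openIz rapid_id_mul_sqrtM (by omega) (by omega) ht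
          x hz).mul_const _)) x hz

theorem innerMac_eq (hπ : IsDensity Iz dens) {G K G' K' : ℝ → ℝ → ℝ}
    (hG : ∀ x, ∀ z ∈ Iz, G x z = G' x z) (hK : ∀ x, ∀ z ∈ Iz, K x z = K' x z) :
    innerMac Iz dens G K = ∫ p, G' p.1 p.2 * K' p.1 p.2 ∂(xzMeasure Iz dens) := by
  refine integral_congr_ae ?_
  filter_upwards [hπ.xz_ae_mem] with p hp
  rw [hG p.1 p.2 hp, hK p.1 p.2 hp]

theorem sobSqMac_eq (hπ : IsDensity Iz dens) {G : ℝ → ℝ → ℝ → ℝ} {A : ℕ → ℕ → ℝ → ℝ → ℝ}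
    (hG : ∀ i ≤ 1, ∀ l ≤ m, ∀ x, ∀ z ∈ Iz, dzxMac l i G t x z = A i l x z) :
    sobSqMac Iz dens m G t
      = sumIndex m fun i l => ∫ p, A i l p.1 p.2 ^ 2 ∂(xzMeasure Iz dens) :=
  sumIndex_congr (f := fun i l => normSqMac Iz dens (dzxMac l i G t)) fun i hi l hl => by
    unfold normSqMac
    rw [innerMac_eq hπ (hG i hi l hl) (hG i hi l hl)]
    simp only [sq]

theorem Ephi_eq (R : Represents m ε δ J Iz h φ D Q) (hπ : IsDensity Iz dens) (ht : t ∈ J) :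
    Ephi Iz dens m φ t
      = sumIndex m fun i l => ∫ p, field Q i l t p.1 p.2 ^ 2 ∂(xzMeasure Iz dens) :=
  sobSqMac_eq hπ fun _ hi _ hl x _ hz => R.dzxMac_gradPhi hi hl ht x hz

theorem Du_eq (R : Represents m ε δ J Iz h φ D Q) (hπ : IsDensity Iz dens) (ht : t ∈ J) :
    Du Iz dens m h t
      = sumIndex m fun i l => ∫ p, cur D i l t p.1 p.2 ^ 2 ∂(xzMeasure Iz dens) :=
  sobSqMac_eq hπ fun _ hi _ hl x _ hz => R.dzxMac_vel hi hl ht x hz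

theorem Dsigma_eq (R : Represents m ε δ J Iz h φ D Q) (hπ : IsDensity Iz dens) (ht : t ∈ J) :
    Dsigma Iz dens m h t
      = sumIndex m fun i l => ∫ p, sig D i l t p.1 p.2 ^ 2 ∂(xzMeasure Iz dens) :=
  sobSqMac_eq hπ fun _ hi _ hl x _ hz => R.dzxMac_sigma hi hl ht x hz

theorem Eh_eq (R : Represents m ε δ J Iz h φ D Q) (hπ : IsDensity Iz dens) (ht : t ∈ J) :
    Eh Iz dens m h t = sumIndex m fun i l => ∫ q, D 0 i 0 l t q.1.1 q.2 q.1.2 ^ 2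
      ∂(xzvMeasure Iz dens) := by
  have := hπ.prob
  refine sumIndex_congr (f := fun i l => normSq Iz dens (dzx l i h t)) fun i hi l hl => ?_
  unfold normSq
  rw [integral_reorder fun x v z => dzx l i h t x v z ^ 2]
  refine integral_congr_ae ?_
  filter_upwards [hπ.xzv_ae_mem] with q hq
  rw [R.dzx_h hi hl ht q.1.1 q.2 hq]

theorem Dh_eq (R : Represents m ε δ J Iz h φ D Q) (H : EnergyData m ε δ J Iz dens D Q t) :
    Dh Iz dens m h t = sumIndex m fun i l => EnergyData.nuSq Iz dens D i l t := by
  have := H.density.prob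
  refine sumIndex_congr (f := fun i l => nuNormSq Iz dens (dzx l i (micro h) t))
    fun i hi l hl => ?_
  unfold nuNormSq EnergyData.nuSq
  rw [integral_reorder fun x v z => (1 + v ^ 2) * dzx l i (micro h) t x v z ^ 2
    + deriv (fun w => dzx l i (micro h) t x w z) v ^ 2]
  refine integral_congr_ae ?_
  filter_upwards [H.density.xzv_ae_mem] with q hq
  simp only [R.dzx_micro hi hl H.mem q.1.1 _ hq,
    (H.hasDerivAt_microPart hi hl q.1.1 q.2 hq).deriv]

theorem Gmac_eq (R : Represents m ε δ J Iz h φ D Q) (hπ : IsDensity Iz dens) (ht : t ∈ J) :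
    Gmac Iz dens m ε h φ t = (sumIndex m fun i l => ∫ p, cur D i l t p.1 p.2
          * field Q i l t p.1 p.2 ∂(xzMeasure Iz dens))
        + 1 / (2 * ε) * sumIndex m fun i l => ∫ p, field Q i l t p.1 p.2 ^ 2
          ∂(xzMeasure Iz dens) := by
  unfold Gmac
  rw [R.Ephi_eq hπ ht]
  congr 1
  rw [← sumIndex_congr (f := fun i l => innerMac Iz dens (dzxMac l i (vel h) t)
    (dzxMac l i (gradPhi φ) t)) fun i hi l hl => innerMac_eq hπ
      (fun x z hz => R.dzxMac_vel hi hl ht x hz) (fun x z hz => R.dzxMac_gradPhi hi hl ht x hz)]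
  unfold sumIndex
  exact ((Finset.sum_range_succ _ 1).trans (by rw [Finset.sum_range_one])).symm

theorem energyData (R : Represents m ε δ J Iz h φ D Q) (hm : 1 ≤ m) (hπ : IsDensity Iz dens)
    (hsol : IsSolution m ε δ J Iz dens h φ) (ht : t ∈ J) : EnergyData m ε δ J Iz dens D Q t := by
  have := hπ.prob
  have hJt := R.sys.openJ.mem_nhds ht
  have hDt : ∀ i ≤ 1, ∀ l ≤ m, ∀ x v, ∀ z ∈ Iz,
      deriv (fun s => dzx l i h s x v z) t = D 1 i 0 l t x v z := fun i hi l hl x v z hz => by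
    rw [(Filter.eventuallyEq_of_mem hJt fun s hs => R.dzx_h hi hl hs x v hz).deriv_eq]
    exact (R.sys.famD.deriv 0 i 0 l (by omega) hl t ht x v z hz).1.deriv
  have hQt : ∀ i ≤ 1, ∀ l ≤ m, ∀ x, ∀ z ∈ Iz,
      deriv (fun s => dzxMac l i (gradPhi φ) s x z) t = Q 1 (i + 1) 0 l t x 0 z :=
    fun i hi l hl x z hz => by
    rw [(Filter.eventuallyEq_of_mem hJt fun s hs => R.dzxMac_gradPhi hi hl hs x hz).deriv_eq]
    exact (R.sys.famQ.deriv 0 (i + 1) 0 l (by omega) hl t ht x 0 z hz).1.deriv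
  have hae := hπ.xzv_ae_mem
  refine ⟨R.sys, hπ, ht, hm, fun i hi l hl => ?_, fun i hi l hl => ?_, fun i hi l hl => ?_,
    fun i hi l hl => ?_, fun i hi l hl => ?_, fun i hi l hl => ?_⟩
  · refine (memLp_reorder (F := dzx l i h t) (hsol.energy_h t ht i hi l hl)).ae_eq ?_
    filter_upwards [hae] with q hq using R.dzx_h hi hl ht _ _ hq
  · refine (memLp_reorder (F := fun x v z => v * dzx l i h t x v z)
      (hsol.weight_h t ht i hi l hl)).ae_eq ?_
    filter_upwards [hae] with q hq
    rw [R.dzx_h hi hl ht _ _ hq]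
  · refine (memLp_reorder (F := fun x v z => deriv (fun w => dzx l i h t x w z) v)
      (hsol.dv_h t ht i hi l hl)).ae_eq ?_
    filter_upwards [hae] with q hq
    simp only [R.dzx_h hi hl ht _ _ hq]
    exact (R.sys.famD.deriv 0 i 0 l (by omega) hl t ht _ _ _ hq).2.2.deriv
  · refine (hsol.energy_phi t ht i hi l hl).ae_eq ?_
    filter_upwards [hπ.xz_ae_mem] with q hq using R.dzxMac_gradPhi hi hl ht _ hq
  · have h0 : HasL2DerivAt (xvzMeasure Iz dens) (fun s p => dzx l i h s p.1 p.2.1 p.2.2)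
        (fun p => deriv (fun s => dzx l i h s p.1 p.2.1 p.2.2) t) t :=
      ⟨Filter.eventually_of_mem hJt fun s hs => hsol.energy_h s hs i hi l hl,
        (hsol.dt_h t ht i hi l hl).1, (hsol.dt_h t ht i hi l hl).2⟩
    refine (h0.comp_measurePreserving measurePreserving_reorder).congr ?_ ?_
    · filter_upwards [hJt] with s hs
      filter_upwards [hae] with q hq using (R.dzx_h hi hl hs _ _ hq).symm
    · filter_upwards [hae] with q hq using (hDt i hi l hl _ _ _ hq).symm
  · have h0 : HasL2DerivAt (xzMeasure Iz dens) (fun s p => dzxMac l i (gradPhi φ) s p.1 p.2)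
        (fun p => deriv (fun s => dzxMac l i (gradPhi φ) s p.1 p.2) t) t :=
      ⟨Filter.eventually_of_mem hJt fun s hs => hsol.energy_phi s hs i hi l hl,
        (hsol.dt_phi t ht i hi l hl).1, (hsol.dt_phi t ht i hi l hl).2⟩
    refine h0.congr ?_ ?_
    · filter_upwards [hJt] with s hs
      filter_upwards [hπ.xz_ae_mem] with q hq using (R.dzxMac_gradPhi hi hl hs _ hq).symm
    · filter_upwards [hπ.xz_ae_mem] with q hq using (hQt i hi l hl _ _ hq).symm

end Represents

end VPFP

end

/-! ### The two inequalities for a solution. -/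

theorem lemma3p2 (m : ℕ) (hm : 1 ≤ m) (ε δ : ℝ) (hε : 0 < ε) (hδ : 0 < δ)
    (J Iz : Set ℝ) (hJ : IsOpen J) (dens : ℝ → ℝ) (hdens : VPFP.IsDensity Iz dens)
    (C₁ : ℝ) (hC₁ : VPFP.IsSobolevConst Iz dens C₁)
    (h : ℝ → ℝ → ℝ → ℝ → ℝ) (φ : ℝ → ℝ → ℝ → ℝ)
    (hsol : VPFP.IsSolution m ε δ J Iz dens h φ) (t : ℝ) (ht : t ∈ J) :
    -- microscopic inequality
    (DifferentiableAt ℝ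
        (fun s => VPFP.Eh Iz dens m h s + δ / ε * VPFP.Ephi Iz dens m φ s) t ∧
      ∀ a : ℝ, 0 < a →
        1 / 2 * deriv (fun s => VPFP.Eh Iz dens m h s + δ / ε * VPFP.Ephi Iz dens m φ s) t
            + VPFP.lambda0 / (δ * ε) * VPFP.Dh Iz dens m h t
            + 1 / (δ * ε) * VPFP.Du Iz dens m h t
          ≤ VPFP.constA m * C₁ ^ 2 / (a * ε) * Real.sqrt (VPFP.Eh Iz dens m h t)
                * (3 * VPFP.Du Iz dens m h t + 2 * VPFP.Dh Iz dens m h t)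
            + 2 * VPFP.constA m * C₁ ^ 2 / ε * Real.sqrt (VPFP.Ephi Iz dens m φ t)
                * ((4 + 1 / a) * VPFP.Du Iz dens m h t + 4 * VPFP.Dh Iz dens m h t)
            + a * VPFP.constA m * C₁ ^ 2 / ε * Real.sqrt (VPFP.Eh Iz dens m h t)
                * VPFP.Dphi Iz dens m φ t
            + a * VPFP.constA m * C₁ ^ 2 / ε * Real.sqrt (VPFP.Ephi Iz dens m φ t)
                * VPFP.Dsigma Iz dens m h t) ∧
    -- macroscopic inequality
    (DifferentiableAt ℝ (VPFP.Gmac Iz dens m ε h φ) t ∧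
      deriv (VPFP.Gmac Iz dens m ε h φ) t
          + 1 / (2 * δ) * VPFP.Dsigma Iz dens m h t
          + 1 / ε * VPFP.Dphi Iz dens m φ t
        ≤ 1 / δ * VPFP.Du Iz dens m h t
          + 1 / (2 * δ) * VPFP.Dh Iz dens m h t
          + VPFP.constA m * C₁ ^ 2 / ε * Real.sqrt (VPFP.Ephi Iz dens m φ t)
              * (3 * VPFP.Dsigma Iz dens m h t + 2 * VPFP.Dphi Iz dens m φ t)) := by
  obtain ⟨D, Q, R⟩ := hsol.exists_represents hJ hdens.isOpen
  have H := R.energyData hm hdens hsol ht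
  have hJt := hJ.mem_nhds ht
  constructor
  · obtain ⟨X, hX, hle⟩ := H.micro_inequality hε hδ hC₁
    -- The functionals agree with their expressions through the derivative families at every time of
    -- the open set `J`, hence near `t`, so the derivative carries over.
    have hX' := hX.congr_of_eventuallyEq (Filter.eventuallyEq_of_mem hJt fun s hs => by
      rw [← R.Eh_eq hdens hs, ← R.Ephi_eq hdens hs] :
      (fun s => VPFP.Eh Iz dens m h s + δ / ε * VPFP.Ephi Iz dens m φ s) =ᶠ[nhds t] _)
    refine ⟨hX'.differentiableAt, fun a ha => ?_⟩
    -- The energy of `h` enters only through nonnegative slack terms, so the inequality is available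
    -- with an arbitrary value there and is specialized to `E_h`.
    have := hle a (VPFP.Eh Iz dens m h t) ha
    rw [← R.Dh_eq H, ← R.Du_eq hdens ht, ← R.Dsigma_eq hdens ht, ← R.Ephi_eq hdens ht] at this
    rw [hX'.deriv, mul_assoc 2, mul_assoc a]
    exact this
  · obtain ⟨X, hX, hle⟩ := H.macro_inequality hε hδ hC₁
    have hX' := hX.congr_of_eventuallyEq (Filter.eventuallyEq_of_mem hJt fun s hs =>
      R.Gmac_eq hdens hs)
    refine ⟨hX'.differentiableAt, ?_⟩
    rw [← R.Dh_eq H, ← R.Du_eq hdens ht, ← R.Dsigma_eq hdens ht, ← R.Ephi_eq hdens ht] at hle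
    rw [hX'.deriv]
    exact hle
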